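/- **Setting.** Let $d\ge 1$, $\alpha\in(0,1]$, $\lambda>0$, and let $m:[0,\infty)\to\mathbb R$ be Borel measurable with $m(r)>0$ for a.e. $r>0$. Let $\mathbb H$ be a closed subspace of $L^2(\mathbb R^d,dx)$ (complex valued), and let $A$ be a self-adjoint operator on $\mathbb H$ with $A=\mathcal F^{-1}\,m\,\mathcal F$, i.e. $D(A)=\{f\in\mathbb H:\ m(\|\cdot\|)\,\widehat f\in L^2(\mathbb R^d)\}$ and $\widehat{Af}(\xi)=m(\|\xi\|)\widehat f(\xi)$, where $\widehat f(\xi)=\int_{\mathbb R^d}e^{i\langle x,\xi\rangle}f(x)\,dx$ (extended to $L^2$ by Plancherel). For $u:[0,\infty)\to\mathbb H$ absolutely continuous on bounded intervals and a.e. differentiable, let $D_t^\alpha u(t)=\frac1{\Gamma(1-\alpha)}\int_0^t(t-\tau)^{-\alpha}u'(\tau)\,d\tau$ (Bochner integral) if $\alpha<1$, and $D_t^1u=u'$. For $f\in D(A)$ consider the Cauchy problem $$\big[(D_t^\alpha)^2+2\lambda D_t^\alpha+A\big]u(t)=0\quad(t>0),\qquad u(0)=f,\qquad D_t^\alpha u(0)=0,\qquad(\ast)$$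 where $(D_t^\alpha)^2=D_t^\alpha D_t^\alpha$; $u(t)\in D(A)$ and the two Caputo derivatives exist for every $t>0$; $u$ and $D_t^\alpha u$ are absolutely continuous on bounded intervals and a.e. differentiable; and $D_t^\alpha u(0)=\lim_{t\downarrow0}D_t^\alpha u(t)$. Put $E_{a,b}(z)=\sum_{k\ge0}z^k/\Gamma(ak+b)$, $r_{1,2}=-\lambda\pm\sqrt{\lambda^2-m(r)}$ and $$\widehat\Phi_\alpha(t,r)=\frac12\left[\Big(1+\frac{\lambda}{\sqrt{\lambda^2-m(r)}}\Big)E_{\alpha,1}(r_1t^\alpha)+\Big(1-\frac{\lambda}{\sqrt{\lambda^2-m(r)}}\Big)E_{\alpha,1}(r_2t^\alpha)\right],$$ to be read at $m(r)=\lambda^2$ as its limit $E_{\alpha,1}(-\lambda t^\alpha)+\frac{\lambda t^\alpha}{\alpha}E_{\alpha,\alpha}(-\lambda t^\alpha)$. **Theorem.** For every $f\in D(A)$ the problem $(\ast)$ has exactly one solution $u_\alpha$, and for every $t>0$ $$u_\alpha(t)=f\ast\Phi_\alpha(t),\qquad \Phi_\alpha(t,x)=\frac{1}{(2\pi)^{d/2}\|x\|^{d/2-1}}\int_0^\infty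 r^{d/2}J_{d/2-1}(r\|x\|)\,\widehat\Phi_\alpha(t,r)\,dr ,$$ where $J_\nu$ is the Bessel function of the first kind, and kernel and convolution are understood as follows. 1. In general, with $\Phi_\alpha^R(t,x)$ denoting the right-hand side with $\int_0^R$ in place of $\int_0^\infty$ (an absolutely convergent integral for $x\ne0$), $\Phi_\alpha^R(t)$ converges as $R\to\infty$ to a tempered distribution $\Phi_\alpha(t)$, independent of $f$, and $u_\alpha(t)=f\ast\Phi_\alpha(t)$ in the sense that $\int u_\alpha(t,x)\varphi(x)\,dx=\int f(x)\,\langle\Phi_\alpha(t),\varphi(x+\cdot)\rangle\,dx$ for all Schwartz functions $\varphi$, with absolutely convergent integrals. 2. If $\int_0^\infty r^{d-1}|\widehat\Phi_\alpha(t,r)|^2dr<\infty$, then the distribution $\Phi_\alpha(t)$ is a function in $L^2(\mathbb R^d)$, $\Phi_\alpha^R(t)\to\Phi_\alpha(t)$ in $L^2$, and $\Phi_\alpha(t,x)$ is the value of the improper integral $\lim_{R\to\infty}\Phi_\alpha^R(t,x)$ at almost every $x$ at which this limit exists. The integral $(f\ast\Phi_\alpha(t))(x)=\int f(y)\Phi_\alpha(t,x-y)\,dy$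 converges absolutely for each $x\in\mathbb R^d$, is continuous in $x$, and is a representative of $u_\alpha(t,\cdot)$. 3. If $\int_0^\infty r^{d-1}|\widehat\Phi_\alpha(t,r)|\,dr<\infty$, then the integral defining $\Phi_\alpha(t,x)$ converges absolutely for every $x\neq0$, the distribution $\Phi_\alpha(t)$ is this function, and $u_\alpha(t,x)=(f\ast\Phi_\alpha(t))(x)$ in the same pointwise sense as in 2. -/

import Mathlib

open MeasureTheory Set Filter Topology
open scoped FourierTransform SchwartzMap

noncomputable section

namespace FracTelegraph

/-! ### Special functions -/

/-- The Mittag-Leffler function `E_{a,b}(z) = ∑ z ^ k / Γ(a k + b)`, for `a, b > 0`. -/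
def mittagLeffler (a b : ℝ) (z : ℂ) : ℂ :=
  ∑' k : ℕ, z ^ k / (Real.Gamma (a * k + b) : ℂ)

/-- The Bessel function of the first kind
`J_ν(x) = ∑ (-1) ^ k / (k! Γ(k + ν + 1)) (x / 2) ^ (2 k + ν)`, for `ν > -1` and `x > 0`. -/
def besselJ (ν x : ℝ) : ℝ :=
  (x / 2) ^ ν * ∑' k : ℕ,
    (-1) ^ k / ((k.factorial : ℝ) * Real.Gamma (k + ν + 1)) * (x / 2) ^ (2 * k)

/-- The Fourier multiplier of the telegraph problem at a frequency where the symbol takes the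
value `μ`:
`½ [(1 + λ/s) E_{α,1}(r₁ t^α) + (1 - λ/s) E_{α,1}(r₂ t^α)]` with `s = √(λ² - μ)`,
`r₁ = -λ + s`, `r₂ = -λ - s`. At `μ = λ²` (where `s = 0`) it is the limit of this expression,
`E_{α,1}(-λ t^α) + (λ t^α / α) E_{α,α}(-λ t^α)`. -/
def multiplier (α lam t μ : ℝ) : ℂ :=
  let T : ℂ := ((t ^ α : ℝ) : ℂ)
  let s : ℂ := ((lam ^ 2 - μ : ℝ) : ℂ) ^ (1 / 2 : ℂ)
  if μ = lam ^ 2 then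
    mittagLeffler α 1 (-lam * T) + lam * T / α * mittagLeffler α α (-lam * T)
  else
    1 / 2 * ((1 + lam / s) * mittagLeffler α 1 ((-lam + s) * T)
      + (1 - lam / s) * mittagLeffler α 1 ((-lam - s) * T))

/-! ### The Caputo derivative and the abstract Cauchy problem -/

section Abstract

variable {E : Type*} [NormedAddCommGroup E] [NormedSpace ℝ E]

/-- The Caputo derivative of order `α ∈ (0, 1]` at `t > 0`, with a Bochner integral:
`1 / Γ(1 - α) ∫₀ᵗ (t - τ) ^ (-α) u'(τ) dτ` for `α < 1` and `u'(t)` for `α = 1`. -/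
def caputo (α : ℝ) (u : ℝ → E) (t : ℝ) : E :=
  if α = 1 then deriv u t
  else (Real.Gamma (1 - α))⁻¹ • ∫ τ in (0 : ℝ)..t, (t - τ) ^ (-α) • deriv u τ

/-- `u : [0, ∞) → E` is (locally) absolutely continuous and a.e. differentiable, and its Caputo
derivative of order `α` makes sense at every `t > 0`. Values at negative times are irrelevant. -/
structure CaputoDifferentiable (α : ℝ) (u : ℝ → E) : Prop where
  absCont : ∀ T : ℝ, 0 < T → AbsolutelyContinuousOnInterval u 0 T
  ae_differentiable : ∀ᵐ t ∂volume.restrict (Ioi (0 : ℝ)), DifferentiableAt ℝ u t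
  exists_caputo : ∀ t : ℝ, 0 < t →
    if α = 1 then DifferentiableAt ℝ u t
    else IntervalIntegrable (fun τ : ℝ => (t - τ) ^ (-α) • deriv u τ) volume 0 t

end Abstract

/-- `u` solves `(D^α)² u + 2 λ D^α u + A u = 0` for `t > 0`, `u(0) = f`, `D^α u(0) = 0`.
Here `w` is `D^α u` on `(0, ∞)`, extended to `t = 0` by the initial value `0`; since `w` is
absolutely continuous on `[0, T]`, this says that `D^α u(t)` tends to `0` as `t` tends to `0`. -/
structure IsSolution {E : Type*} [NormedAddCommGroup E] [NormedSpace ℝ E] [Module ℂ E]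
    (A : E →ₗ.[ℂ] E) (α lam : ℝ) (f : E) (u : ℝ → E) : Prop where
  caputoDifferentiable : CaputoDifferentiable α u
  initial : u 0 = f
  mem_domain : ∀ t : ℝ, 0 < t → u t ∈ A.domain
  equation : ∃ w : ℝ → E, (∀ t : ℝ, 0 < t → w t = caputo α u t) ∧ w 0 = 0 ∧
    CaputoDifferentiable α w ∧
    ∀ (t : ℝ) (ht : 0 < t),
      caputo α w t + (2 * lam) • w t + A ⟨u t, mem_domain t ht⟩ = 0

/-! ### The Fourier side -/

/-- `L²(ℝ^d, dx)`, complex valued. -/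
abbrev L2 (d : ℕ) : Type := Lp ℂ 2 (volume : Measure (EuclideanSpace ℝ (Fin d)))

/-- The Fourier-Plancherel transform with the normalisation `∫ exp(i ⟨x, ξ⟩) f(x) dx`, from
Mathlib's, which is `∫ exp(-2 π i ⟨x, ξ⟩) f(x) dx`. It is meaningful for almost every `ξ`. -/
def fourierL2 {d : ℕ} (f : L2 d) (ξ : EuclideanSpace ℝ (Fin d)) : ℂ :=
  (𝓕 f : L2 d) (-(2 * Real.pi)⁻¹ • ξ)

/-- `A = 𝓕⁻¹ m 𝓕` on the subspace `H` of `L²(ℝ^d)`, with the radial symbol `m(‖ξ‖)` and the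
domain `{f ∈ H : m f̂ ∈ L²}`. -/
structure IsRadialFourierMultiplier {d : ℕ} (m : ℝ → ℝ) (H : Submodule ℂ (L2 d))
    (A : H →ₗ.[ℂ] H) : Prop where
  mem_domain_iff : ∀ f : H, f ∈ A.domain ↔
    MemLp (fun ξ => (m ‖ξ‖ : ℂ) * fourierL2 (f : L2 d) ξ) 2 volume
  fourier_apply : ∀ f : A.domain,
    fourierL2 ((A f : H) : L2 d) =ᵐ[volume]
      fun ξ => (m ‖ξ‖ : ℂ) * fourierL2 ((f : H) : L2 d) ξ

/-! ### The kernel -/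

/-- The integrand `r^{d/2} J_{d/2-1}(r ‖x‖) Φ̂_α(t, r)`. -/
def hankelIntegrand (d : ℕ) (α lam : ℝ) (m : ℝ → ℝ) (t : ℝ) (x : EuclideanSpace ℝ (Fin d))
    (r : ℝ) : ℂ :=
  ((r ^ ((d : ℝ) / 2) * besselJ ((d : ℝ) / 2 - 1) (r * ‖x‖) : ℝ) : ℂ) * multiplier α lam t (m r)

/-- The prefactor `1 / ((2 π)^{d/2} ‖x‖^{d/2-1})`. -/
def hankelPrefactor (d : ℕ) (x : EuclideanSpace ℝ (Fin d)) : ℂ :=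
  ((1 / ((2 * Real.pi) ^ ((d : ℝ) / 2) * ‖x‖ ^ ((d : ℝ) / 2 - 1)) : ℝ) : ℂ)

/-- The kernel `Φ_α(t, x)` as a Lebesgue integral over `(0, ∞)`. -/
def hankelKernel (d : ℕ) (α lam : ℝ) (m : ℝ → ℝ) (t : ℝ) (x : EuclideanSpace ℝ (Fin d)) : ℂ :=
  hankelPrefactor d x * ∫ r in Ioi (0 : ℝ), hankelIntegrand d α lam m t x r

/-- The kernel with the integral over `(0, R)`. -/
def truncatedKernel (d : ℕ) (α lam : ℝ) (m : ℝ → ℝ) (t R : ℝ)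
    (x : EuclideanSpace ℝ (Fin d)) : ℂ :=
  hankelPrefactor d x * ∫ r in (0 : ℝ)..R, hankelIntegrand d α lam m t x r

/-- The tempered distribution `K` is given by the locally integrable function `k`. -/
def IsRepresentedBy {d : ℕ} (K : 𝓢'(EuclideanSpace ℝ (Fin d), ℂ))
    (k : EuclideanSpace ℝ (Fin d) → ℂ) : Prop :=
  ∀ φ : 𝓢(EuclideanSpace ℝ (Fin d), ℂ),
    Integrable (fun x => k x * φ x) volume ∧ K φ = ∫ x, k x * φ x

/-- `K` is the Hankel-type integral `∫₀^∞`, as the limit of `∫₀^R` in the sense of tempered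
distributions. -/
def IsHankelKernel (d : ℕ) (α lam : ℝ) (m : ℝ → ℝ) (t : ℝ)
    (K : 𝓢'(EuclideanSpace ℝ (Fin d), ℂ)) : Prop :=
  (∀ x : EuclideanSpace ℝ (Fin d), x ≠ 0 → ∀ R : ℝ, 0 < R →
    IntervalIntegrable (hankelIntegrand d α lam m t x) volume 0 R) ∧
  ∀ φ : 𝓢(EuclideanSpace ℝ (Fin d), ℂ),
    (∀ R : ℝ, 0 < R → Integrable (fun x => truncatedKernel d α lam m t R x * φ x) volume) ∧
    Tendsto (fun R : ℝ => ∫ x, truncatedKernel d α lam m t R x * φ x) atTop (𝓝 (K φ))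

/-- `g = f ∗ K` for a function `f` and a tempered distribution `K`:
`⟨f ∗ K, φ⟩ = ∫ f(x) ⟨K, φ(x + ·)⟩ dx` for every Schwartz function `φ`. -/
def IsConvolution {d : ℕ} (f : L2 d) (K : 𝓢'(EuclideanSpace ℝ (Fin d), ℂ)) (g : L2 d) : Prop :=
  ∀ φ : 𝓢(EuclideanSpace ℝ (Fin d), ℂ),
    Integrable (fun x => f x * K (SchwartzMap.compSubConstCLM ℂ (-x) φ)) volume ∧
    ∫ x, g x * φ x = ∫ x, f x * K (SchwartzMap.compSubConstCLM ℂ (-x) φ)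

/-- `g = f ∗ k` for functions: the integral `∫ f(y) k(x - y) dy` converges absolutely at every
point `x`, is continuous in `x`, and is a representative of `g`. -/
def IsPointwiseConvolution {d : ℕ} (f : L2 d) (k : EuclideanSpace ℝ (Fin d) → ℂ) (g : L2 d) :
    Prop :=
  ConvolutionExists f k (ContinuousLinearMap.mul ℂ ℂ) volume ∧
  Continuous (convolution f k (ContinuousLinearMap.mul ℂ ℂ) volume) ∧
  g =ᵐ[volume] convolution f k (ContinuousLinearMap.mul ℂ ℂ) volume

end FracTelegraph

end

noncomputable section

namespace FracTelegraph

/-! ### The Beta integral and power series with Gamma denominators -/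

/-! The Fourier transform splits the problem into scalar equations (D^α)² y + 2λ D^α y + μ y = 0,
one for each value μ = m(‖ξ‖) of the symbol. Since D^α maps t^(αn+α)/Γ(αn+α+1) to t^(αn)/Γ(αn+1), a
series ∑ c_n t^(αn)/Γ(αn+1) solves the scalar equation as soon as its coefficients satisfy the
linear recursion with characteristic polynomial X² + 2λX + μ. Solving the recursion by its roots
gives the stated multiplier (`multiplier_eq_gammaSeries`). The series is entire in t^α and
continuous in μ, so the double root μ = λ² needs no separate treatment afterwards.

The analytic core is a bound for these series that is uniform in μ > 0 and in bounded t
(`exists_bound_gammaSeries_telegraphCoeff`). For μ below 2λ² the coefficients grow at a common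
geometric rate. For larger μ the roots are well separated and have real part -λ, so it suffices that
|E_{α,α}(z t^α)| ≤ 1/Γ(α) and |E_{α,1}(z t^α)| ≤ 1 whenever Re z ≤ 0. For α < 1 the first bound
comes from a maximum principle for the Riemann-Liouville derivative
(`pos_of_hasDerivAt_rlIntegral`), and the second follows by fractional integration; for α = 1 both
are bounds for the exponential.

Existence has to produce elements of the given subspace, not merely of L². Self-adjointness forces
the resolvent (1 + A)⁻¹ to act inside the subspace (`resolvent_mem`), and Weierstrass approximation
in the variable 1/(1 + μ) extends this to all bounded continuous functions of A
(`exists_functional_calculus`). Time derivatives of the scalar solution carry a factor μ, which is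
absorbed by f ∈ D(A); dominated convergence in L² then carries the scalar identities over to the
Hilbert space.

Uniqueness uses that fractional integration of order α inverts the Caputo derivative up to the
initial value. On the frequency band |m| ≤ N the equation is a linear system with bounded
coefficients, so a Gronwall lemma with the Abel kernel kills the difference of two solutions; then N
tends to infinity.

The Bessel function enters as the Fourier transform of the surface measure of the sphere, identified
through its moments (`hankelPrefactor_mul`). Hence the truncated kernel is the inverse Fourier
transform of the multiplier cut off at frequency R, and the kernel is the tempered distribution with
bounded Fourier transform Φ̂. The square integrable case is Plancherel's theorem; an integrable
multiplier, being bounded, is also square integrable. -/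

theorem integral_sub_rpow_mul_rpow {a b t : ℝ} (ha : 0 < a) (hb : 0 < b) (ht : 0 < t) :
    ∫ τ in (0 : ℝ)..t, (t - τ) ^ (b - 1) * τ ^ (a - 1) =
      Real.Gamma a * Real.Gamma b / Real.Gamma (a + b) * t ^ (a + b - 1) := by
  have h1 := Complex.betaIntegral_scaled (a : ℂ) (b : ℂ) ht
  have h2 := Complex.betaIntegral_eq_Gamma_mul_div (a : ℂ) (b : ℂ) (by simpa) (by simpa)
  rw [h2] at h1
  have h3 : ∫ x in (0 : ℝ)..t, (x : ℂ) ^ ((a : ℂ) - 1) * ((t : ℂ) - x) ^ ((b : ℂ) - 1)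
      = ∫ τ in (0 : ℝ)..t, (((t - τ) ^ (b - 1) * τ ^ (a - 1) : ℝ) : ℂ) := by
    apply intervalIntegral.integral_congr
    intro τ hτ
    rw [uIcc_of_le ht.le] at hτ
    push_cast
    rw [Complex.ofReal_cpow (by linarith [hτ.2]), Complex.ofReal_cpow hτ.1]
    push_cast
    ring
  rw [h3, intervalIntegral.integral_ofReal] at h1
  apply Complex.ofReal_injective
  rw [h1]
  push_cast [Complex.ofReal_cpow ht.le, ← Complex.Gamma_ofReal]
  ring

/-- Integrability is read off from the value: the integral of a non-integrable function is zero by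
convention, while the Beta integral is positive. -/
theorem intervalIntegrable_sub_rpow_mul_rpow {a b t : ℝ} (ha : 0 < a) (hb : 0 < b) (ht : 0 < t) :
    IntervalIntegrable (fun τ : ℝ => (t - τ) ^ (b - 1) * τ ^ (a - 1)) volume 0 t := by
  by_contra h
  have h1 := integral_sub_rpow_mul_rpow ha hb ht
  rw [intervalIntegral.integral_undef h] at h1
  have h2 : 0 < Real.Gamma a * Real.Gamma b / Real.Gamma (a + b) * t ^ (a + b - 1) := by
    have := Real.Gamma_pos_of_pos ha
    have := Real.Gamma_pos_of_pos hb
    have := Real.Gamma_pos_of_pos (add_pos ha hb)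
    positivity
  exact h2.ne h1

/-- Euler's integral is restricted to (K, K + 1]. As K is arbitrary, Γ outgrows every geometric
sequence. -/
theorem exp_mul_rpow_le_Gamma {K x : ℝ} (hK : 0 < K) (hx : 1 ≤ x) :
    Real.exp (-(K + 1)) * K ^ (x - 1) ≤ Real.Gamma x := by
  have hx0 : 0 < x := by linarith
  rw [Real.Gamma_eq_integral hx0]
  have hint := Real.GammaIntegral_convergent hx0
  have hsub : Ioc K (K + 1) ⊆ Ioi (0 : ℝ) := fun y hy => lt_trans hK hy.1
  calc Real.exp (-(K + 1)) * K ^ (x - 1)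
      = ∫ _ in Ioc K (K + 1), Real.exp (-(K + 1)) * K ^ (x - 1) := by simp
    _ ≤ ∫ y in Ioc K (K + 1), Real.exp (-y) * y ^ (x - 1) := by
        apply setIntegral_mono_on _ (hint.mono_set hsub) measurableSet_Ioc
        · intro y hy
          have : K ^ (x - 1) ≤ y ^ (x - 1) :=
            Real.rpow_le_rpow hK.le hy.1.le (by linarith)
          have h2 : Real.exp (-(K + 1)) ≤ Real.exp (-y) := Real.exp_le_exp.2 (by linarith [hy.2])
          gcongr
        · exact integrableOn_const (by simp)
    _ ≤ _ := by
        apply setIntegral_mono_set hint _ hsub.eventuallyLE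
        filter_upwards [ae_restrict_mem measurableSet_Ioi] with y hy
        have : (0 : ℝ) < y := hy
        positivity

theorem summable_pow_div_Gamma {α β : ℝ} (hα : 0 < α) (hβ : 0 < β) (K : ℝ) :
    Summable fun n : ℕ => K ^ n / Real.Gamma (α * n + β) := by
  -- With L ^ α = 2(|K| + 1), the bound Γ(αk + β) ≥ e^(-(L+1)) L^(αk+β-1) makes the terms decay like
  -- 2^(-k). It needs αk + β ≥ 1, whence the shift by N.
  set L : ℝ := (2 * (|K| + 1)) ^ (α⁻¹) with hL
  have hK0 : 0 < 2 * (|K| + 1) := by positivity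
  have hLpos : 0 < L := by positivity
  have hLα : L ^ α = 2 * (|K| + 1) := by
    rw [hL, ← Real.rpow_mul hK0.le, inv_mul_cancel₀ hα.ne', Real.rpow_one]
  obtain ⟨N, hN⟩ := exists_nat_ge (1 / α)
  rw [← summable_nat_add_iff N]
  set C : ℝ := Real.exp (L + 1) * L ^ (1 - β) with hC
  have hgeo : Summable fun n : ℕ => C * (1 / 2 : ℝ) ^ (n + N) := by
    apply Summable.mul_left
    rw [summable_nat_add_iff N (f := fun n : ℕ => (1 / 2 : ℝ) ^ n)]
    exact summable_geometric_of_lt_one (by norm_num) (by norm_num)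
  refine Summable.of_norm_bounded hgeo fun n => ?_
  set k := n + N with hk
  have hk1 : 1 ≤ α * k + β := by
    have : (1 / α) ≤ (k : ℝ) := hN.trans (by rw [hk]; push_cast; linarith [Nat.cast_nonneg (α := ℝ) n])
    have := (div_le_iff₀ hα).1 this
    linarith
  have hΓ := exp_mul_rpow_le_Gamma hLpos hk1
  have hpos : 0 < Real.exp (-(L + 1)) * L ^ (α * k + β - 1) := by positivity
  rw [norm_div, norm_pow, Real.norm_eq_abs, Real.norm_of_nonneg (hpos.le.trans hΓ)]
  have h1 : L ^ (α * k + β - 1) = (2 * (|K| + 1)) ^ k * L ^ (β - 1) := by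
    rw [show α * k + β - 1 = α * k + (β - 1) by ring, Real.rpow_add hLpos, Real.rpow_mul hLpos.le,
      hLα, Real.rpow_natCast]
  calc |K| ^ k / Real.Gamma (α * k + β)
      ≤ |K| ^ k / (Real.exp (-(L + 1)) * L ^ (α * k + β - 1)) := by gcongr
    _ = C * (|K| / (2 * (|K| + 1))) ^ k := by
        rw [h1, hC, Real.exp_neg, show 1 - β = -(β - 1) by ring, Real.rpow_neg hLpos.le, div_pow]
        field_simp
    _ ≤ C * (1 / 2) ^ k := by
        have : |K| / (2 * (|K| + 1)) ≤ 1 / 2 := by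
          rw [div_le_iff₀ hK0]; linarith [abs_nonneg K]
        gcongr ?_ * ?_ ^ k

/-- The power series `∑ a_n T ^ n / Γ(α n + β)`. -/
def gammaSeries (α β : ℝ) (a : ℕ → ℂ) (T : ℝ) : ℂ :=
  ∑' n : ℕ, a n * ((T ^ n / Real.Gamma (α * n + β) : ℝ) : ℂ)

/-- A coefficient sequence of at most geometric growth. -/
def GeomBounded (a : ℕ → ℂ) : Prop := ∃ C K : ℝ, ∀ n, ‖a n‖ ≤ C * K ^ n

theorem GeomBounded.shift {a : ℕ → ℂ} (ha : GeomBounded a) : GeomBounded fun n => a (n + 1) := by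
  obtain ⟨C, K, h⟩ := ha
  exact ⟨C * K, K, fun n => (h (n + 1)).trans_eq (by ring)⟩

theorem norm_gammaSeries_term_le {α β C K T : ℝ} (hα : 0 < α) (hβ : 0 < β) {a : ℕ → ℂ} {n : ℕ}
    (h : ‖a n‖ ≤ C * K ^ n) :
    ‖a n * ((T ^ n / Real.Gamma (α * n + β) : ℝ) : ℂ)‖ ≤
      C * ((K * |T|) ^ n / Real.Gamma (α * n + β)) := by
  have hΓ : 0 < Real.Gamma (α * n + β) := Real.Gamma_pos_of_pos (by positivity)
  rw [norm_mul, Complex.norm_real, norm_div, norm_pow, Real.norm_eq_abs, Real.norm_of_nonneg hΓ.le,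
    mul_pow]
  calc _ ≤ C * K ^ n * (|T| ^ n / Real.Gamma (α * n + β)) := by gcongr
    _ = _ := by ring

theorem GeomBounded.summable {α β : ℝ} (hα : 0 < α) (hβ : 0 < β) {a : ℕ → ℂ} (ha : GeomBounded a)
    (T : ℝ) : Summable fun n : ℕ => a n * ((T ^ n / Real.Gamma (α * n + β) : ℝ) : ℂ) := by
  obtain ⟨C, K, h⟩ := ha
  exact .of_norm_bounded ((summable_pow_div_Gamma hα hβ _).mul_left C)
    fun n => norm_gammaSeries_term_le hα hβ (h n)

theorem norm_gammaSeries_le {α β C K T T₀ : ℝ} (hα : 0 < α) (hβ : 0 < β) (hC : 0 ≤ C) (hK : 0 ≤ K)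
    (hT : |T| ≤ T₀) {a : ℕ → ℂ} (h : ∀ n, ‖a n‖ ≤ C * K ^ n) :
    ‖gammaSeries α β a T‖ ≤ C * ∑' n : ℕ, (K * T₀) ^ n / Real.Gamma (α * n + β) := by
  rw [← tsum_mul_left]
  refine tsum_of_norm_bounded ((summable_pow_div_Gamma hα hβ _).mul_left C).hasSum fun n => ?_
  refine (norm_gammaSeries_term_le hα hβ (h n)).trans ?_
  have hΓ : 0 < Real.Gamma (α * n + β) := Real.Gamma_pos_of_pos (by positivity)
  gcongr

theorem gammaSeries_add {α β T : ℝ} (hα : 0 < α) (hβ : 0 < β) {a b : ℕ → ℂ} (ha : GeomBounded a)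
    (hb : GeomBounded b) :
    gammaSeries α β (fun n => a n + b n) T = gammaSeries α β a T + gammaSeries α β b T := by
  rw [gammaSeries, gammaSeries, gammaSeries,
    ← (ha.summable hα hβ T).tsum_add (hb.summable hα hβ T)]
  simp only [add_mul]

theorem gammaSeries_const_mul {α β T : ℝ} (c : ℂ) (a : ℕ → ℂ) :
    gammaSeries α β (fun n => c * a n) T = c * gammaSeries α β a T := by
  simp only [gammaSeries, mul_assoc, tsum_mul_left]

theorem gammaSeries_eq_add_shift {α β T : ℝ} (hα : 0 < α) (hβ : 0 < β) {a : ℕ → ℂ}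
    (ha : GeomBounded a) :
    gammaSeries α β a T =
      a 0 / Real.Gamma β + T * gammaSeries α (α + β) (fun n => a (n + 1)) T := by
  rw [gammaSeries, (ha.summable hα hβ T).tsum_eq_zero_add, gammaSeries, ← tsum_mul_left]
  congr 1
  · simp [div_eq_mul_inv]
  · congr 1
    ext n
    rw [show α * ((n + 1 : ℕ) : ℝ) + β = α * n + (α + β) by push_cast; ring]
    push_cast
    ring

/-- The Weierstrass M-test with coefficients and argument depending on a parameter; this later gives
joint continuity in time and symbol value. -/
theorem continuousOn_gammaSeries {X : Type*} [TopologicalSpace X] {s : Set X} {α β C K T₀ : ℝ}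
    (hα : 0 < α) (hβ : 0 < β) (hC : 0 ≤ C) (hK : 0 ≤ K)
    {a : X → ℕ → ℂ} {T : X → ℝ} (ha : ∀ n, ContinuousOn (fun x => a x n) s) (hT : ContinuousOn T s)
    (hbd : ∀ x ∈ s, ∀ n, ‖a x n‖ ≤ C * K ^ n) (hT₀ : ∀ x ∈ s, |T x| ≤ T₀) :
    ContinuousOn (fun x => gammaSeries α β (a x) (T x)) s := by
  refine continuousOn_tsum (fun n => ?_)
    ((summable_pow_div_Gamma hα hβ (K * T₀)).mul_left C) fun n x hx => ?_
  · exact (ha n).mul (Complex.continuous_ofReal.comp_continuousOn ((hT.pow n).div_const _))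
  · refine (norm_gammaSeries_term_le hα hβ (hbd x hx n)).trans ?_
    have hΓ : 0 < Real.Gamma (α * n + β) := Real.Gamma_pos_of_pos (by positivity)
    have := hT₀ x hx
    gcongr

theorem GeomBounded.continuous_gammaSeries {α β : ℝ} (hα : 0 < α) (hβ : 0 < β) {a : ℕ → ℂ}
    (ha : GeomBounded a) : Continuous (gammaSeries α β a) := by
  obtain ⟨C, K, h⟩ := ha
  rw [continuous_iff_continuousAt]
  intro T
  have h' : ∀ n, ‖a n‖ ≤ |C| * |K| ^ n := fun n => (h n).trans (by
    rw [← abs_pow, ← abs_mul]; exact le_abs_self _)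
  have := continuousOn_gammaSeries (s := Metric.ball (0 : ℝ) (|T| + 1)) (a := fun _ => a)
    (T := fun x => x) (T₀ := |T| + 1) hα hβ (abs_nonneg C) (abs_nonneg K)
    (fun n => continuousOn_const) continuousOn_id (fun _ _ => h') (fun x hx => by
      simpa using (mem_ball_zero_iff.1 hx).le)
  exact this.continuousAt (Metric.isOpen_ball.mem_nhds (by simp))

theorem continuousOn_rpow_mul_gammaSeries {α β : ℝ} (hα : 0 < α) (hβ : 0 < β) {a : ℕ → ℂ}
    (ha : GeomBounded a) (γ : ℝ) :
    ContinuousOn (fun τ : ℝ => ((τ ^ γ : ℝ) : ℂ) * gammaSeries α β a (τ ^ α)) (Ioi 0) := by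
  apply ContinuousOn.mul
  · exact Complex.continuous_ofReal.comp_continuousOn
      (continuousOn_id.rpow_const fun x hx => Or.inl (ne_of_gt hx))
  · exact (ha.continuous_gammaSeries hα hβ).comp_continuousOn
      (continuousOn_id.rpow_const fun x hx => Or.inl (ne_of_gt hx))

/-- Riemann-Liouville integration of a Gamma series, termwise. -/
theorem integral_rpow_mul_gammaSeries {α β γ t : ℝ} (hα : 0 < α) (hβ : 0 < β) (hγ : 0 < γ)
    (ht : 0 < t) {a : ℕ → ℂ} (ha : GeomBounded a) :
    ∫ τ in (0 : ℝ)..t, (((t - τ) ^ (γ - 1) * τ ^ (β - 1) : ℝ) : ℂ) * gammaSeries α β a (τ ^ α) =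
      Real.Gamma γ * ((t ^ (β + γ - 1) : ℝ) : ℂ) * gammaSeries α (β + γ) a (t ^ α) := by
  set F : ℕ → ℝ → ℂ := fun n τ => (a n / Real.Gamma (α * n + β)) *
    (((t - τ) ^ (γ - 1) * τ ^ (α * n + β - 1) : ℝ) : ℂ) with hF
  have hb : ∀ n : ℕ, 0 < α * n + β := fun n => by positivity
  have hΓγ := Real.Gamma_pos_of_pos hγ
  have hpw : ∀ (n : ℕ) (s : ℝ), 0 < s → s ^ (α * n + β - 1) = s ^ (β - 1) * (s ^ α) ^ n := by
    intro n s hs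
    rw [← Real.rpow_mul_natCast hs.le, ← Real.rpow_add hs]
    congr 1; ring
  have hint : ∀ n : ℕ, IntervalIntegrable (fun τ : ℝ => (t - τ) ^ (γ - 1) * τ ^ (α * n + β - 1))
      volume 0 t := fun n => intervalIntegrable_sub_rpow_mul_rpow (hb n) hγ ht
  have hI : ∀ n : ℕ, ∫ τ in (0 : ℝ)..t, (t - τ) ^ (γ - 1) * τ ^ (α * n + β - 1) =
      Real.Gamma (α * n + β) * (Real.Gamma γ * t ^ (β + γ - 1) *
        ((t ^ α) ^ n / Real.Gamma (α * n + (β + γ)))) := by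
    intro n
    rw [integral_sub_rpow_mul_rpow (hb n) hγ ht,
      show α * n + β + γ - 1 = α * n + (β + γ) - 1 by ring]
    have : t ^ (α * n + (β + γ) - 1) = t ^ (β + γ - 1) * (t ^ α) ^ n := by
      rw [← Real.rpow_mul_natCast ht.le, ← Real.rpow_add ht]
      congr 1; ring
    rw [this, add_assoc]
    ring
  have hFint : ∀ n, Integrable (F n) (volume.restrict (Ioc 0 t)) := fun n =>
    (((intervalIntegrable_iff_integrableOn_Ioc_of_le ht.le).1 (hint n)).ofReal).const_mul _
  -- Up to a constant, the L¹ norms of the terms are the absolute values of the terms of the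
  -- resulting series, whose summability permits exchanging sum and integral.
  have hnorm : ∀ n, ∫ τ in Ioc 0 t, ‖F n τ‖ = Real.Gamma γ * t ^ (β + γ - 1) *
      ‖a n * (((t ^ α) ^ n / Real.Gamma (α * n + (β + γ)) : ℝ) : ℂ)‖ := by
    intro n
    have hΓ := Real.Gamma_pos_of_pos (hb n)
    have hΓ' : 0 < Real.Gamma (α * n + (β + γ)) := Real.Gamma_pos_of_pos (by positivity)
    have h1 : ∫ τ in Ioc 0 t, ‖F n τ‖ = ∫ τ in Ioc 0 t, (‖a n‖ / Real.Gamma (α * n + β)) *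
        ((t - τ) ^ (γ - 1) * τ ^ (α * n + β - 1)) := by
      apply setIntegral_congr_fun measurableSet_Ioc
      intro τ hτ
      have h0 : 0 ≤ (t - τ) ^ (γ - 1) * τ ^ (α * n + β - 1) :=
        mul_nonneg (Real.rpow_nonneg (by linarith [hτ.2]) _) (Real.rpow_nonneg hτ.1.le _)
      simp only [hF]
      rw [norm_mul, norm_div, Complex.norm_real, Complex.norm_real, Real.norm_of_nonneg h0,
        Real.norm_of_nonneg hΓ.le]
    rw [h1, integral_const_mul, ← intervalIntegral.integral_of_le ht.le, hI, norm_mul,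
      Complex.norm_real, Real.norm_of_nonneg (by positivity)]
    field_simp
  have key := hasSum_integral_of_summable_integral_norm hFint (by
    simp only [hnorm]
    exact ((ha.summable hα (add_pos hβ hγ) (t ^ α)).norm).mul_left _)
  have h2 : ∫ τ in Ioc 0 t, ∑' n, F n τ = ∫ τ in (0 : ℝ)..t,
      (((t - τ) ^ (γ - 1) * τ ^ (β - 1) : ℝ) : ℂ) * gammaSeries α β a (τ ^ α) := by
    rw [intervalIntegral.integral_of_le ht.le]
    apply setIntegral_congr_fun measurableSet_Ioc
    intro τ hτ
    simp only [gammaSeries, hF]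
    rw [← tsum_mul_left]
    congr 1
    ext n
    rw [hpw n τ hτ.1]
    push_cast
    ring
  rw [← h2, ← key.tsum_eq, gammaSeries, ← tsum_mul_left]
  congr 1
  ext n
  simp only [hF]
  rw [integral_const_mul, integral_complex_ofReal, ← intervalIntegral.integral_of_le ht.le, hI]
  have hΓ := (Real.Gamma_pos_of_pos (hb n)).ne'
  have hΓ' : (Real.Gamma (α * n + β) : ℂ) ≠ 0 := by exact_mod_cast hΓ
  push_cast
  field_simp

theorem intervalIntegrable_rpow_mul_gammaSeries {α β γ t : ℝ} (hα : 0 < α) (hβ : 0 < β)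
    (hγ : 0 < γ) (ht : 0 < t) {a : ℕ → ℂ} (ha : GeomBounded a) :
    IntervalIntegrable (fun τ : ℝ =>
      (((t - τ) ^ (γ - 1) * τ ^ (β - 1) : ℝ) : ℂ) * gammaSeries α β a (τ ^ α)) volume 0 t := by
  apply IntervalIntegrable.mul_continuousOn
  · rw [intervalIntegrable_iff_integrableOn_Ioc_of_le ht.le]
    exact ((intervalIntegrable_iff_integrableOn_Ioc_of_le ht.le).1
      (intervalIntegrable_sub_rpow_mul_rpow hβ hγ ht)).ofReal
  · exact ((ha.continuous_gammaSeries hα hβ).comp (Real.continuous_rpow_const hα.le)).continuousOn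

/-- No termwise differentiation is needed: `integral_rpow_mul_gammaSeries` with γ = 1 exhibits the
series as a primitive of the claimed derivative, which is continuous for t > 0 and integrable at
zero. -/
theorem hasDerivAt_gammaSeries {α t : ℝ} (hα : 0 < α) (ht : 0 < t) {a : ℕ → ℂ}
    (ha : GeomBounded a) :
    HasDerivAt (fun s : ℝ => gammaSeries α 1 a (s ^ α))
      (((t ^ (α - 1) : ℝ) : ℂ) * gammaSeries α α (fun n => a (n + 1)) (t ^ α)) t := by
  set g : ℝ → ℂ := fun τ => ((τ ^ (α - 1) : ℝ) : ℂ) * gammaSeries α α (fun n => a (n + 1)) (τ ^ α)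
    with hg
  have hprim : ∀ s : ℝ, 0 < s → ∫ τ in (0 : ℝ)..s, g τ = gammaSeries α 1 a (s ^ α) - a 0 := by
    intro s hs
    have h := integral_rpow_mul_gammaSeries hα hα one_pos hs ha.shift
    simp only [sub_self, Real.rpow_zero, one_mul, Real.Gamma_one, Complex.ofReal_one,
      add_sub_cancel_right] at h
    rw [hg, h, gammaSeries_eq_add_shift hα one_pos ha, Real.Gamma_one]
    push_cast
    ring
  have hcont : ContinuousOn g (Ioi 0) := continuousOn_rpow_mul_gammaSeries hα hα ha.shift _
  have hii : IntervalIntegrable g volume 0 t := by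
    simpa using intervalIntegrable_rpow_mul_gammaSeries hα hα one_pos ht ha.shift
  have hd := intervalIntegral.integral_hasDerivAt_right hii
    (hcont.stronglyMeasurableAtFilter isOpen_Ioi t ht) (hcont.continuousAt (Ioi_mem_nhds ht))
  refine (hd.add_const (a 0)).congr_of_eventuallyEq ?_
  filter_upwards [Ioi_mem_nhds ht] with s hs
  rw [hprim s hs]
  ring

/-! ### Bounds for Mittag-Leffler functions on the left half-plane -/

/-- Convexity of s ↦ s^(-α): its graph lies above the tangent line at y. -/
theorem mul_le_rpow_neg_sub_rpow_neg {α x y : ℝ} (hα : 0 < α) (hx : 0 < x) (hxy : x < y) :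
    α * (y - x) * y ^ (-α - 1) ≤ x ^ (-α) - y ^ (-α) := by
  have hy : 0 < y := hx.trans hxy
  have hxy' : 0 < x / y := by positivity
  have h1 : x ^ (-α) = y ^ (-α) * (x / y) ^ (-α) := by
    rw [← Real.mul_rpow hy.le hxy'.le, mul_div_cancel₀ _ hy.ne']
  have h2 : 1 + α * (1 - x / y) ≤ (x / y) ^ (-α) := by
    rw [Real.rpow_def_of_pos hxy']
    have := Real.add_one_le_exp (Real.log (x / y) * -α)
    have := Real.log_le_sub_one_of_pos hxy'
    nlinarith
  have h3 : y ^ (-α - 1) = y ^ (-α) / y := by rw [Real.rpow_sub hy, Real.rpow_one]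
  rw [h1, h3]
  have hyp : 0 < y ^ (-α) := by positivity
  calc α * (y - x) * (y ^ (-α) / y) = y ^ (-α) * (1 + α * (1 - x / y)) - y ^ (-α) := by
        field_simp; ring
    _ ≤ _ := by gcongr

/-- A maximum principle for the Riemann-Liouville derivative: at the first point where a negative
function returns to zero, its fractional derivative is positive. -/
theorem pos_of_hasDerivAt_rlIntegral {α t₀ D : ℝ} (hα0 : 0 < α) (hα1 : α < 1) (ht₀ : 0 < t₀)
    {q : ℝ → ℝ} (hqc : ContinuousOn q (Ioi 0)) (hneg : ∀ s ∈ Ioo 0 t₀, q s < 0) (hq0 : q t₀ = 0)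
    (hqd : DifferentiableAt ℝ q t₀)
    (hint : ∀ t, 0 < t → IntervalIntegrable (fun s => (t - s) ^ (-α) * q s) volume 0 t)
    (hD : HasDerivAt (fun t => ∫ s in (0 : ℝ)..t, (t - s) ^ (-α) * q s) D t₀) : 0 < D := by
  set Q : ℝ → ℝ := fun t => ∫ s in (0 : ℝ)..t, (t - s) ^ (-α) * q s with hQ
  -- On this window, away from both 0 and t₀, q stays below -η < 0. The memory of these values
  -- forces the derivative at t₀ to be positive.
  obtain ⟨s₁, hs₁, hmax⟩ : ∃ s₁ ∈ Icc (t₀ / 4) (t₀ / 2), ∀ s ∈ Icc (t₀ / 4) (t₀ / 2), q s ≤ q s₁ :=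
    isCompact_Icc.exists_isMaxOn ⟨t₀ / 4, by constructor <;> linarith⟩
      (hqc.mono fun s hs => by have := hs.1; simp only [mem_Ioi]; linarith)
  set η : ℝ := -q s₁ with hη
  have hηpos : 0 < η := by
    have := hneg s₁ ⟨by linarith [hs₁.1], by linarith [hs₁.2]⟩
    linarith
  obtain ⟨C, hC⟩ : ∃ C, ∀ᶠ s in 𝓝 t₀, ‖q s - q t₀‖ ≤ C * ‖s - t₀‖ := hqd.isBigO_sub.bound
  set C' : ℝ := max C 0 with hC'
  have hC0 : 0 ≤ C' := le_max_right _ _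
  obtain ⟨δ, hδ, hball⟩ := Metric.eventually_nhds_iff.1 hC
  -- Moving from t₀ - h to t₀ lowers the kernel by at least α h t₀^(-α-1) on the window, which has
  -- length t₀/4, and there -q ≥ η. So the window contributes at least c h to the increment.
  set c : ℝ := α * t₀ ^ (-α - 1) * η * (t₀ / 4) with hc
  have hcpos : 0 < c := by positivity
  have key : ∀ h : ℝ, 0 < h → h < min δ (t₀ / 4) →
      c - C' * h ^ (1 - α) ≤ (Q (t₀ - h) - Q t₀) / (-h) := by
    intro h hh hhm
    have hhδ : h < δ := hhm.trans_le (min_le_left _ _)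
    have hh4 : h < t₀ / 4 := hhm.trans_le (min_le_right _ _)
    have hp : 0 < t₀ - h := by linarith
    have hI1 : IntervalIntegrable (fun s => (t₀ - s) ^ (-α) * q s) volume 0 (t₀ - h) :=
      (hint t₀ ht₀).mono_set (by
        rw [uIcc_of_le hp.le, uIcc_of_le ht₀.le]; exact Icc_subset_Icc_right (by linarith))
    have hI2 : IntervalIntegrable (fun s => (t₀ - s) ^ (-α) * q s) volume (t₀ - h) t₀ :=
      (hint t₀ ht₀).mono_set (by
        rw [uIcc_of_le (by linarith), uIcc_of_le ht₀.le]; exact Icc_subset_Icc_left (by linarith))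
    have hI3 := hint (t₀ - h) hp
    -- The first integral has a nonnegative integrand, since both the kernel and q decrease the
    -- wrong way together. The second is O(h^(2-α)) because q is O(t₀ - s) near t₀; this is where
    -- differentiability of q is used.
    have hsplit : Q t₀ - Q (t₀ - h) =
        (∫ s in (0 : ℝ)..(t₀ - h), ((t₀ - h - s) ^ (-α) - (t₀ - s) ^ (-α)) * (-q s)) +
          ∫ s in (t₀ - h)..t₀, (t₀ - s) ^ (-α) * q s := by
      have e1 : Q t₀ = (∫ s in (0 : ℝ)..(t₀ - h), (t₀ - s) ^ (-α) * q s) +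
          ∫ s in (t₀ - h)..t₀, (t₀ - s) ^ (-α) * q s :=
        (intervalIntegral.integral_add_adjacent_intervals hI1 hI2).symm
      have e2 : (∫ s in (0 : ℝ)..(t₀ - h), (t₀ - s) ^ (-α) * q s) - Q (t₀ - h) =
          ∫ s in (0 : ℝ)..(t₀ - h), ((t₀ - h - s) ^ (-α) - (t₀ - s) ^ (-α)) * (-q s) := by
        rw [hQ, ← intervalIntegral.integral_sub hI1 hI3]
        congr 1; ext s; ring
      rw [e1, ← e2]; ring
    have hI4 : IntervalIntegrable (fun s => ((t₀ - h - s) ^ (-α) - (t₀ - s) ^ (-α)) * (-q s))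
        volume 0 (t₀ - h) := by
      convert hI1.sub hI3 using 1
      ext s; ring
    have hfirst : c * h ≤
        ∫ s in (0 : ℝ)..(t₀ - h), ((t₀ - h - s) ^ (-α) - (t₀ - s) ^ (-α)) * (-q s) := by
      have hsub : Ioc (t₀ / 4) (t₀ / 2) ⊆ Ioc 0 (t₀ - h) :=
        Ioc_subset_Ioc (by linarith) (by linarith)
      rw [intervalIntegral.integral_of_le hp.le]
      have hI5 := (intervalIntegrable_iff_integrableOn_Ioc_of_le hp.le).1 hI4
      calc c * h = ∫ _ in Ioc (t₀ / 4) (t₀ / 2), α * h * t₀ ^ (-α - 1) * η := by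
            rw [setIntegral_const, Real.volume_real_Ioc_of_le (by linarith), hc, smul_eq_mul]
            ring
        _ ≤ ∫ s in Ioc (t₀ / 4) (t₀ / 2),
              ((t₀ - h - s) ^ (-α) - (t₀ - s) ^ (-α)) * (-q s) := by
            apply setIntegral_mono_on (integrableOn_const (by simp)) (hI5.mono_set hsub)
              measurableSet_Ioc
            intro s hs
            have h1 := mul_le_rpow_neg_sub_rpow_neg hα0 (x := t₀ - h - s) (y := t₀ - s)
              (by linarith [hs.2]) (by linarith)
            have h2 : t₀ ^ (-α - 1) ≤ (t₀ - s) ^ (-α - 1) :=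
              Real.rpow_le_rpow_of_nonpos (by linarith [hs.2]) (by linarith [hs.1]) (by linarith)
            have h3 : η ≤ -q s := by
              have := hmax s ⟨hs.1.le, hs.2⟩
              linarith
            have h4 : α * h * t₀ ^ (-α - 1) ≤ (t₀ - h - s) ^ (-α) - (t₀ - s) ^ (-α) := by
              refine le_trans ?_ h1
              rw [show t₀ - s - (t₀ - h - s) = h by ring]
              gcongr
            have h5 : 0 ≤ α * h * t₀ ^ (-α - 1) := by positivity
            exact mul_le_mul h4 h3 hηpos.le (h5.trans h4)
        _ ≤ _ := by
            apply setIntegral_mono_set hI5 _ hsub.eventuallyLE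
            have : ∀ᵐ s ∂(volume.restrict (Ioc 0 (t₀ - h))), s ≠ t₀ - h := by
              apply ae_restrict_of_ae
              simp [ae_iff]
            filter_upwards [ae_restrict_mem measurableSet_Ioc, this] with s hs hne
            have hs' : s < t₀ - h := lt_of_le_of_ne hs.2 hne
            have h1 := mul_le_rpow_neg_sub_rpow_neg hα0 (x := t₀ - h - s) (y := t₀ - s)
              (by linarith) (by linarith)
            have h5 : 0 ≤ α * (t₀ - s - (t₀ - h - s)) * (t₀ - s) ^ (-α - 1) := by
              have : 0 < t₀ - s := by linarith
              rw [show t₀ - s - (t₀ - h - s) = h by ring]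
              positivity
            have := hneg s ⟨hs.1, by linarith⟩
            exact mul_nonneg (h5.trans h1) (by linarith)
    have hsecond : -(C' * h ^ (1 - α) * h) ≤ ∫ s in (t₀ - h)..t₀, (t₀ - s) ^ (-α) * q s := by
      calc -(C' * h ^ (1 - α) * h) = ∫ _ in (t₀ - h)..t₀, -(C' * h ^ (1 - α)) := by
            rw [intervalIntegral.integral_const, smul_eq_mul]; ring
        _ ≤ _ := by
            apply intervalIntegral.integral_mono_on (by linarith) (by simp) hI2
            intro s hs
            rcases eq_or_lt_of_le hs.2 with rfl | hs2
            · rw [hq0, mul_zero, neg_nonpos]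
              exact mul_nonneg hC0 (Real.rpow_nonneg hh.le _)
            · have hts : 0 < t₀ - s := by linarith
              have h1 := hball (y := s) (by rw [Real.dist_eq, abs_lt]; constructor <;> linarith [hs.1])
              rw [hq0, sub_zero, Real.norm_eq_abs, Real.norm_eq_abs, abs_sub_comm,
                abs_of_pos hts] at h1
              have h2 : -(C' * (t₀ - s)) ≤ q s := by
                have := neg_abs_le (q s)
                have : C * (t₀ - s) ≤ C' * (t₀ - s) := by
                  have := le_max_left C 0
                  gcongr
                linarith
              calc -(C' * h ^ (1 - α)) ≤ -(C' * (t₀ - s) ^ (1 - α)) := by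
                    have : t₀ - s ≤ h := by linarith [hs.1]
                    have : (t₀ - s) ^ (1 - α) ≤ h ^ (1 - α) :=
                      Real.rpow_le_rpow hts.le this (by linarith)
                    gcongr
                _ = (t₀ - s) ^ (-α) * (-(C' * (t₀ - s))) := by
                    rw [show 1 - α = -α + 1 by ring, Real.rpow_add hts, Real.rpow_one]; ring
                _ ≤ _ := by gcongr
    rw [le_div_iff_of_neg (by linarith)]
    nlinarith [hsplit, hfirst, hsecond]
  have hlim : Tendsto (fun h : ℝ => (Q (t₀ - h) - Q t₀) / (-h)) (𝓝[>] 0) (𝓝 D) := by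
    have h1 := hD.tendsto_slope_zero
    have h2 : Tendsto (fun h : ℝ => -h) (𝓝[>] 0) (𝓝[≠] 0) := by
      apply tendsto_nhdsWithin_of_tendsto_nhds_of_eventually_within
      · have : Tendsto (fun h : ℝ => -h) (𝓝 0) (𝓝 (-0)) := continuous_neg.tendsto 0
        rw [neg_zero] at this
        exact this.mono_left nhdsWithin_le_nhds
      · filter_upwards [self_mem_nhdsWithin] with h hh
        simpa using ne_of_gt hh
    refine (h1.comp h2).congr fun h => ?_
    simp only [Function.comp, smul_eq_mul, ← sub_eq_add_neg, hQ]
    ring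
  have hlim2 : Tendsto (fun h : ℝ => c - C' * h ^ (1 - α)) (𝓝[>] 0) (𝓝 c) := by
    have : Tendsto (fun h : ℝ => c - C' * h ^ (1 - α)) (𝓝 0) (𝓝 (c - C' * 0 ^ (1 - α))) :=
      (continuous_const.sub (continuous_const.mul
        (Real.continuous_rpow_const (by linarith)))).tendsto 0
    rw [Real.zero_rpow (by linarith), mul_zero, sub_zero] at this
    exact this.mono_left nhdsWithin_le_nhds
  refine hcpos.trans_le (le_of_tendsto_of_tendsto hlim2 hlim ?_)
  filter_upwards [self_mem_nhdsWithin, nhdsWithin_le_nhds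
    (Iio_mem_nhds (lt_min hδ (by positivity : 0 < t₀ / 4)))] with h hh hh2
  exact key h hh hh2

theorem GeomBounded.differentiableAt_gammaSeries {α β : ℝ} (hα : 0 < α) (hβ : 0 < β) {a : ℕ → ℂ}
    (ha : GeomBounded a) (T : ℝ) : DifferentiableAt ℝ (gammaSeries α β a) T := by
  obtain ⟨C, K, h⟩ := ha
  have hC : 0 ≤ C := by simpa using (norm_nonneg _).trans (h 0)
  set S : ℝ := |T| + 1 with hS
  have hS1 : 1 ≤ S := by rw [hS]; linarith [abs_nonneg T]
  -- The factor 2 ^ n absorbs the n produced by differentiating T ^ n.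
  set u : ℕ → ℝ := fun n => C * ((2 * |K| * S) ^ n / Real.Gamma (α * n + β)) with hu
  have hus : Summable u := (summable_pow_div_Gamma hα hβ _).mul_left C
  have hb : ∀ n : ℕ, 0 < Real.Gamma (α * n + β) := fun n => Real.Gamma_pos_of_pos (by positivity)
  have hmem : T ∈ Metric.ball (0 : ℝ) S := by simp [hS]
  refine (hasDerivAt_tsum_of_isPreconnected (t := Metric.ball (0 : ℝ) S) hus Metric.isOpen_ball
    (convex_ball _ _).isPreconnected
    (g' := fun n y => a n * ((((n : ℝ) * y ^ (n - 1)) / Real.Gamma (α * n + β) : ℝ) : ℂ))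
    (fun n y _ => ?_) (fun n y hy => ?_) hmem ?_ hmem).differentiableAt
  · exact (((hasDerivAt_pow n y).div_const _).ofReal_comp).const_mul _
  · have hy' : |y| ≤ S := by simpa using (mem_ball_zero_iff.1 hy).le
    rw [norm_mul, Complex.norm_real, norm_div, Real.norm_of_nonneg (hb n).le, norm_mul, norm_pow,
      Real.norm_eq_abs, Real.norm_eq_abs]
    have h1 : ‖a n‖ ≤ C * |K| ^ n := (h n).trans (by
      rw [← abs_pow]; exact mul_le_mul_of_nonneg_left (le_abs_self _) hC)
    have h2 : |(n : ℝ)| * |y| ^ (n - 1) ≤ 2 ^ n * S ^ n := by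
      have h3 : |(n : ℝ)| ≤ 2 ^ n := by
        rw [abs_of_nonneg (by positivity)]; exact_mod_cast Nat.lt_two_pow_self.le
      have h4 : |y| ^ (n - 1) ≤ S ^ n :=
        (pow_le_pow_left₀ (abs_nonneg y) hy' _).trans (pow_le_pow_right₀ hS1 (Nat.sub_le n 1))
      gcongr
    calc ‖a n‖ * (|(n : ℝ)| * |y| ^ (n - 1) / Real.Gamma (α * n + β))
        ≤ C * |K| ^ n * (2 ^ n * S ^ n / Real.Gamma (α * n + β)) := by
          have := hb n
          gcongr
      _ = _ := by simp only [hu, mul_pow]; ring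
  · exact GeomBounded.summable hα hβ ⟨C, K, h⟩ T

theorem geomBounded_pow (z : ℂ) : GeomBounded fun n => z ^ n :=
  ⟨1, ‖z‖, fun n => by simp⟩

theorem gammaSeries_at_zero {α β : ℝ} (a : ℕ → ℂ) :
    gammaSeries α β a 0 = a 0 / Real.Gamma β := by
  rw [gammaSeries, tsum_eq_single 0]
  · simp [div_eq_mul_inv]
  · intro n hn
    simp [hn]

/-- Write g(s) = E_{α,α}(z s^α), so |g(0)| = 1/Γ(α). If the bound failed, |g| would reach some
larger level for the first time at a t₀ > 0. The fractional integral of order 1 - α of s^(α-1) g is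
E_{α,1}(z s^α), with derivative z s^(α-1) g, while that of s^(α-1) is constant. After rotating g(t₀)
to the positive axis, the function s^(α-1)(Re g(s) - |g(t₀)|) is negative before t₀ and zero there,
but its Riemann-Liouville derivative at t₀ has the sign of Re z ≤ 0. This contradicts the maximum
principle. -/
theorem norm_gammaSeries_pow_diag_le {α : ℝ} (hα0 : 0 < α) (hα1 : α < 1) {z : ℂ} (hz : z.re ≤ 0)
    {t : ℝ} (ht : 0 ≤ t) :
    ‖gammaSeries α α (fun n => z ^ n) (t ^ α)‖ ≤ 1 / Real.Gamma α := by
  have hΓ : 0 < Real.Gamma α := Real.Gamma_pos_of_pos hα0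
  have hΓ' : 0 < Real.Gamma (1 - α) := Real.Gamma_pos_of_pos (by linarith)
  have hgb := geomBounded_pow z
  set g : ℝ → ℂ := fun s => gammaSeries α α (fun n => z ^ n) (s ^ α) with hg
  have hgc : Continuous g :=
    (hgb.continuous_gammaSeries hα0 hα0).comp (Real.continuous_rpow_const hα0.le)
  by_contra! hlt
  set S : Set ℝ := {s | 0 ≤ s ∧ ‖g t‖ ≤ ‖g s‖} with hS
  have hSc : IsClosed S := isClosed_Ici.inter (isClosed_le continuous_const hgc.norm)
  have hSne : S.Nonempty := ⟨t, ht, le_rfl⟩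
  have hSbdd : BddBelow S := ⟨0, fun s hs => hs.1⟩
  set t₀ : ℝ := sInf S with ht₀
  obtain ⟨ht₀0, ht₀g⟩ : t₀ ∈ S := hSc.csInf_mem hSne hSbdd
  have hg0 : ‖g 0‖ = 1 / Real.Gamma α := by
    simp [hg, Real.zero_rpow hα0.ne', gammaSeries_at_zero, abs_of_pos hΓ]
  have ht₀pos : 0 < t₀ := by
    rcases ht₀0.eq_or_lt with h | h
    · rw [← h, hg0] at ht₀g
      exact absurd hlt (not_lt.2 ht₀g)
    · exact h
  have hbefore : ∀ s ∈ Ioo 0 t₀, ‖g s‖ < ‖g t₀‖ := by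
    intro s hs
    by_contra! h
    exact absurd (csInf_le hSbdd ⟨hs.1.le, ht₀g.trans h⟩) (not_le.2 hs.2)
  set N : ℝ := ‖g t₀‖ with hN
  have hNpos : 0 < N := (norm_nonneg _).trans_lt (hbefore (t₀ / 2) ⟨by linarith, by linarith⟩)
  -- The unimodular factor that makes c * g t₀ equal to its modulus N.
  set c : ℂ := (starRingEnd ℂ) (g t₀) / N with hc
  have hNc : (N : ℂ) ≠ 0 := by exact_mod_cast hNpos.ne'
  have hcn : ‖c‖ = 1 := by
    rw [hc, norm_div, RCLike.norm_conj, Complex.norm_real, norm_norm]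
    exact div_self hNpos.ne'
  have hcg : c * g t₀ = N := by
    rw [hc, div_mul_eq_mul_div, mul_comm, Complex.mul_conj, Complex.normSq_eq_norm_sq, ← hN]
    push_cast
    field_simp
  set q : ℝ → ℝ := fun s => s ^ (α - 1) * ((c * g s).re - N) with hq
  have hint : ∀ t, 0 < t → IntervalIntegrable (fun s : ℝ =>
      (((t - s) ^ (-α) * s ^ (α - 1) : ℝ) : ℂ) * g s) volume 0 t := fun t ht => by
    have := intervalIntegrable_rpow_mul_gammaSeries hα0 hα0 (γ := 1 - α) (by linarith) ht hgb
    rwa [show 1 - α - 1 = -α by ring] at this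
  have hint2 : ∀ t, 0 < t → IntervalIntegrable (fun s : ℝ => (t - s) ^ (-α) * s ^ (α - 1))
      volume 0 t := fun t ht => by
    have := intervalIntegrable_sub_rpow_mul_rpow hα0 (b := 1 - α) (by linarith) ht
    rwa [show 1 - α - 1 = -α by ring] at this
  have hqeq : ∀ t s : ℝ, (t - s) ^ (-α) * q s =
      (c * ((((t - s) ^ (-α) * s ^ (α - 1) : ℝ) : ℂ) * g s)).re -
        N * ((t - s) ^ (-α) * s ^ (α - 1)) := by
    intro t s
    rw [mul_left_comm c, Complex.re_ofReal_mul]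
    simp only [hq]; ring
  have hintre : ∀ t, 0 < t → IntervalIntegrable (fun s : ℝ =>
      (c * ((((t - s) ^ (-α) * s ^ (α - 1) : ℝ) : ℂ) * g s)).re) volume 0 t := fun t ht => by
    rw [intervalIntegrable_iff_integrableOn_Ioc_of_le ht.le]
    exact ((intervalIntegrable_iff_integrableOn_Ioc_of_le ht.le).1
      ((hint t ht).const_mul c)).re
  have hQ : ∀ t, 0 < t → ∫ s in (0 : ℝ)..t, (t - s) ^ (-α) * q s =
      (c * (Real.Gamma (1 - α) * gammaSeries α 1 (fun n => z ^ n) (t ^ α))).re -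
        N * (Real.Gamma α * Real.Gamma (1 - α)) := by
    intro t ht
    simp only [hqeq]
    rw [intervalIntegral.integral_sub (hintre t ht) ((hint2 t ht).const_mul N),
      intervalIntegral.integral_const_mul]
    congr 1
    · have h1 := integral_rpow_mul_gammaSeries hα0 hα0 (γ := 1 - α) (by linarith) ht hgb
      rw [show 1 - α - 1 = -α by ring, show α + (1 - α) - 1 = 0 by ring, Real.rpow_zero,
        Complex.ofReal_one, mul_one, show α + (1 - α) = 1 by ring] at h1
      rw [← h1, ← intervalIntegral.integral_const_mul, intervalIntegral.integral_of_le ht.le,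
        intervalIntegral.integral_of_le ht.le]
      exact integral_re ((intervalIntegrable_iff_integrableOn_Ioc_of_le ht.le).1
        ((hint t ht).const_mul c))
    · have h1 := integral_sub_rpow_mul_rpow hα0 (b := 1 - α) (by linarith) ht
      rw [show 1 - α - 1 = -α by ring, show α + (1 - α) - 1 = 0 by ring, Real.rpow_zero,
        show α + (1 - α) = 1 by ring, Real.Gamma_one] at h1
      rw [h1]; ring
  have hD : HasDerivAt (fun t => ∫ s in (0 : ℝ)..t, (t - s) ^ (-α) * q s)
      (Real.Gamma (1 - α) * (t₀ ^ (α - 1) * (z.re * N))) t₀ := by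
    have h1 := (Complex.reCLM.hasFDerivAt.comp_hasDerivAt t₀
      (((hasDerivAt_gammaSeries hα0 ht₀pos hgb).const_mul
      (Real.Gamma (1 - α) : ℂ)).const_mul c)).sub_const (N * (Real.Gamma α * Real.Gamma (1 - α)))
    have h2 : Complex.reCLM (c * (Real.Gamma (1 - α) * (((t₀ ^ (α - 1) : ℝ) : ℂ) *
        gammaSeries α α (fun n => z ^ (n + 1)) (t₀ ^ α)))) =
        Real.Gamma (1 - α) * (t₀ ^ (α - 1) * (z.re * N)) := by
      have h3 : gammaSeries α α (fun n => z ^ (n + 1)) (t₀ ^ α) = z * g t₀ := by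
        simp only [pow_succ', gammaSeries_const_mul, hg]
      rw [h3, show c * (Real.Gamma (1 - α) * (((t₀ ^ (α - 1) : ℝ) : ℂ) * (z * g t₀))) =
        ((Real.Gamma (1 - α) * t₀ ^ (α - 1) : ℝ) : ℂ) * (z * (c * g t₀)) by push_cast; ring, hcg,
        Complex.reCLM_apply, Complex.re_ofReal_mul, Complex.re_mul_ofReal]
      ring
    rw [h2] at h1
    refine h1.congr_of_eventuallyEq ?_
    filter_upwards [Ioi_mem_nhds ht₀pos] with t ht
    exact hQ t ht
  have hqc : ContinuousOn q (Ioi 0) := by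
    apply ContinuousOn.mul
    · exact continuousOn_id.rpow_const fun x hx => Or.inl (ne_of_gt hx)
    · exact ((Complex.continuous_re.comp (continuous_const.mul hgc)).sub
        continuous_const).continuousOn
  have hqd : DifferentiableAt ℝ q t₀ := by
    have h1 : DifferentiableAt ℝ (fun s : ℝ => s ^ (α - 1)) t₀ :=
      (Real.hasDerivAt_rpow_const (Or.inl ht₀pos.ne')).differentiableAt
    have h2 : DifferentiableAt ℝ g t₀ :=
      (hgb.differentiableAt_gammaSeries hα0 hα0 _).comp t₀
        (Real.hasDerivAt_rpow_const (Or.inl ht₀pos.ne')).differentiableAt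
    exact h1.mul ((Complex.reCLM.differentiableAt.comp t₀ (h2.const_mul c)).sub_const N)
  have hpos := pos_of_hasDerivAt_rlIntegral hα0 hα1 ht₀pos hqc (fun s hs => ?_) ?_ hqd
    (fun t ht => ?_) hD
  · have : z.re * N ≤ 0 := mul_nonpos_of_nonpos_of_nonneg hz hNpos.le
    have h3 : 0 ≤ Real.Gamma (1 - α) * t₀ ^ (α - 1) := by positivity
    nlinarith
  · have h1 : (c * g s).re < N := by
      calc (c * g s).re ≤ ‖c * g s‖ := Complex.re_le_norm _
        _ = ‖g s‖ := by rw [norm_mul, hcn, one_mul]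
        _ < N := hbefore s hs
    exact mul_neg_of_pos_of_neg (Real.rpow_pos_of_pos hs.1 _) (by linarith)
  · simp only [hq]
    rw [hcg]; simp
  · simp only [hqeq]
    exact (hintre t ht).sub ((hint2 t ht).const_mul N)

theorem gammaSeries_one_one_pow (z : ℂ) (T : ℝ) :
    gammaSeries 1 1 (fun n => z ^ n) T = Complex.exp (z * T) := by
  rw [Complex.exp_eq_exp_ℂ, NormedSpace.exp_eq_tsum_div, gammaSeries]
  congr 1
  ext n
  rw [one_mul, Real.Gamma_nat_eq_factorial]
  push_cast
  rw [mul_pow]; ring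

/-- For α < 1, E_{α,1}(z t^α) is the fractional integral of order 1 - α of t^(α-1) E_{α,α}(z t^α).
Inserting the bound 1/Γ(α) leaves a Beta integral equal to Γ(α) Γ(1-α), so the constant is exactly
1. For α = 1 both functions are exponentials. -/
theorem norm_gammaSeries_pow_le {α : ℝ} (hα0 : 0 < α) (hα1 : α ≤ 1) {z : ℂ} (hz : z.re ≤ 0)
    {t : ℝ} (ht : 0 ≤ t) :
    ‖gammaSeries α α (fun n => z ^ n) (t ^ α)‖ ≤ 1 / Real.Gamma α ∧
      ‖gammaSeries α 1 (fun n => z ^ n) (t ^ α)‖ ≤ 1 := by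
  rcases hα1.eq_or_lt with rfl | hα1
  · have : ‖gammaSeries 1 1 (fun n => z ^ n) (t ^ (1 : ℝ))‖ ≤ 1 := by
      rw [gammaSeries_one_one_pow, Complex.norm_exp, Real.exp_le_one_iff, Real.rpow_one,
        Complex.re_mul_ofReal]
      exact mul_nonpos_of_nonpos_of_nonneg hz ht
    simpa using this
  refine ⟨norm_gammaSeries_pow_diag_le hα0 hα1 hz ht, ?_⟩
  have hgb := geomBounded_pow z
  rcases ht.eq_or_lt with rfl | ht
  · simp [Real.zero_rpow hα0.ne', gammaSeries_at_zero]
  have hΓ : 0 < Real.Gamma α := Real.Gamma_pos_of_pos hα0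
  have hΓ' : 0 < Real.Gamma (1 - α) := Real.Gamma_pos_of_pos (by linarith)
  have h1 := integral_rpow_mul_gammaSeries hα0 hα0 (γ := 1 - α) (by linarith) ht hgb
  rw [show α + (1 - α) - 1 = 0 by ring, Real.rpow_zero,
    Complex.ofReal_one, mul_one, show α + (1 - α) = 1 by ring] at h1
  have h2 := integral_sub_rpow_mul_rpow hα0 (b := 1 - α) (by linarith) ht
  rw [show α + (1 - α) - 1 = 0 by ring, Real.rpow_zero,
    show α + (1 - α) = 1 by ring, Real.Gamma_one] at h2
  have hle : ‖∫ τ in (0 : ℝ)..t, (((t - τ) ^ (1 - α - 1) * τ ^ (α - 1) : ℝ) : ℂ) *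
      gammaSeries α α (fun n => z ^ n) (τ ^ α)‖ ≤
      ∫ τ in (0 : ℝ)..t, (t - τ) ^ (1 - α - 1) * τ ^ (α - 1) * (1 / Real.Gamma α) := by
    apply intervalIntegral.norm_integral_le_of_norm_le ht.le
    · filter_upwards with τ hτ
      have h0 : 0 ≤ (t - τ) ^ (1 - α - 1) * τ ^ (α - 1) :=
        mul_nonneg (Real.rpow_nonneg (by linarith [hτ.2]) _) (Real.rpow_nonneg hτ.1.le _)
      rw [norm_mul, Complex.norm_real, Real.norm_of_nonneg h0]
      exact mul_le_mul_of_nonneg_left (norm_gammaSeries_pow_diag_le hα0 hα1 hz hτ.1.le) h0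
    · exact (intervalIntegrable_sub_rpow_mul_rpow hα0 (by linarith) ht).mul_const _
  rw [h1, intervalIntegral.integral_mul_const, h2, norm_mul, Complex.norm_real,
    Real.norm_of_nonneg hΓ'.le] at hle
  have h3 : Real.Gamma α * Real.Gamma (1 - α) / 1 * 1 * (1 / Real.Gamma α) =
      Real.Gamma (1 - α) * 1 := by field_simp
  rw [h3] at hle
  exact le_of_mul_le_mul_left hle hΓ'

/-! ### The scalar telegraph equation -/

/-- The coefficients `d₀ = 0`, `d₁ = 1`, `d_{n+2} = -2 λ d_{n+1} - μ d_n`. -/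
def telegraphCoeff (lam mu : ℝ) : ℕ → ℂ
  | 0 => 0
  | 1 => 1
  | n + 2 => -(2 * lam) * telegraphCoeff lam mu (n + 1) - mu * telegraphCoeff lam mu n

theorem telegraphCoeff_add_two (lam mu : ℝ) (n : ℕ) : telegraphCoeff lam mu (n + 2) =
    -(2 * lam) * telegraphCoeff lam mu (n + 1) - mu * telegraphCoeff lam mu n := rfl

theorem norm_telegraphCoeff_le {lam mu K : ℝ} (hK1 : 1 ≤ K) (hK : 2 * |lam| + |mu| ≤ K) :
    ∀ n, ‖telegraphCoeff lam mu n‖ ≤ K ^ n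
  | 0 => by simp [telegraphCoeff]
  | 1 => by simpa [telegraphCoeff] using hK1
  | n + 2 => by
    have h1 := norm_telegraphCoeff_le hK1 hK (n + 1)
    have h2 := norm_telegraphCoeff_le hK1 hK n
    have hK0 : 0 ≤ K := by linarith
    have h3 : K ^ n ≤ K ^ (n + 1) := pow_le_pow_right₀ hK1 n.le_succ
    rw [telegraphCoeff_add_two]
    calc _ ≤ ‖-(2 * (lam : ℂ)) * telegraphCoeff lam mu (n + 1)‖ +
          ‖(mu : ℂ) * telegraphCoeff lam mu n‖ := norm_sub_le _ _
      _ = 2 * |lam| * ‖telegraphCoeff lam mu (n + 1)‖ + |mu| * ‖telegraphCoeff lam mu n‖ := by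
          simp
      _ ≤ 2 * |lam| * K ^ (n + 1) + |mu| * K ^ (n + 1) := by gcongr; exact h2.trans h3
      _ = (2 * |lam| + |mu|) * K ^ (n + 1) := by ring
      _ ≤ K * K ^ (n + 1) := by gcongr
      _ = K ^ (n + 2) := by ring

theorem geomBounded_telegraphCoeff (lam mu : ℝ) : GeomBounded (telegraphCoeff lam mu) :=
  ⟨1, 1 + 2 * |lam| + |mu|, fun n => by
    rw [one_mul]
    exact norm_telegraphCoeff_le (by linarith [abs_nonneg lam, abs_nonneg mu]) (by linarith) n⟩

theorem continuous_telegraphCoeff (lam : ℝ) : ∀ n, Continuous fun mu => telegraphCoeff lam mu n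
  | 0 => continuous_const
  | 1 => continuous_const
  | n + 2 => (continuous_const.mul (continuous_telegraphCoeff lam (n + 1))).sub
      (Complex.continuous_ofReal.mul (continuous_telegraphCoeff lam n))

/-- Binet's formula, with the denominator 2s cleared. -/
theorem two_mul_telegraphCoeff {lam mu : ℝ} {s : ℂ} (hs : s ^ 2 = lam ^ 2 - mu) :
    ∀ n, 2 * s * telegraphCoeff lam mu n = (-lam + s) ^ n - (-lam - s) ^ n
  | 0 => by simp [telegraphCoeff]
  | 1 => by simp only [telegraphCoeff]; ring
  | n + 2 => by
    have h1 := two_mul_telegraphCoeff hs (n + 1)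
    have h2 := two_mul_telegraphCoeff hs n
    rw [telegraphCoeff_add_two]
    have hmu : (mu : ℂ) = lam ^ 2 - s ^ 2 := by rw [hs]; ring
    linear_combination (-(2 * (lam : ℂ))) * h1 - (mu : ℂ) * h2 -
      ((-lam + s) ^ n - (-lam - s) ^ n) * hmu

theorem telegraphCoeff_double_root (lam : ℝ) :
    ∀ n : ℕ, telegraphCoeff lam (lam ^ 2) (n + 1) = (n + 1) * (-lam : ℂ) ^ n
  | 0 => by simp [telegraphCoeff]
  | 1 => by simp only [telegraphCoeff]; push_cast; ring
  | n + 2 => by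
    have h1 := telegraphCoeff_double_root lam (n + 1)
    have h2 := telegraphCoeff_double_root lam n
    rw [telegraphCoeff_add_two, h1, h2]
    push_cast
    ring

theorem mittagLeffler_mul_ofReal (α β : ℝ) (z : ℂ) (T : ℝ) :
    mittagLeffler α β (z * T) = gammaSeries α β (fun n => z ^ n) T := by
  rw [mittagLeffler, gammaSeries]
  congr 1
  ext n
  push_cast
  rw [mul_pow]; ring

/-- The coefficients of the solution of the scalar telegraph equation. -/
def solutionCoeff (lam mu : ℝ) (n : ℕ) : ℂ :=
  telegraphCoeff lam mu (n + 1) + 2 * lam * telegraphCoeff lam mu n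

theorem geomBounded_two_mul_telegraphCoeff (lam mu : ℝ) :
    GeomBounded fun n => 2 * (lam : ℂ) * telegraphCoeff lam mu n := by
  obtain ⟨C, K, h⟩ := geomBounded_telegraphCoeff lam mu
  refine ⟨‖2 * (lam : ℂ)‖ * C, K, fun n => ?_⟩
  rw [norm_mul, mul_assoc]
  exact mul_le_mul_of_nonneg_left (h n) (norm_nonneg _)

theorem gammaSeries_solutionCoeff {α β T : ℝ} (hα : 0 < α) (hβ : 0 < β) (lam mu : ℝ) :
    gammaSeries α β (solutionCoeff lam mu) T =
      gammaSeries α β (fun n => telegraphCoeff lam mu (n + 1)) T +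
        2 * lam * gammaSeries α β (telegraphCoeff lam mu) T := by
  rw [← gammaSeries_const_mul, ← gammaSeries_add hα hβ (geomBounded_telegraphCoeff lam mu).shift
    (geomBounded_two_mul_telegraphCoeff lam mu)]
  rfl

/-- The index shift is the Caputo derivative on the level of coefficients. In particular the
coefficient with index 1 vanishes, which is the initial condition D^α u(0) = 0. -/
theorem solutionCoeff_succ (lam mu : ℝ) (n : ℕ) :
    solutionCoeff lam mu (n + 1) = -mu * telegraphCoeff lam mu n := by
  rw [solutionCoeff, telegraphCoeff_add_two]; ring

theorem geomBounded_solutionCoeff (lam mu : ℝ) : GeomBounded (solutionCoeff lam mu) := by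
  have hd := @norm_telegraphCoeff_le lam mu (1 + 2 * |lam| + |mu|)
    (by linarith [abs_nonneg lam, abs_nonneg mu]) (by linarith)
  set K := 1 + 2 * |lam| + |mu|
  refine ⟨K + 2 * |lam|, K, fun n => (norm_add_le _ _).trans ?_⟩
  have h1 := hd n
  have h2 := hd (n + 1)
  rw [norm_mul, norm_mul, Complex.norm_real, Real.norm_eq_abs, Complex.norm_ofNat]
  have := mul_le_mul_of_nonneg_left h1 (by positivity : 0 ≤ 2 * |lam|)
  rw [pow_succ] at h2
  nlinarith

theorem multiplier_eq_gammaSeries {α : ℝ} (hα : 0 < α) (lam t mu : ℝ) :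
    multiplier α lam t mu = gammaSeries α 1 (solutionCoeff lam mu) (t ^ α) := by
  rw [multiplier]
  set T : ℝ := t ^ α
  split_ifs with h
  -- At the double root the coefficients are (1 - n)(-λ)^n. After an index shift in the part with n,
  -- Γ(α(n+1) + 1) = α(n+1) Γ(αn + α) cancels the factor n + 1 and leaves E_{α,α}.
  · have e : solutionCoeff lam mu = fun n : ℕ => (-(lam : ℂ)) ^ n + -(n : ℂ) * (-(lam : ℂ)) ^ n := by
      ext n
      rw [h, solutionCoeff, telegraphCoeff_double_root]
      cases n with
      | zero => simp [telegraphCoeff]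
      | succ n => rw [telegraphCoeff_double_root]; push_cast; ring
    have hgb2 : GeomBounded fun n : ℕ => -(n : ℂ) * (-(lam : ℂ)) ^ n := by
      refine ⟨1, 2 * |lam|, fun n => ?_⟩
      rw [norm_mul, norm_neg, norm_pow, norm_neg, Complex.norm_real, Complex.norm_natCast,
        Real.norm_eq_abs, mul_pow, one_mul]
      have : (n : ℝ) ≤ 2 ^ n := by exact_mod_cast Nat.lt_two_pow_self.le
      gcongr
    rw [e, gammaSeries_add hα one_pos (geomBounded_pow _) hgb2, mittagLeffler_mul_ofReal,
      mittagLeffler_mul_ofReal, gammaSeries_eq_add_shift hα one_pos hgb2]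
    congr 1
    simp only [CharP.cast_eq_zero, neg_zero, zero_mul, zero_div, zero_add]
    rw [mul_comm (lam : ℂ) (T : ℂ), mul_div_assoc, mul_assoc, gammaSeries, ← tsum_mul_left,
      gammaSeries]
    congr 2
    ext n
    have hn : 0 < α * n + α := by positivity
    rw [show α * (n : ℝ) + (α + 1) = (α * n + α) + 1 by ring, Real.Gamma_add_one hn.ne']
    have h1 : (Real.Gamma (α * n + α) : ℂ) ≠ 0 := by exact_mod_cast (Real.Gamma_pos_of_pos hn).ne'
    have h2 : ((n : ℂ) + 1) ≠ 0 := by exact_mod_cast n.succ_ne_zero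
    have h3 : (α : ℂ) ≠ 0 := by exact_mod_cast hα.ne'
    have h4 : (α : ℂ) * n + α = α * (n + 1) := by ring
    push_cast
    rw [h4]
    field_simp
    ring
  · set s : ℂ := ((lam ^ 2 - mu : ℝ) : ℂ) ^ (1 / 2 : ℂ)
    have hs : s ^ 2 = lam ^ 2 - mu := by
      rw [← Complex.cpow_nat_mul]
      norm_num
    have hs0 : s ≠ 0 := by
      intro h0
      rw [h0] at hs
      apply h
      have : ((lam ^ 2 - mu : ℝ) : ℂ) = 0 := by push_cast; rw [← hs]; ring
      linarith [Complex.ofReal_eq_zero.1 this]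
    have e : solutionCoeff lam mu = fun n => 1 / 2 * (1 + lam / s) * (-lam + s) ^ n +
        1 / 2 * (1 - lam / s) * (-lam - s) ^ n := by
      ext n
      have h1 := two_mul_telegraphCoeff hs (n + 1)
      have h2 := two_mul_telegraphCoeff hs n
      rw [solutionCoeff]
      field_simp
      linear_combination h1 + 2 * (lam : ℂ) * h2
    have hg : ∀ c z : ℂ, GeomBounded fun n => c * z ^ n := fun c z => ⟨‖c‖, ‖z‖, fun n => by simp⟩
    rw [e, gammaSeries_add hα one_pos (hg _ _) (hg _ _), gammaSeries_const_mul,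
      gammaSeries_const_mul, mittagLeffler_mul_ofReal, mittagLeffler_mul_ofReal]
    ring

/-- Uniformity in `mu` is the point. The Mittag-Leffler bounds apply to each root, but Binet's
formula divides by their difference 2s, which vanishes at `mu = lam ^ 2`. Splitting at `2 * lam ^ 2`
keeps the collision in the range where coefficient bounds suffice and gives |s| ≥ `lam` in the
other. -/
theorem exists_bound_gammaSeries_telegraphCoeff {α β lam : ℝ} (hα0 : 0 < α) (hα1 : α ≤ 1)
    (hlam : 0 < lam) (hβ : β = α ∨ β = 1) (T₀ : ℝ) :
    ∃ C, 0 ≤ C ∧ ∀ mu, 0 < mu → ∀ t, 0 ≤ t → t ≤ T₀ →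
      ‖gammaSeries α β (telegraphCoeff lam mu) (t ^ α)‖ ≤ C ∧
      ‖gammaSeries α β (fun n => telegraphCoeff lam mu (n + 1)) (t ^ α)‖ ≤ C := by
  have hβ0 : 0 < β := by rcases hβ with rfl | rfl <;> [exact hα0; exact one_pos]
  set B : ℝ := 1 / Real.Gamma β with hB
  have hB0 : 0 < B := by have := Real.Gamma_pos_of_pos hβ0; positivity
  have hpow : ∀ z : ℂ, z.re ≤ 0 → ∀ t : ℝ, 0 ≤ t →
      ‖gammaSeries α β (fun n => z ^ n) (t ^ α)‖ ≤ B := by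
    intro z hz t ht
    obtain ⟨h1, h2⟩ := norm_gammaSeries_pow_le hα0 hα1 hz ht
    rcases hβ with rfl | rfl
    · exact h1
    · simpa [hB] using h2
  set K : ℝ := 1 + 2 * lam + 2 * lam ^ 2 with hK
  have hK1 : 1 ≤ K := by rw [hK]; nlinarith
  -- The leading K serves the shifted coefficients, which are bounded by K * K ^ n.
  set C₁ : ℝ := K * ∑' n : ℕ, (K * |T₀| ^ α) ^ n / Real.Gamma (α * n + β) with hC₁
  have hC₁0 : 0 ≤ C₁ := by
    apply mul_nonneg (by linarith)
    apply tsum_nonneg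
    intro n
    have := Real.Gamma_pos_of_pos (by positivity : 0 < α * n + β)
    positivity
  refine ⟨C₁ + B / lam + 2 * B, by positivity, fun mu hmu t ht htT => ?_⟩
  rcases lt_or_ge mu (2 * lam ^ 2) with hlt | hge
  · have hd : ∀ n, ‖telegraphCoeff lam mu n‖ ≤ K ^ n := norm_telegraphCoeff_le hK1 (by
      rw [abs_of_pos hlam, abs_of_pos hmu, hK]; linarith)
    have hT : |t ^ α| ≤ |T₀| ^ α := by
      rw [abs_of_nonneg (Real.rpow_nonneg ht α)]
      exact Real.rpow_le_rpow ht (htT.trans (le_abs_self _)) hα0.le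
    have h0 : C₁ ≤ C₁ + B / lam + 2 * B := by
      have : 0 ≤ B / lam + 2 * B := by positivity
      linarith
    constructor <;> refine le_trans ?_ h0
    · exact norm_gammaSeries_le hα0 hβ0 (by linarith) (by linarith) hT fun n =>
        (hd n).trans (le_mul_of_one_le_left (by positivity) hK1)
    · exact norm_gammaSeries_le hα0 hβ0 (by linarith) (by linarith) hT fun n =>
        (hd (n + 1)).trans_eq (by ring)
  -- The roots are -λ ± iσ with σ ≥ λ. Their moduli are at most 2σ, so the extra factor of a root in
  -- the shifted series is compensated by the denominator 2σ.
  · set σ : ℝ := Real.sqrt (mu - lam ^ 2) with hσ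
    have hσsq : σ ^ 2 = mu - lam ^ 2 := Real.sq_sqrt (by nlinarith)
    have hσlam : lam ≤ σ := Real.le_sqrt_of_sq_le (by linarith)
    have hσ0 : 0 < σ := hlam.trans_le hσlam
    set s : ℂ := σ * Complex.I with hs
    have hs2 : s ^ 2 = lam ^ 2 - mu := by
      rw [hs, mul_pow, Complex.I_sq, ← Complex.ofReal_pow, hσsq]; push_cast; ring
    have hs0 : s ≠ 0 := by
      rw [hs]; exact mul_ne_zero (by exact_mod_cast hσ0.ne') Complex.I_ne_zero
    have hsn : ‖s‖ = σ := by simp [hs, abs_of_pos hσ0]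
    have hr1 : ‖gammaSeries α β (fun n => (-lam + s) ^ n) (t ^ α)‖ ≤ B :=
      hpow _ (by simp [hs]; linarith) t ht
    have hr2 : ‖gammaSeries α β (fun n => (-lam - s) ^ n) (t ^ α)‖ ≤ B :=
      hpow _ (by simp [hs]; linarith) t ht
    have hg : ∀ c z : ℂ, GeomBounded fun n => c * z ^ n := fun c z => ⟨‖c‖, ‖z‖, fun n => by simp⟩
    have e1 : telegraphCoeff lam mu = fun n => (2 * s)⁻¹ * (-lam + s) ^ n +
        -(2 * s)⁻¹ * (-lam - s) ^ n := by
      ext n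
      have := two_mul_telegraphCoeff hs2 n
      field_simp
      linear_combination this
    have e2 : (fun n => telegraphCoeff lam mu (n + 1)) = fun n =>
        (2 * s)⁻¹ * (-lam + s) * (-lam + s) ^ n + -(2 * s)⁻¹ * (-lam - s) * (-lam - s) ^ n := by
      ext n
      have := two_mul_telegraphCoeff hs2 (n + 1)
      field_simp
      linear_combination this
    have hlb : B / σ ≤ B / lam := by gcongr
    have hn2 : ‖(2 * s)⁻¹‖ = (2 * σ)⁻¹ := by rw [norm_inv, norm_mul, hsn]; simp
    constructor
    · rw [e1, gammaSeries_add hα0 hβ0 (hg _ _) (hg _ _), gammaSeries_const_mul,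
        gammaSeries_const_mul]
      refine (norm_add_le _ _).trans ?_
      rw [norm_mul, norm_mul, norm_neg, hn2]
      calc (2 * σ)⁻¹ * _ + (2 * σ)⁻¹ * _ ≤ (2 * σ)⁻¹ * B + (2 * σ)⁻¹ * B := by gcongr
        _ = B / σ := by field_simp; ring
        _ ≤ _ := by linarith
    · have hr : ‖-(lam : ℂ) + s‖ ≤ 2 * σ ∧ ‖-(lam : ℂ) - s‖ ≤ 2 * σ := by
        have hl : ‖-(lam : ℂ)‖ = lam := by simp [abs_of_pos hlam]
        constructor
        · refine (norm_add_le _ _).trans ?_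
          rw [hl, hsn]; linarith
        · refine (norm_sub_le _ _).trans ?_
          rw [hl, hsn]; linarith
      rw [e2, gammaSeries_add hα0 hβ0 (hg _ _) (hg _ _), gammaSeries_const_mul,
        gammaSeries_const_mul]
      refine (norm_add_le _ _).trans ?_
      rw [norm_mul, norm_mul, norm_mul, norm_mul, norm_neg, hn2]
      calc _ ≤ (2 * σ)⁻¹ * (2 * σ) * B + (2 * σ)⁻¹ * (2 * σ) * B := by
            gcongr
            · exact hr.1
            · exact hr.2
        _ = 2 * B := by field_simp; ring
        _ ≤ _ := by
          have : 0 ≤ B / lam := by positivity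
          linarith

/-- The solution of the scalar telegraph equation with symbol value `mu`. -/
def scalarSol (α lam t mu : ℝ) : ℂ := gammaSeries α 1 (solutionCoeff lam mu) (t ^ α)

/-- The Caputo derivative of `scalarSol` divided by `-mu`. -/
def scalarVel (α lam t mu : ℝ) : ℂ := gammaSeries α 1 (telegraphCoeff lam mu) (t ^ α)

/-- The time derivative of `scalarSol` divided by `-mu`. -/
def scalarSolDeriv (α lam t mu : ℝ) : ℂ :=
  ((t ^ (α - 1) : ℝ) : ℂ) * gammaSeries α α (telegraphCoeff lam mu) (t ^ α)

/-- The time derivative of `scalarVel`. -/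
def scalarVelDeriv (α lam t mu : ℝ) : ℂ :=
  ((t ^ (α - 1) : ℝ) : ℂ) * gammaSeries α α (fun n => telegraphCoeff lam mu (n + 1)) (t ^ α)

/-- The Caputo derivative of `scalarVel`. -/
def scalarAcc (α lam t mu : ℝ) : ℂ :=
  gammaSeries α 1 (fun n => telegraphCoeff lam mu (n + 1)) (t ^ α)

/-! ### Identities, bounds and continuity of the scalar solution -/

section Scalar

variable {α lam : ℝ}

/-- This is the scalar telegraph equation itself, divided by `mu`. -/
theorem scalarSol_eq (hα : 0 < α) (t mu : ℝ) :
    scalarSol α lam t mu = scalarAcc α lam t mu + 2 * lam * scalarVel α lam t mu :=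
  gammaSeries_solutionCoeff hα one_pos lam mu

theorem scalarSol_zero (hα : 0 < α) (mu : ℝ) : scalarSol α lam 0 mu = 1 := by
  simp [scalarSol, Real.zero_rpow hα.ne', gammaSeries_at_zero, solutionCoeff, telegraphCoeff]

theorem scalarVel_zero (hα : 0 < α) (mu : ℝ) : scalarVel α lam 0 mu = 0 := by
  simp [scalarVel, Real.zero_rpow hα.ne', gammaSeries_at_zero, telegraphCoeff]

theorem hasDerivAt_scalarSol (hα : 0 < α) {t : ℝ} (ht : 0 < t) (mu : ℝ) :
    HasDerivAt (fun s => scalarSol α lam s mu) (-mu * scalarSolDeriv α lam t mu) t := by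
  have h := hasDerivAt_gammaSeries hα ht (geomBounded_solutionCoeff lam mu)
  rw [show (fun n => solutionCoeff lam mu (n + 1)) = fun n => -mu * telegraphCoeff lam mu n from
    funext (solutionCoeff_succ lam mu), gammaSeries_const_mul, mul_left_comm] at h
  exact h

theorem hasDerivAt_scalarVel (hα : 0 < α) {t : ℝ} (ht : 0 < t) (mu : ℝ) :
    HasDerivAt (fun s => scalarVel α lam s mu) (scalarVelDeriv α lam t mu) t :=
  hasDerivAt_gammaSeries hα ht (geomBounded_telegraphCoeff lam mu)

theorem integral_sub_rpow_mul_gammaSeries_diag (hα0 : 0 < α) (hα1 : α < 1) {t : ℝ} (ht : 0 < t)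
    {a : ℕ → ℂ} (ha : GeomBounded a) :
    ∫ τ in (0 : ℝ)..t, (((t - τ) ^ (-α) : ℝ) : ℂ) *
        (((τ ^ (α - 1) : ℝ) : ℂ) * gammaSeries α α a (τ ^ α)) =
      Real.Gamma (1 - α) * gammaSeries α 1 a (t ^ α) := by
  have h := integral_rpow_mul_gammaSeries hα0 hα0 (γ := 1 - α) (by linarith) ht ha
  rw [show 1 - α - 1 = -α by ring, show α + (1 - α) - 1 = 0 by ring, Real.rpow_zero,
    Complex.ofReal_one, mul_one, show α + (1 - α) = 1 by ring] at h
  rw [← h]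
  congr 1; ext τ; push_cast; ring

theorem integral_scalarSolDeriv (hα0 : 0 < α) (hα1 : α < 1) {t : ℝ} (ht : 0 < t) (mu : ℝ) :
    ∫ τ in (0 : ℝ)..t, (((t - τ) ^ (-α) : ℝ) : ℂ) * scalarSolDeriv α lam τ mu =
      Real.Gamma (1 - α) * scalarVel α lam t mu :=
  integral_sub_rpow_mul_gammaSeries_diag hα0 hα1 ht (geomBounded_telegraphCoeff lam mu)

theorem integral_scalarVelDeriv (hα0 : 0 < α) (hα1 : α < 1) {t : ℝ} (ht : 0 < t) (mu : ℝ) :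
    ∫ τ in (0 : ℝ)..t, (((t - τ) ^ (-α) : ℝ) : ℂ) * scalarVelDeriv α lam τ mu =
      Real.Gamma (1 - α) * scalarAcc α lam t mu :=
  integral_sub_rpow_mul_gammaSeries_diag hα0 hα1 ht (geomBounded_telegraphCoeff lam mu).shift

theorem scalarSolDeriv_one (t mu : ℝ) : scalarSolDeriv 1 lam t mu = scalarVel 1 lam t mu := by
  simp [scalarSolDeriv, scalarVel]

theorem scalarVelDeriv_one (t mu : ℝ) : scalarVelDeriv 1 lam t mu = scalarAcc 1 lam t mu := by
  simp [scalarVelDeriv, scalarAcc]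

/-- These bounds supply both the boundedness required by the functional calculus and the dominating
functions in L². The singularity t^(α-1) of the time derivatives is integrable. -/
theorem exists_bound_scalar (hα0 : 0 < α) (hα1 : α ≤ 1) (hlam : 0 < lam) (T₀ : ℝ) :
    ∃ C, 0 ≤ C ∧ ∀ mu, 0 < mu → ∀ t, 0 ≤ t → t ≤ T₀ →
      ‖scalarSol α lam t mu‖ ≤ C ∧ ‖scalarVel α lam t mu‖ ≤ C ∧ ‖scalarAcc α lam t mu‖ ≤ C ∧
      ‖scalarSolDeriv α lam t mu‖ ≤ C * t ^ (α - 1) ∧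
      ‖scalarVelDeriv α lam t mu‖ ≤ C * t ^ (α - 1) := by
  obtain ⟨C₁, hC₁, h₁⟩ := exists_bound_gammaSeries_telegraphCoeff hα0 hα1 hlam (.inr rfl) T₀
  obtain ⟨C₂, hC₂, h₂⟩ := exists_bound_gammaSeries_telegraphCoeff hα0 hα1 hlam (.inl rfl) T₀
  refine ⟨C₁ + 2 * lam * C₁ + C₂, by positivity, fun mu hmu t ht htT => ?_⟩
  obtain ⟨hv, ha⟩ := h₁ mu hmu t ht htT
  obtain ⟨hv', ha'⟩ := h₂ mu hmu t ht htT
  have hp : 0 ≤ 2 * lam * C₁ := by positivity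
  have hmul : ∀ z : ℂ, ‖z‖ ≤ C₂ →
      ‖((t ^ (α - 1) : ℝ) : ℂ) * z‖ ≤ (C₁ + 2 * lam * C₁ + C₂) * t ^ (α - 1) := by
    intro z hz
    rw [norm_mul, Complex.norm_real, Real.norm_of_nonneg (Real.rpow_nonneg ht _), mul_comm]
    have := Real.rpow_nonneg ht (α - 1)
    gcongr
    linarith
  refine ⟨?_, hv.trans (by linarith), ha.trans (by linarith), hmul _ hv', hmul _ ha'⟩
  rw [scalarSol_eq hα0]
  refine (norm_add_le _ _).trans ?_
  rw [norm_mul, norm_mul, Complex.norm_real, Real.norm_of_nonneg hlam.le, Complex.norm_ofNat]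
  have : 2 * lam * ‖scalarVel α lam t mu‖ ≤ 2 * lam * C₁ := by gcongr; exact hv
  change ‖scalarAcc α lam t mu‖ ≤ C₁ at ha
  linarith

/-- The shift `k` covers velocity (k = 0) and acceleration (k = 1) at once. Here the geometric bound
is only local in the symbol value, which is enough for continuity. -/
theorem continuousAt_gammaSeries_telegraphCoeff {β : ℝ} (hα : 0 < α) (hβ : 0 < β) (k : ℕ)
    (p : ℝ × ℝ) : ContinuousAt
      (fun p : ℝ × ℝ => gammaSeries α β (fun n => telegraphCoeff lam p.2 (n + k)) (p.1 ^ α)) p := by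
  set R : ℝ := |p.2| + 1
  set K : ℝ := 1 + 2 * |lam| + R
  have hR : 0 ≤ R := by positivity
  have hcont : Continuous fun q : ℝ × ℝ => q.1 ^ α :=
    (Real.continuous_rpow_const hα.le).comp continuous_fst
  set s : Set (ℝ × ℝ) := {q | |q.2| < R ∧ |q.1 ^ α| < |p.1 ^ α| + 1} with hs
  have hso : IsOpen s := (isOpen_lt (continuous_abs.comp continuous_snd) continuous_const).inter
    (isOpen_lt (continuous_abs.comp hcont) continuous_const)
  have hps : p ∈ s := ⟨by simp [R], by simp⟩
  refine (continuousOn_gammaSeries (s := s) (C := K ^ k) (K := K) (T₀ := |p.1 ^ α| + 1) hα hβ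
    (by positivity) (by positivity) (fun n => ?_) hcont.continuousOn (fun q hq n => ?_)
    fun q hq => hq.2.le).continuousAt (hso.mem_nhds hps)
  · exact ((continuous_telegraphCoeff lam (n + k)).comp continuous_snd).continuousOn
  · rw [← pow_add, add_comm k n]
    exact norm_telegraphCoeff_le (by simp only [K]; linarith [abs_nonneg lam])
      (by simp only [K]; linarith [hq.1]) _

theorem continuous_scalarVel (hα : 0 < α) :
    Continuous fun p : ℝ × ℝ => scalarVel α lam p.1 p.2 :=
  continuous_iff_continuousAt.2 fun p => continuousAt_gammaSeries_telegraphCoeff hα one_pos 0 p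

theorem continuous_scalarAcc (hα : 0 < α) :
    Continuous fun p : ℝ × ℝ => scalarAcc α lam p.1 p.2 :=
  continuous_iff_continuousAt.2 fun p => continuousAt_gammaSeries_telegraphCoeff hα one_pos 1 p

theorem continuous_scalarSol (hα : 0 < α) :
    Continuous fun p : ℝ × ℝ => scalarSol α lam p.1 p.2 := by
  simp only [scalarSol_eq hα]
  exact (continuous_scalarAcc hα).add (continuous_const.mul (continuous_scalarVel hα))

theorem measurable_scalarSolDeriv (hα : 0 < α) :
    Measurable fun p : ℝ × ℝ => scalarSolDeriv α lam p.1 p.2 :=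
  (Complex.measurable_ofReal.comp (measurable_fst.pow_const _)).mul
    (continuous_iff_continuousAt.2 fun p =>
      continuousAt_gammaSeries_telegraphCoeff hα hα 0 p).measurable

theorem measurable_scalarVelDeriv (hα : 0 < α) :
    Measurable fun p : ℝ × ℝ => scalarVelDeriv α lam p.1 p.2 :=
  (Complex.measurable_ofReal.comp (measurable_fst.pow_const _)).mul
    (continuous_iff_continuousAt.2 fun p =>
      continuousAt_gammaSeries_telegraphCoeff hα hα 1 p).measurable

end Scalar

/-! ### Fractional integration of the Caputo derivative and a Gronwall lemma -/

theorem absolutelyContinuousOnInterval_of_dist_le {X Y : Type*} [PseudoMetricSpace X]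
    [PseudoMetricSpace Y] {f : ℝ → X} {g : ℝ → Y} {a b C : ℝ}
    (hg : AbsolutelyContinuousOnInterval g a b)
    (h : ∀ x ∈ uIcc a b, ∀ y ∈ uIcc a b, dist (f x) (f y) ≤ C * dist (g x) (g y)) :
    AbsolutelyContinuousOnInterval f a b := by
  rw [absolutelyContinuousOnInterval_iff] at hg ⊢
  intro ε hε
  have hC : 0 < |C| + 1 := by positivity
  obtain ⟨δ, hδ, hδ'⟩ := hg (ε / (|C| + 1)) (by positivity)
  refine ⟨δ, hδ, fun E hE hlt => ?_⟩
  calc ∑ i ∈ Finset.range E.1, dist (f (E.2 i).1) (f (E.2 i).2)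
      ≤ ∑ i ∈ Finset.range E.1, (|C| + 1) * dist (g (E.2 i).1) (g (E.2 i).2) := by
        apply Finset.sum_le_sum
        intro i hi
        obtain ⟨h1, h2⟩ := hE.1 i hi
        refine (h _ h1 _ h2).trans ?_
        have := le_abs_self C
        gcongr
        linarith
    _ = (|C| + 1) * ∑ i ∈ Finset.range E.1, dist (g (E.2 i).1) (g (E.2 i).2) :=
        (Finset.mul_sum _ _ _).symm
    _ < (|C| + 1) * (ε / (|C| + 1)) := by
        have := hδ' E hE hlt
        gcongr
    _ = ε := by field_simp

/-- The kernels of fractional integration of orders α and 1 - α convolve to a constant; this is the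
semigroup law. -/
theorem integral_triangle_kernel {α t τ : ℝ} (hα0 : 0 < α) (hα1 : α < 1) (hτ : τ < t) :
    ∫ s in τ..t, (t - s) ^ (α - 1) * (s - τ) ^ (-α) = Real.Gamma α * Real.Gamma (1 - α) := by
  have h := integral_sub_rpow_mul_rpow (a := 1 - α) (b := α) (t := t - τ) (by linarith) hα0
    (by linarith)
  rw [show 1 - α - 1 = -α by ring, show 1 - α + α = 1 by ring, sub_self, Real.rpow_zero,
    Real.Gamma_one, div_one, mul_one, mul_comm] at h
  rw [← h]
  have := intervalIntegral.integral_comp_sub_right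
    (fun x => (t - τ - x) ^ (α - 1) * x ^ (-α)) τ (a := τ) (b := t)
  rw [sub_self] at this
  rw [← this]
  congr 1; ext s
  congr 2; ring

theorem intervalIntegrable_triangle_kernel {α t τ : ℝ} (hα0 : 0 < α) (hα1 : α < 1) (hτ : τ < t) :
    IntervalIntegrable (fun s => (t - s) ^ (α - 1) * (s - τ) ^ (-α)) volume τ t := by
  by_contra h
  have h1 := integral_triangle_kernel hα0 hα1 hτ
  rw [intervalIntegral.integral_undef h] at h1
  have := Real.Gamma_pos_of_pos hα0
  have := Real.Gamma_pos_of_pos (by linarith : 0 < 1 - α)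
  exact (by positivity : (0 : ℝ) < Real.Gamma α * Real.Gamma (1 - α)).ne h1

/-- The fractional integral of the fractional integral of complementary order. -/
theorem integral_rpow_mul_integral_rpow {α t : ℝ} (hα0 : 0 < α) (hα1 : α < 1) (ht : 0 < t)
    {g : ℝ → ℝ} (hg : IntervalIntegrable g volume 0 t) (hgm : Measurable g) :
    IntervalIntegrable
      (fun s => (t - s) ^ (α - 1) * ∫ τ in (0 : ℝ)..s, (s - τ) ^ (-α) * g τ) volume 0 t ∧
    ∫ s in (0 : ℝ)..t, (t - s) ^ (α - 1) * ∫ τ in (0 : ℝ)..s, (s - τ) ^ (-α) * g τ =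
      Real.Gamma α * Real.Gamma (1 - α) * ∫ τ in (0 : ℝ)..t, g τ := by
  set ν : Measure ℝ := volume.restrict (Ioc 0 t) with hν
  have hΓ := Real.Gamma_pos_of_pos hα0
  have hΓ' := Real.Gamma_pos_of_pos (by linarith : 0 < 1 - α)
  -- Extending the kernel by zero off the triangle τ < s lets Fubini's theorem be applied on a
  -- square. The constant slice integrals prove both integrability and the formula.
  set k : ℝ × ℝ → ℝ := {p : ℝ × ℝ | p.2 < p.1}.indicator
    (fun p => (t - p.1) ^ (α - 1) * (p.1 - p.2) ^ (-α)) with hk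
  have hkm : Measurable k := by
    apply Measurable.indicator
    · exact ((measurable_const.sub measurable_fst).pow_const _).mul
        ((measurable_fst.sub measurable_snd).pow_const _)
    · exact measurableSet_lt measurable_snd measurable_fst
  have hk0 : ∀ p : ℝ × ℝ, p.1 ≤ t → 0 ≤ k p := by
    intro p hp
    rw [hk, indicator_apply]
    split_ifs with hp2
    · exact mul_nonneg (Real.rpow_nonneg (by linarith) _)
        (Real.rpow_nonneg (sub_nonneg.2 (le_of_lt hp2)) _)
    · exact le_rfl
  have hslice : ∀ τ ∈ Ioo 0 t, Integrable (fun s => k (s, τ)) ν ∧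
      ∫ s, k (s, τ) ∂ν = Real.Gamma α * Real.Gamma (1 - α) := by
    intro τ hτ
    have e : (fun s => k (s, τ)) =
        (Ioi τ).indicator fun s => (t - s) ^ (α - 1) * (s - τ) ^ (-α) := by
      ext s; simp [hk, indicator]
    have hset : Ioc 0 t ∩ Ioi τ = Ioc τ t := by
      ext s; simp only [mem_inter_iff, mem_Ioc, mem_Ioi]
      constructor
      · rintro ⟨⟨_, h⟩, h2⟩; exact ⟨h2, h⟩
      · rintro ⟨h, h2⟩; exact ⟨⟨hτ.1.trans h, h2⟩, h⟩
    rw [e, integrable_indicator_iff measurableSet_Ioi, integral_indicator measurableSet_Ioi,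
      IntegrableOn, hν, Measure.restrict_restrict measurableSet_Ioi, inter_comm, hset,
      ← intervalIntegral.integral_of_le hτ.2.le, integral_triangle_kernel hα0 hα1 hτ.2]
    exact ⟨(intervalIntegrable_iff_integrableOn_Ioc_of_le hτ.2.le).1
      (intervalIntegrable_triangle_kernel hα0 hα1 hτ.2), rfl⟩
  have hae : ∀ᵐ τ ∂ν, τ ∈ Ioo 0 t := by
    have : ∀ᵐ τ ∂ν, τ ≠ t := by
      apply ae_restrict_of_ae
      simp [ae_iff]
    filter_upwards [ae_restrict_mem measurableSet_Ioc, this] with τ h1 h2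
    exact ⟨h1.1, lt_of_le_of_ne h1.2 h2⟩
  have hgi : Integrable g ν := (intervalIntegrable_iff_integrableOn_Ioc_of_le ht.le).1 hg
  have hF : Integrable (fun p : ℝ × ℝ => k p * g p.2) (ν.prod ν) := by
    have hm : Measurable fun p : ℝ × ℝ => k p * g p.2 := hkm.mul (hgm.comp measurable_snd)
    rw [integrable_prod_iff' hm.aestronglyMeasurable]
    refine ⟨?_, ?_⟩
    · filter_upwards [hae] with τ hτ
      exact (hslice τ hτ).1.mul_const _
    · have : (fun τ => ∫ s, ‖k (s, τ) * g τ‖ ∂ν) =ᵐ[ν] fun τ =>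
          Real.Gamma α * Real.Gamma (1 - α) * ‖g τ‖ := by
        filter_upwards [hae] with τ hτ
        rw [← (hslice τ hτ).2, ← integral_mul_const]
        apply integral_congr_ae
        filter_upwards [ae_restrict_mem measurableSet_Ioc] with s hs
        rw [norm_mul, Real.norm_of_nonneg (hk0 _ hs.2)]
      exact (hgi.norm.const_mul _).congr this.symm
  have hinner : ∀ s ∈ Ioc 0 t, ∫ τ, k (s, τ) * g τ ∂ν =
      (t - s) ^ (α - 1) * ∫ τ in (0 : ℝ)..s, (s - τ) ^ (-α) * g τ := by
    intro s hs
    have e : (fun τ => k (s, τ) * g τ) = (Iio s).indicator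
        fun τ => (t - s) ^ (α - 1) * ((s - τ) ^ (-α) * g τ) := by
      ext τ
      by_cases h : τ < s
      · simp [hk, indicator, h]; ring
      · simp [hk, indicator, h]
    have hset : Ioc 0 t ∩ Iio s = Ioo 0 s := by
      ext τ; simp only [mem_inter_iff, mem_Ioc, mem_Iio, mem_Ioo]
      constructor
      · rintro ⟨⟨h, _⟩, h2⟩; exact ⟨h, h2⟩
      · rintro ⟨h, h2⟩; exact ⟨⟨h, h2.le.trans hs.2⟩, h2⟩
    rw [e, integral_indicator measurableSet_Iio, hν, Measure.restrict_restrict measurableSet_Iio,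
      inter_comm, hset, integral_const_mul, intervalIntegral.integral_of_le hs.1.le,
      integral_Ioc_eq_integral_Ioo]
  have hinner_ae : (fun s => ∫ τ, k (s, τ) * g τ ∂ν) =ᵐ[ν] fun s =>
      (t - s) ^ (α - 1) * ∫ τ in (0 : ℝ)..s, (s - τ) ^ (-α) * g τ := by
    filter_upwards [ae_restrict_mem measurableSet_Ioc] with s hs using hinner s hs
  constructor
  · rw [intervalIntegrable_iff_integrableOn_Ioc_of_le ht.le]
    exact hF.integral_prod_left.congr hinner_ae
  · rw [intervalIntegral.integral_of_le ht.le, intervalIntegral.integral_of_le ht.le,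
      ← integral_congr_ae hinner_ae, integral_integral_swap hF, ← integral_const_mul]
    apply integral_congr_ae
    filter_upwards [hae] with τ hτ
    rw [integral_mul_const, (hslice τ hτ).2]

/-- Fractional integration of order α undoes the Caputo derivative: the kernels compose to plain
integration of u'. Testing against a real functional reduces to the fundamental theorem of calculus
for real absolutely continuous functions; a.e. differentiability of u identifies the derivative of
`ℓ ∘ u` with `ℓ` of the derivative. -/
theorem CaputoDifferentiable.integral_caputo {E : Type*} [NormedAddCommGroup E] [NormedSpace ℝ E]
    [CompleteSpace E] {α : ℝ} (hα0 : 0 < α) (hα1 : α ≤ 1) {u : ℝ → E}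
    (hu : CaputoDifferentiable α u) (ℓ : E →L[ℝ] ℝ) {t : ℝ} (ht : 0 < t) :
    IntervalIntegrable (fun s => (t - s) ^ (α - 1) * ℓ (caputo α u s)) volume 0 t ∧
    ∫ s in (0 : ℝ)..t, (t - s) ^ (α - 1) * ℓ (caputo α u s) =
      Real.Gamma α * (ℓ (u t) - ℓ (u 0)) := by
  have hac : AbsolutelyContinuousOnInterval (fun s => ℓ (u s)) 0 t :=
    absolutelyContinuousOnInterval_of_dist_le (hu.absCont t ht) (C := ‖ℓ‖) fun x _ y _ => by
      rw [dist_eq_norm, dist_eq_norm, ← map_sub]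
      exact ℓ.le_opNorm _
  have hftc := hac.integral_deriv_eq_sub
  have hii := hac.intervalIntegrable_deriv
  have hder : ∀ᵐ s ∂volume.restrict (Ioi (0 : ℝ)), deriv (fun s => ℓ (u s)) s = ℓ (deriv u s) := by
    filter_upwards [hu.ae_differentiable] with s hs
    exact (ℓ.hasFDerivAt.comp_hasDerivAt s hs.hasDerivAt).deriv
  rcases hα1.eq_or_lt with rfl | hα1
  · have e : EqOn (fun s => (t - s) ^ ((1 : ℝ) - 1) * ℓ (caputo 1 u s))
        (deriv fun s => ℓ (u s)) (Ioc 0 t) := by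
      intro s hs
      have hd : DifferentiableAt ℝ u s := by simpa using hu.exists_caputo s hs.1
      simp only [caputo, sub_self, Real.rpow_zero, one_mul, if_true]
      exact (ℓ.hasFDerivAt.comp_hasDerivAt s hd.hasDerivAt).deriv.symm
    constructor
    · rw [intervalIntegrable_iff_integrableOn_Ioc_of_le ht.le] at hii ⊢
      exact hii.congr_fun e.symm measurableSet_Ioc
    · rw [Real.Gamma_one, one_mul, ← hftc, intervalIntegral.integral_of_le ht.le,
        intervalIntegral.integral_of_le ht.le]
      exact setIntegral_congr_fun measurableSet_Ioc e
  · have hΓ' := Real.Gamma_pos_of_pos (by linarith : 0 < 1 - α)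
    obtain ⟨h1, h2⟩ := integral_rpow_mul_integral_rpow hα0 hα1 ht hii (measurable_deriv _)
    have e : EqOn (fun s => (t - s) ^ (α - 1) * ℓ (caputo α u s))
        (fun s => (Real.Gamma (1 - α))⁻¹ * ((t - s) ^ (α - 1) *
          ∫ τ in (0 : ℝ)..s, (s - τ) ^ (-α) * deriv (fun s => ℓ (u s)) τ)) (Ioc 0 t) := by
      intro s hs
      have hex : IntervalIntegrable (fun τ : ℝ => (s - τ) ^ (-α) • deriv u τ) volume 0 s := by
        simpa [hα1.ne] using hu.exists_caputo s hs.1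
      have : ∫ τ in (0 : ℝ)..s, (s - τ) ^ (-α) * deriv (fun s => ℓ (u s)) τ =
          ∫ τ in (0 : ℝ)..s, ℓ ((s - τ) ^ (-α) • deriv u τ) := by
        rw [intervalIntegral.integral_of_le hs.1.le, intervalIntegral.integral_of_le hs.1.le]
        apply integral_congr_ae
        filter_upwards [ae_restrict_of_ae_restrict_of_subset
          (fun x hx => hx.1 : Ioc 0 s ⊆ Ioi 0) hder] with τ hτ
        rw [hτ, map_smul, smul_eq_mul]
      simp only [caputo, hα1.ne, if_false]
      rw [this, ℓ.intervalIntegral_comp_comm hex, map_smul, smul_eq_mul]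
      ring
    constructor
    · rw [intervalIntegrable_iff_integrableOn_Ioc_of_le ht.le] at h1 ⊢
      exact IntegrableOn.congr_fun (h1.const_mul _) e.symm measurableSet_Ioc
    · rw [intervalIntegral.integral_of_le ht.le, setIntegral_congr_fun measurableSet_Ioc e,
        integral_const_mul, ← intervalIntegral.integral_of_le ht.le, h2, hftc]
      field_simp

/-- A Gronwall lemma for the Abel kernel. -/
theorem eq_zero_of_le_integral_rpow {α T C : ℝ} (hα : 0 < α) (hC : 0 ≤ C) {x : ℝ → ℝ}
    (hxc : ContinuousOn x (Icc 0 T)) (hx0 : ∀ t ∈ Icc 0 T, 0 ≤ x t)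
    (hle : ∀ t ∈ Ioc 0 T, x t ≤ C * ∫ s in (0 : ℝ)..t, (t - s) ^ (α - 1) * x s) :
    ∀ t ∈ Ioc 0 T, x t = 0 := by
  obtain ⟨M, hM⟩ := isCompact_Icc.exists_bound_of_continuousOn hxc
  have hΓ := Real.Gamma_pos_of_pos hα
  -- Iterating the inequality n times bounds x by M times the n-th term of a convergent
  -- Mittag-Leffler series; each step is a Beta integral. The terms tend to zero.
  have key : ∀ n : ℕ, ∀ t ∈ Ioc 0 T,
      x t ≤ M * ((C * Real.Gamma α) ^ n * t ^ (α * n) / Real.Gamma (α * n + 1)) := by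
    intro n
    induction n with
    | zero =>
      intro t ht
      simpa using (le_abs_self _).trans (hM t ⟨ht.1.le, ht.2⟩)
    | succ n ih =>
      intro t ht
      have hn : 0 < α * n + 1 := by positivity
      have hI := integral_sub_rpow_mul_rpow hn hα ht.1
      have hii := intervalIntegrable_sub_rpow_mul_rpow hn hα ht.1
      rw [add_sub_cancel_right] at hI hii
      set A : ℝ := M * ((C * Real.Gamma α) ^ n / Real.Gamma (α * n + 1)) with hA
      have h1 : ∫ s in (0 : ℝ)..t, (t - s) ^ (α - 1) * x s ≤
          ∫ s in (0 : ℝ)..t, (t - s) ^ (α - 1) * s ^ (α * n) * A := by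
        have hii1 : IntervalIntegrable (fun s : ℝ => (t - s) ^ (α - 1)) volume 0 t := by
          simpa using intervalIntegrable_sub_rpow_mul_rpow one_pos hα ht.1
        rw [intervalIntegral.integral_of_le ht.1.le, intervalIntegral.integral_of_le ht.1.le]
        apply setIntegral_mono_on _ _ measurableSet_Ioc
        · intro s hs
          rw [mul_assoc]
          apply mul_le_mul_of_nonneg_left _ (Real.rpow_nonneg (by linarith [hs.2]) _)
          refine (ih s ⟨hs.1, hs.2.trans ht.2⟩).trans_eq ?_
          rw [hA]; ring
        · rw [← intervalIntegrable_iff_integrableOn_Ioc_of_le ht.1.le]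
          exact hii1.mul_continuousOn (hxc.mono (by
            rw [uIcc_of_le ht.1.le]; exact Icc_subset_Icc_right ht.2))
        · rw [← intervalIntegrable_iff_integrableOn_Ioc_of_le ht.1.le]
          exact hii.mul_const _
      rw [intervalIntegral.integral_mul_const, hI] at h1
      refine (hle t ht).trans ((mul_le_mul_of_nonneg_left h1 hC).trans_eq ?_)
      have hΓn := (Real.Gamma_pos_of_pos hn).ne'
      rw [hA, show α * (n : ℝ) + 1 + α - 1 = α * ((n + 1 : ℕ) : ℝ) by push_cast; ring,
        show α * (n : ℝ) + 1 + α = α * ((n + 1 : ℕ) : ℝ) + 1 by push_cast; ring]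
      field_simp
      ring
  intro t ht
  refine le_antisymm ?_ (hx0 t ⟨ht.1.le, ht.2⟩)
  have hlim := ((summable_pow_div_Gamma hα one_pos
    (C * Real.Gamma α * t ^ α)).tendsto_atTop_zero).const_mul M
  rw [mul_zero] at hlim
  refine ge_of_tendsto' hlim fun n => (key n t ht).trans_eq ?_
  rw [mul_pow (C * Real.Gamma α), Real.rpow_mul ht.1.le, Real.rpow_natCast]

/-! ### Curves in `L²` given pointwise on the Fourier side -/

section Curves

variable {d : ℕ}

theorem norm_sq_L2 (f : L2 d) : ‖f‖ ^ 2 = ∫ x, ‖f x‖ ^ 2 := by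
  have h := L2.inner_def (𝕜 := ℂ) f f
  rw [inner_self_eq_norm_sq_to_K] at h
  have h2 : ∫ x, inner ℂ (f x) (f x) = ((∫ x, ‖f x‖ ^ 2 : ℝ) : ℂ) := by
    rw [← integral_complex_ofReal]
    congr 1; ext x
    rw [inner_self_eq_norm_sq_to_K]; push_cast; rfl
  rw [h2] at h
  apply Complex.ofReal_injective
  rw [← h]
  push_cast
  rfl

theorem norm_le_of_ae_le {X : L2 d} {χ : EuclideanSpace ℝ (Fin d) → ℂ} (hX : X =ᵐ[volume] χ)
    {B : EuclideanSpace ℝ (Fin d) → ℝ} (hB : MemLp B 2 volume) {c : ℝ} (hc : 0 ≤ c)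
    (h : ∀ᵐ x, ‖χ x‖ ≤ c * B x) :
    ‖X‖ ≤ c * (eLpNorm B 2 volume).toReal := by
  have h1 : ∀ᵐ x, ‖X x‖ ≤ c * ‖hB.toLp B x‖ := by
    filter_upwards [hX, h, hB.coeFn_toLp] with x h1 h2 h3
    rw [h1, h3]
    exact h2.trans (mul_le_mul_of_nonneg_left (le_abs_self _) hc)
  have := Lp.norm_le_mul_norm_of_ae_le_mul h1
  rwa [Lp.norm_toLp] at this

/-- Dominated convergence in `L²`. -/
theorem tendsto_norm_zero_of_dominated {ι : Type*} {l : Filter ι} [l.IsCountablyGenerated]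
    {X : ι → L2 d} {χ : ι → EuclideanSpace ℝ (Fin d) → ℂ} (hX : ∀ᶠ i in l, X i =ᵐ[volume] χ i)
    {B : EuclideanSpace ℝ (Fin d) → ℝ} (hB : MemLp B 2 volume)
    (hbd : ∀ᶠ i in l, ∀ᵐ x, ‖χ i x‖ ≤ B x) (hlim : ∀ᵐ x, Tendsto (fun i => χ i x) l (𝓝 0)) :
    Tendsto (fun i => ‖X i‖) l (𝓝 0) := by
  have hsq : Tendsto (fun i => ‖X i‖ ^ 2) l (𝓝 0) := by
    have h1 : Tendsto (fun i => ∫ x, ‖χ i x‖ ^ 2) l (𝓝 (∫ _ : EuclideanSpace ℝ (Fin d), (0 : ℝ))) := by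
      apply tendsto_integral_filter_of_dominated_convergence (fun x => B x ^ 2)
      · filter_upwards [hX] with i hi
        exact (((Lp.aestronglyMeasurable (X i)).congr hi).norm.pow 2)
      · filter_upwards [hbd] with i hi
        filter_upwards [hi] with x hx
        rw [Real.norm_of_nonneg (by positivity)]
        gcongr
      · exact hB.integrable_sq
      · filter_upwards [hlim] with x hx
        simpa using (hx.norm.pow 2)
    rw [integral_zero] at h1
    refine h1.congr' ?_
    filter_upwards [hX] with i hi
    rw [norm_sq_L2]
    apply integral_congr_ae
    filter_upwards [hi] with x hx
    rw [hx]
  have := hsq.sqrt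
  simpa using this

variable {E : Type*} [NormedAddCommGroup E] [NormedSpace ℝ E] [CompleteSpace E]

/-- Increments are controlled by those of t^α, so absolute continuity down to time zero survives the
singular derivative. -/
theorem norm_sub_le_of_norm_deriv_le_rpow {α c s t : ℝ} (hα : 0 < α) (hs : 0 ≤ s) (hst : s ≤ t)
    {φ ψ : ℝ → ℂ} (hφ : ContinuousOn φ (Ici 0)) (hd : ∀ t, 0 < t → HasDerivAt φ (ψ t) t)
    (hψm : Measurable ψ) (hbd : ∀ τ ∈ Ioc 0 t, ‖ψ τ‖ ≤ c * τ ^ (α - 1)) :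
    ‖φ t - φ s‖ ≤ c / α * (t ^ α - s ^ α) := by
  have hii : IntervalIntegrable (fun τ : ℝ => c * τ ^ (α - 1)) volume s t :=
    (intervalIntegral.intervalIntegrable_rpow' (by linarith)).const_mul c
  have hbd' : ∀ τ ∈ Ioc s t, ‖ψ τ‖ ≤ c * τ ^ (α - 1) := fun τ hτ =>
    hbd τ ⟨hs.trans_lt hτ.1, hτ.2⟩
  have hψ : IntervalIntegrable ψ volume s t := by
    rw [intervalIntegrable_iff_integrableOn_Ioc_of_le hst] at hii ⊢
    refine Integrable.mono' hii hψm.aestronglyMeasurable ?_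
    filter_upwards [ae_restrict_mem measurableSet_Ioc] with τ hτ using hbd' τ hτ
  have h1 := intervalIntegral.integral_eq_sub_of_hasDerivAt_of_le hst
    (hφ.mono fun x hx => hs.trans hx.1) (fun x hx => hd x (hs.trans_lt hx.1)) hψ
  have h2 : ∫ τ in s..t, c * τ ^ (α - 1) = c / α * (t ^ α - s ^ α) := by
    rw [intervalIntegral.integral_const_mul, integral_rpow (Or.inl (by linarith)), sub_add_cancel]
    ring
  rw [← h1, ← h2]
  refine intervalIntegral.norm_integral_le_of_norm_le hst ?_ hii
  filter_upwards with τ hτ using hbd' τ hτ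

/-- A curve whose image under an isometry into `L²` is given pointwise by differentiable functions
with an integrable singularity of the derivative at time zero is Caputo differentiable, and its
Caputo derivative is computed pointwise. -/
theorem caputoDifferentiable_of_pointwise {α : ℝ} (hα0 : 0 < α) (hα1 : α ≤ 1)
    (J : E →ₗᵢ[ℝ] L2 d) {u D c : ℝ → E} {φ ψ θ : ℝ → EuclideanSpace ℝ (Fin d) → ℂ}
    {B : EuclideanSpace ℝ (Fin d) → ℝ}
    (hu : ∀ t, 0 ≤ t → J (u t) =ᵐ[volume] φ t) (hD : ∀ t, 0 < t → J (D t) =ᵐ[volume] ψ t)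
    (hc : ∀ t, 0 < t → J (c t) =ᵐ[volume] θ t)
    (hψm : Measurable (Function.uncurry ψ)) (hB : MemLp B 2 volume)
    (hφc : ∀ η, ContinuousOn (fun t => φ t η) (Ici 0))
    (hφd : ∀ η t, 0 < t → HasDerivAt (fun t => φ t η) (ψ t η) t)
    (hθ : ∀ η t, 0 < t → if α = 1 then ψ t η = θ t η else
      ∫ τ in (0 : ℝ)..t, (((t - τ) ^ (-α) : ℝ) : ℂ) * ψ τ η = Real.Gamma (1 - α) * θ t η)
    (hbd : ∀ T, ∃ C, 0 ≤ C ∧ ∀ᵐ η, ∀ t ∈ Ioc 0 T, ‖ψ t η‖ ≤ C * B η * t ^ (α - 1)) :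
    CaputoDifferentiable α u ∧ ∀ t, 0 < t → caputo α u t = c t := by
  have hψη : ∀ η, Measurable fun t => ψ t η := fun η =>
    hψm.comp (measurable_id.prodMk measurable_const)
  set nB : ℝ := (eLpNorm B 2 volume).toReal with hnB
  -- The difference quotients converge pointwise on the Fourier side. On [t/2, 2t] the mean value
  -- inequality bounds them by a multiple of B, so they converge in L².
  have hderiv : ∀ t, 0 < t → HasDerivAt u (D t) t := by
    intro t ht
    rw [hasDerivAt_iff_tendsto_slope, tendsto_iff_norm_sub_tendsto_zero]
    obtain ⟨C, hC0, hC⟩ := hbd (2 * t)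
    have hIoo : ∀ᶠ s in 𝓝[≠] t, s ∈ Ioo (t / 2) (2 * t) :=
      nhdsWithin_le_nhds (Ioo_mem_nhds (by linarith) (by linarith))
    have hMb : ∀ τ ∈ Icc (t / 2) (2 * t), τ ^ (α - 1) ≤ (t / 2) ^ (α - 1) := fun τ hτ =>
      Real.rpow_le_rpow_of_nonpos (by linarith) hτ.1 (by linarith)
    have key : Tendsto (fun s => ‖J (slope u t s - D t)‖) (𝓝[≠] t) (𝓝 0) := by
      refine tendsto_norm_zero_of_dominated
        (χ := fun s η => (s - t)⁻¹ • (φ s η - φ t η) - ψ t η)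
        (B := fun η => (2 * (C * (t / 2) ^ (α - 1))) * B η) ?_ (hB.const_mul _) ?_ ?_
      · filter_upwards [hIoo] with s hs
        have e : J (slope u t s - D t) = (s - t)⁻¹ • (J (u s) - J (u t)) - J (D t) := by
          rw [slope_def_module, map_sub, map_smul, map_sub]
        rw [e]
        filter_upwards [hu s (by linarith [hs.1]), hu t ht.le, hD t ht,
          Lp.coeFn_sub ((s - t)⁻¹ • (J (u s) - J (u t))) (J (D t)),
          Lp.coeFn_smul (s - t)⁻¹ (J (u s) - J (u t)), Lp.coeFn_sub (J (u s)) (J (u t))]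
          with η h1 h2 h3 h4 h5 h6
        rw [h4, Pi.sub_apply, h5, Pi.smul_apply, h6, Pi.sub_apply, h1, h2, h3]
      · filter_upwards [hIoo, self_mem_nhdsWithin] with s hs hne
        filter_upwards [hC] with η hη
        have hb : ∀ τ ∈ Icc (t / 2) (2 * t), ‖ψ τ η‖ ≤ C * (t / 2) ^ (α - 1) * B η := by
          intro τ hτ
          have h0 := hη τ ⟨by linarith [hτ.1], hτ.2⟩
          have hτ0 : 0 < τ ^ (α - 1) := Real.rpow_pos_of_pos (by linarith [hτ.1]) _
          -- The sign is forced by the bound on ψ; no sign of B is assumed.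
          have hCB : 0 ≤ C * B η := by
            by_contra! hneg
            have := mul_neg_of_neg_of_pos hneg hτ0
            linarith [norm_nonneg (ψ τ η)]
          calc ‖ψ τ η‖ ≤ C * B η * τ ^ (α - 1) := h0
            _ ≤ C * B η * (t / 2) ^ (α - 1) := mul_le_mul_of_nonneg_left (hMb τ hτ) hCB
            _ = _ := by ring
        have h1 := (convex_Icc (t / 2) (2 * t)).norm_image_sub_le_of_norm_hasDerivWithin_le
          (f := fun τ => φ τ η) (f' := fun τ => ψ τ η) (x := t) (y := s)
          (fun τ hτ => (hφd η τ (by linarith [hτ.1])).hasDerivWithinAt) hb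
          ⟨by linarith, by linarith⟩ ⟨hs.1.le, hs.2.le⟩
        have h2 := hb t ⟨by linarith, by linarith⟩
        have hst : 0 < ‖s - t‖ := norm_pos_iff.2 (sub_ne_zero.2 hne)
        calc ‖(s - t)⁻¹ • (φ s η - φ t η) - ψ t η‖
            ≤ ‖s - t‖⁻¹ * ‖φ s η - φ t η‖ + ‖ψ t η‖ := by
              refine (norm_sub_le _ _).trans ?_
              rw [norm_smul, norm_inv]
          _ ≤ ‖s - t‖⁻¹ * (C * (t / 2) ^ (α - 1) * B η * ‖s - t‖) +
              C * (t / 2) ^ (α - 1) * B η := by gcongr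
          _ = _ := by field_simp; ring
      · filter_upwards with η
        have h1 := (hasDerivAt_iff_tendsto_slope.1 (hφd η t ht)).sub_const (ψ t η)
        rw [sub_self] at h1
        refine h1.congr fun s => ?_
        rw [slope_def_module]
    simpa only [J.norm_map] using key
  have hDn : ∀ T, ∃ C, 0 ≤ C ∧ ∀ t ∈ Ioc 0 T, ‖D t‖ ≤ C * t ^ (α - 1) := by
    intro T
    obtain ⟨C, hC0, hC⟩ := hbd T
    refine ⟨C * nB, by positivity, fun t ht => ?_⟩
    have h0 : 0 ≤ t ^ (α - 1) := Real.rpow_nonneg ht.1.le _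
    have := norm_le_of_ae_le (hD t ht.1) hB (c := C * t ^ (α - 1)) (by positivity) (by
      filter_upwards [hC] with η hη
      refine (hη t ht).trans_eq (by ring))
    rw [J.norm_map] at this
    exact this.trans_eq (by ring)
  have hac : ∀ T, 0 < T → AbsolutelyContinuousOnInterval u 0 T := by
    intro T hT
    obtain ⟨C, hC0, hC⟩ := hbd T
    -- t^α is α times the integral of the integrable function τ^(α-1), hence absolutely continuous
    -- although its derivative is unbounded when α < 1.
    have hpow : AbsolutelyContinuousOnInterval (fun t : ℝ => t ^ α) 0 T := by
      have hii : IntervalIntegrable (fun τ : ℝ => τ ^ (α - 1)) volume 0 T :=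
        intervalIntegral.intervalIntegrable_rpow' (by linarith)
      refine absolutelyContinuousOnInterval_of_dist_le
        (hii.absolutelyContinuousOnInterval_intervalIntegral (c := 0) (by simp)) (C := α)
        fun x hx y hy => ?_
      have hI : ∀ z : ℝ, ∫ τ in (0 : ℝ)..z, τ ^ (α - 1) = z ^ α / α := fun z => by
        rw [integral_rpow (Or.inl (by linarith)), sub_add_cancel, Real.zero_rpow hα0.ne', sub_zero]
      rw [hI, hI, Real.dist_eq, Real.dist_eq, ← sub_div, abs_div, abs_of_pos hα0]
      exact le_of_eq (by field_simp)
    have hmain : ∀ s t, 0 ≤ s → s ≤ t → t ≤ T → ‖u t - u s‖ ≤ C / α * nB * (t ^ α - s ^ α) := by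
      intro s t hs hst htT
      have hle : 0 ≤ t ^ α - s ^ α := sub_nonneg.2 (Real.rpow_le_rpow hs hst hα0.le)
      have := norm_le_of_ae_le (X := J (u t) - J (u s)) (χ := fun η => φ t η - φ s η) (by
        filter_upwards [hu t (hs.trans hst), hu s hs, Lp.coeFn_sub (J (u t)) (J (u s))]
          with η h1 h2 h3
        rw [h3, Pi.sub_apply, h1, h2]) hB (c := C / α * (t ^ α - s ^ α)) (by positivity) (by
        filter_upwards [hC] with η hη
        refine (norm_sub_le_of_norm_deriv_le_rpow hα0 hs hst (hφc η) (hφd η) (hψη η)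
          fun τ hτ => hη τ ⟨hτ.1, hτ.2.trans htT⟩).trans_eq (by ring))
      rw [← map_sub, J.norm_map] at this
      exact this.trans_eq (by ring)
    refine absolutelyContinuousOnInterval_of_dist_le hpow (C := C / α * nB) fun x hx y hy => ?_
    rw [uIcc_of_le hT.le] at hx hy
    rcases le_total x y with h | h
    · rw [dist_comm, dist_eq_norm, dist_comm, Real.dist_eq,
        abs_of_nonneg (sub_nonneg.2 (Real.rpow_le_rpow hx.1 h hα0.le))]
      exact hmain x y hx.1 h hy.2
    · rw [dist_eq_norm, Real.dist_eq,
        abs_of_nonneg (sub_nonneg.2 (Real.rpow_le_rpow hy.1 h hα0.le))]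
      exact hmain y x hy.1 h hx.2
  have hdd : ∀ t, 0 < t → deriv u t = D t := fun t ht => (hderiv t ht).deriv
  have hii : ∀ t, 0 < t → α ≠ 1 →
      IntervalIntegrable (fun τ : ℝ => (t - τ) ^ (-α) • deriv u τ) volume 0 t := by
    intro t ht hne
    have hlt : α < 1 := lt_of_le_of_ne hα1 hne
    obtain ⟨C, hC0, hC⟩ := hDn t
    have hb := intervalIntegrable_sub_rpow_mul_rpow hα0 (b := 1 - α) (by linarith) ht
    rw [show 1 - α - 1 = -α by ring] at hb
    rw [intervalIntegrable_iff_integrableOn_Ioc_of_le ht.le] at hb ⊢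
    refine Integrable.mono' (hb.const_mul C) ?_ ?_
    · exact AEStronglyMeasurable.smul
        ((measurable_const.sub measurable_id).pow_const _).aestronglyMeasurable
        (stronglyMeasurable_deriv u).aestronglyMeasurable
    · filter_upwards [ae_restrict_mem measurableSet_Ioc] with τ hτ
      have h0 : 0 ≤ (t - τ) ^ (-α) := Real.rpow_nonneg (by linarith [hτ.2]) _
      rw [norm_smul, Real.norm_of_nonneg h0, hdd τ hτ.1]
      exact (mul_le_mul_of_nonneg_left (hC τ hτ) h0).trans_eq (by ring)
  refine ⟨⟨hac, ?_, fun t ht => ?_⟩, fun t ht => ?_⟩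
  · filter_upwards [ae_restrict_mem measurableSet_Ioi] with t ht
    exact (hderiv t ht).differentiableAt
  · split_ifs with h
    · exact (hderiv t ht).differentiableAt
    · exact hii t ht h
  · rw [caputo]
    split_ifs with h
    · rw [hdd t ht]
      apply J.injective
      apply Lp.ext
      filter_upwards [hD t ht, hc t ht] with η h1 h2
      have := hθ η t ht
      rw [if_pos h] at this
      rw [h1, h2, this]
    · have hlt : α < 1 := lt_of_le_of_ne hα1 h
      have hΓ' := Real.Gamma_pos_of_pos (by linarith : 0 < 1 - α)
      rw [inv_smul_eq_iff₀ hΓ'.ne']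
      apply J.injective
      rw [map_smul]
      refine ext_inner_left ℂ fun g => ?_
      -- The Bochner integral is identified weakly: pairing with g in L² gives a double integral
      -- over time and frequency, and Fubini's theorem moves the time integral inside, where the
      -- scalar identity for θ applies.
      set L : E →L[ℝ] ℂ := ((innerSL ℂ g).restrictScalars ℝ).comp J.toContinuousLinearMap with hL
      have e1 : inner ℂ g (J (∫ τ in (0 : ℝ)..t, (t - τ) ^ (-α) • deriv u τ)) =
          ∫ τ in (0 : ℝ)..t, L ((t - τ) ^ (-α) • deriv u τ) :=
        (L.intervalIntegral_comp_comm (hii t ht h)).symm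
      have e2 : ∀ τ ∈ Ioc 0 t, L ((t - τ) ^ (-α) • deriv u τ) =
          ∫ η, (((t - τ) ^ (-α) : ℝ) : ℂ) * ψ τ η * (starRingEnd ℂ) (g η) := by
        intro τ hτ
        rw [map_smul, hdd τ hτ.1]
        have : L (D τ) = inner ℂ g (J (D τ)) := rfl
        rw [this, L2.inner_def, ← integral_smul]
        apply integral_congr_ae
        filter_upwards [hD τ hτ.1] with η hη
        rw [hη, RCLike.inner_apply, Complex.real_smul]
        ring
      obtain ⟨C, hC0, hC⟩ := hbd t
      have hb := intervalIntegrable_sub_rpow_mul_rpow hα0 (b := 1 - α) (by linarith) ht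
      rw [show 1 - α - 1 = -α by ring, intervalIntegrable_iff_integrableOn_Ioc_of_le ht.le] at hb
      have hg : MemLp (fun η => g η) 2 volume := Lp.memLp g
      have hBg : Integrable (fun η => B η * ‖g η‖) volume := hB.integrable_mul hg.norm
      have hprod : Integrable (fun p : ℝ × EuclideanSpace ℝ (Fin d) =>
          (((t - p.1) ^ (-α) : ℝ) : ℂ) * ψ p.1 p.2 * (starRingEnd ℂ) (g p.2))
          ((volume.restrict (Ioc 0 t)).prod volume) := by
        refine Integrable.mono' ((hb.const_mul C).mul_prod hBg) ?_ ?_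
        · apply Measurable.aestronglyMeasurable
          refine ((Complex.measurable_ofReal.comp
            ((measurable_const.sub measurable_fst).pow_const _)).mul hψm).mul ?_
          exact (Complex.continuous_conj.measurable.comp
            ((Lp.stronglyMeasurable g).measurable.comp measurable_snd))
        · have hA : ∀ᵐ p ∂((volume.restrict (Ioc 0 t)).prod
              (volume : Measure (EuclideanSpace ℝ (Fin d)))), p.1 ∈ Ioc 0 t :=
            Measure.quasiMeasurePreserving_fst.ae (ae_restrict_mem measurableSet_Ioc)
          have hA' : ∀ᵐ p ∂((volume.restrict (Ioc 0 t)).prod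
              (volume : Measure (EuclideanSpace ℝ (Fin d)))),
              ∀ t' ∈ Ioc 0 t, ‖ψ t' p.2‖ ≤ C * B p.2 * t' ^ (α - 1) :=
            Measure.quasiMeasurePreserving_snd.ae hC
          filter_upwards [hA, hA'] with p h1 h2
          have h0 : 0 ≤ (t - p.1) ^ (-α) := Real.rpow_nonneg (by linarith [h1.2]) _
          rw [norm_mul, norm_mul, Complex.norm_real, Real.norm_of_nonneg h0, RCLike.norm_conj]
          calc _ ≤ (t - p.1) ^ (-α) * (C * B p.2 * p.1 ^ (α - 1)) * ‖g p.2‖ := by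
                gcongr; exact h2 p.1 h1
            _ = _ := by ring
      have e3 : inner ℂ g (Real.Gamma (1 - α) • J (c t)) =
          ∫ η, (Real.Gamma (1 - α) * θ t η) * (starRingEnd ℂ) (g η) := by
        rw [L2.inner_def]
        apply integral_congr_ae
        filter_upwards [hc t ht, Lp.coeFn_smul (Real.Gamma (1 - α)) (J (c t))] with η h1 h2
        rw [h2, Pi.smul_apply, h1, RCLike.inner_apply, Complex.real_smul]
      rw [e1, e3, intervalIntegral.integral_of_le ht.le,
        setIntegral_congr_fun measurableSet_Ioc e2, integral_integral_swap hprod]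
      apply integral_congr_ae
      filter_upwards with η
      have := hθ η t ht
      rw [if_neg h, intervalIntegral.integral_of_le ht.le] at this
      rw [integral_mul_const, this]

end Curves

/-! ### The multiplier operator on a subspace -/

section Operator

variable {d : ℕ}

/-- The radial symbol in the frequency variable of Mathlib's Fourier transform. -/
def symbol (m : ℝ → ℝ) (η : EuclideanSpace ℝ (Fin d)) : ℝ := m (2 * Real.pi * ‖η‖)

theorem measurable_symbol {m : ℝ → ℝ} (hm : Measurable m) :
    Measurable (symbol m : EuclideanSpace ℝ (Fin d) → ℝ) :=
  hm.comp (measurable_norm.const_mul _)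

theorem symbol_neg_inv_smul (m : ℝ → ℝ) (ξ : EuclideanSpace ℝ (Fin d)) :
    symbol m (-(2 * Real.pi)⁻¹ • ξ) = m ‖ξ‖ := by
  have := Real.pi_pos
  rw [symbol, norm_smul, norm_neg, norm_inv, Real.norm_of_nonneg (by positivity),
    mul_inv_cancel_left₀ (by positivity)]

theorem memLp_comp_smul {F : Type*} [NormedAddCommGroup F] {g : EuclideanSpace ℝ (Fin d) → F}
    {r : ℝ} (hr : r ≠ 0) (hg : MemLp g 2 volume) : MemLp (fun x => g (r • x)) 2 volume := by
  refine MemLp.comp_of_map (f := fun x => r • x) ?_ (measurable_const_smul r).aemeasurable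
  rw [Measure.map_addHaar_smul volume hr]
  exact hg.smul_measure ENNReal.ofReal_ne_top

theorem memLp_comp_smul_iff {F : Type*} [NormedAddCommGroup F]
    {g : EuclideanSpace ℝ (Fin d) → F} {r : ℝ} (hr : r ≠ 0) :
    MemLp (fun x => g (r • x)) 2 volume ↔ MemLp g 2 volume := by
  refine ⟨fun h => ?_, memLp_comp_smul hr⟩
  simpa [smul_smul, hr] using memLp_comp_smul (inv_ne_zero hr) h

theorem ae_of_ae_comp_smul {p : EuclideanSpace ℝ (Fin d) → Prop} {r : ℝ} (hr : r ≠ 0)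
    (h : ∀ᵐ x, p (r • x)) : ∀ᵐ x, p x := by
  have := (Measure.quasiMeasurePreserving_smul (volume : Measure (EuclideanSpace ℝ (Fin d)))
    (inv_ne_zero hr)).ae h
  simpa [smul_smul, hr] using this

/-- In polar coordinates Lebesgue measure is a product whose radial factor has a density, so a null
set of radii gives a null set of points. -/
theorem ae_norm_of_ae_Ioi (hd : 1 ≤ d) {p : ℝ → Prop}
    (h : ∀ᵐ r ∂volume.restrict (Ioi (0 : ℝ)), p r) :
    ∀ᵐ x : EuclideanSpace ℝ (Fin d), p ‖x‖ := by
  have : Nonempty (Fin d) := ⟨⟨0, hd⟩⟩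
  set V := EuclideanSpace ℝ (Fin d)
  have h1 : ∀ᵐ r : Ioi (0 : ℝ) ∂(Measure.comap Subtype.val volume), p r :=
    (ae_restrict_iff_subtype measurableSet_Ioi).1 h
  have h2 : ∀ᵐ r : Ioi (0 : ℝ) ∂(Measure.volumeIoiPow (Module.finrank ℝ V - 1)), p r :=
    (withDensity_absolutelyContinuous _ _).ae_le h1
  have h3 : ∀ᵐ q ∂((volume : Measure V).toSphere.prod
      (Measure.volumeIoiPow (Module.finrank ℝ V - 1))), p (q.2 : ℝ) :=
    Measure.quasiMeasurePreserving_snd.ae h2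
  have h4 : ∀ᵐ x : ({(0 : V)}ᶜ : Set V) ∂(Measure.comap Subtype.val volume),
      p ‖(x : V)‖ := by
    have := ((volume : Measure V).measurePreserving_homeomorphUnitSphereProd).quasiMeasurePreserving.ae h3
    simpa using this
  have h5 := (ae_restrict_iff_subtype (measurableSet_singleton (0 : V)).compl
    (p := fun x => p ‖x‖)).2 h4
  rwa [restrict_compl_singleton] at h5

theorem ae_symbol_pos (hd : 1 ≤ d) {m : ℝ → ℝ}
    (hpos : ∀ᵐ r ∂volume.restrict (Ioi (0 : ℝ)), 0 < m r) :
    ∀ᵐ η : EuclideanSpace ℝ (Fin d), 0 < symbol m η := by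
  have hr : -(2 * Real.pi)⁻¹ ≠ 0 := by have := Real.pi_pos; simp [this.ne']
  refine ae_of_ae_comp_smul hr ?_
  simpa only [symbol_neg_inv_smul] using ae_norm_of_ae_Ioi hd hpos

theorem exists_fourier_eq {g : EuclideanSpace ℝ (Fin d) → ℂ} (hg : MemLp g 2 volume) :
    ∃ h : L2 d, (𝓕 h : L2 d) =ᵐ[volume] g :=
  ⟨𝓕⁻ (hg.toLp g), by rw [FourierTransform.fourier_fourierInv_eq]; exact hg.coeFn_toLp⟩

theorem eq_of_fourier_ae_eq {f g : L2 d} (h : (𝓕 f : L2 d) =ᵐ[volume] (𝓕 g : L2 d)) : f = g :=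
  (Lp.fourierTransformₗᵢ (EuclideanSpace ℝ (Fin d)) ℂ).injective (Lp.ext h)

theorem fourier_add_ae (f g : L2 d) :
    (𝓕 (f + g) : L2 d) =ᵐ[volume] fun η => (𝓕 f : L2 d) η + (𝓕 g : L2 d) η := by
  rw [FourierTransform.fourier_add]; exact Lp.coeFn_add _ _

theorem fourier_sub_ae (f g : L2 d) :
    (𝓕 (f - g) : L2 d) =ᵐ[volume] fun η => (𝓕 f : L2 d) η - (𝓕 g : L2 d) η := by
  have : (𝓕 (f - g) : L2 d) = 𝓕 f - 𝓕 g :=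
    (Lp.fourierTransformₗᵢ (EuclideanSpace ℝ (Fin d)) ℂ).map_sub f g
  rw [this]; exact Lp.coeFn_sub _ _

theorem fourier_smul_ae (c : ℂ) (f : L2 d) :
    (𝓕 (c • f) : L2 d) =ᵐ[volume] fun η => c * (𝓕 f : L2 d) η := by
  rw [FourierTransform.fourier_smul]; exact Lp.coeFn_smul _ _

theorem inner_eq_integral_fourier (f g : L2 d) :
    inner ℂ f g = ∫ η, (starRingEnd ℂ) ((𝓕 f : L2 d) η) * (𝓕 g : L2 d) η := by
  rw [← Lp.inner_fourier_eq, L2.inner_def]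
  congr 1; ext η
  rw [RCLike.inner_apply, mul_comm]

variable {m : ℝ → ℝ} {H : Submodule ℂ (L2 d)} {A : H →ₗ.[ℂ] H}

theorem IsRadialFourierMultiplier.mem_domain_iff_symbol (hAm : IsRadialFourierMultiplier m H A)
    (f : H) : f ∈ A.domain ↔ MemLp (fun η => (symbol m η : ℂ) * (𝓕 (f : L2 d) : L2 d) η) 2 volume := by
  have hr : -(2 * Real.pi)⁻¹ ≠ 0 := by have := Real.pi_pos; simp [this.ne']
  rw [hAm.mem_domain_iff, ← memLp_comp_smul_iff
    (g := fun η => (symbol m η : ℂ) * (𝓕 (f : L2 d) : L2 d) η) hr]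
  simp only [symbol_neg_inv_smul]
  rfl

theorem IsRadialFourierMultiplier.fourier_apply_symbol (hAm : IsRadialFourierMultiplier m H A)
    (f : A.domain) : (𝓕 ((A f : H) : L2 d) : L2 d) =ᵐ[volume]
      fun η => (symbol m η : ℂ) * (𝓕 ((f : H) : L2 d) : L2 d) η := by
  have hr : -(2 * Real.pi)⁻¹ ≠ 0 := by have := Real.pi_pos; simp [this.ne']
  refine ae_of_ae_comp_smul hr ?_
  simp only [symbol_neg_inv_smul]
  exact hAm.fourier_apply f

/-! ### Resolvent and functional calculus inside the subspace -/

variable [CompleteSpace H]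

/-- Let P be the orthogonal projection of h onto the subspace. The relation f - h = m h on the
Fourier side and the equality of the inner products of P and h with elements of the subspace give ⟨f
- P, x⟩ = ⟨P, Ax⟩ for all x ∈ D(A). So P ∈ D(A*) = D(A) and AP = f - P, which determines the Fourier
transform of P and yields P = h. -/
theorem resolvent_mem (hA : IsSelfAdjoint A) (hAm : IsRadialFourierMultiplier m H A)
    (hpos : ∀ᵐ η : EuclideanSpace ℝ (Fin d), 0 < symbol m η) (f : H) {h : L2 d}
    (hh : (𝓕 h : L2 d) =ᵐ[volume]
      fun η => (((1 + symbol m η)⁻¹ : ℝ) : ℂ) * (𝓕 (f : L2 d) : L2 d) η) : h ∈ H := by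
  set P : H := H.orthogonalProjectionOnto h with hP
  have hinner : ∀ g : H, inner ℂ (P : L2 d) (g : L2 d) = inner ℂ h (g : L2 d) := by
    intro g
    have := H.inner_orthogonalProjectionOnto_eq_of_mem_right g h
    exact this
  have hf : ∀ᵐ η : EuclideanSpace ℝ (Fin d),
      (𝓕 (f : L2 d) : L2 d) η = (1 + symbol m η) * (𝓕 h : L2 d) η := by
    filter_upwards [hh, hpos] with η h1 h2
    have : (1 + symbol m η : ℂ) ≠ 0 := by
      have : (1 + symbol m η : ℝ) ≠ 0 := by positivity
      exact_mod_cast this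
    rw [h1]; push_cast
    field_simp
  have hadj : ∀ x : A.domain, inner ℂ (f - P) (x : H) = inner ℂ P (A x) := by
    intro x
    have e1 : inner ℂ P (A x) = inner ℂ h ((A x : H) : L2 d) := hinner (A x)
    have e2 : inner ℂ (f - P) (x : H) =
        inner ℂ (f : L2 d) ((x : H) : L2 d) - inner ℂ h ((x : H) : L2 d) := by
      rw [inner_sub_left, ← hinner]; rfl
    rw [e1, e2, ← inner_sub_left, inner_eq_integral_fourier, inner_eq_integral_fourier]
    apply integral_congr_ae
    filter_upwards [hf, hAm.fourier_apply_symbol x, fourier_sub_ae (f : L2 d) h] with η h1 h2 h3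
    rw [h2, h3, h1]
    simp only [map_sub, map_mul, map_add, map_one, Complex.conj_ofReal]
    ring
  have hA' : A.adjoint = A := hA
  have hdense := hA.dense_domain
  obtain ⟨hPd, hPA⟩ : ∃ hPd : P ∈ A.domain, A ⟨P, hPd⟩ = f - P := by
    rw [← hA']
    have hmem : P ∈ A.adjoint.domain := LinearPMap.mem_adjoint_domain_of_exists P ⟨f - P, hadj⟩
    exact ⟨hmem, LinearPMap.adjoint_apply_eq hdense ⟨P, hmem⟩ hadj⟩
  have hPh : (P : L2 d) = h := by
    apply eq_of_fourier_ae_eq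
    have h1 := hAm.fourier_apply_symbol ⟨P, hPd⟩
    rw [hPA] at h1
    filter_upwards [h1, fourier_sub_ae (f : L2 d) (P : L2 d), hf, hpos] with η h1 h2 h3 h4
    rw [Submodule.coe_sub, h2] at h1
    have h5 : (1 + symbol m η : ℂ) ≠ 0 := by
      have : (1 + symbol m η : ℝ) ≠ 0 := by positivity
      exact_mod_cast this
    apply mul_left_cancel₀ h5
    rw [← h3]
    linear_combination -h1
  rw [← hPh]
  exact P.2

theorem exists_resolvent_pow (hA : IsSelfAdjoint A) (hAm : IsRadialFourierMultiplier m H A)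
    (hm : Measurable m) (hpos : ∀ᵐ η : EuclideanSpace ℝ (Fin d), 0 < symbol m η) (f : H) (n : ℕ) :
    ∃ h : H, (𝓕 (h : L2 d) : L2 d) =ᵐ[volume]
      fun η => ((((1 + symbol m η)⁻¹ : ℝ) ^ n : ℝ) : ℂ) * (𝓕 (f : L2 d) : L2 d) η := by
  induction n with
  | zero => exact ⟨f, by simp⟩
  | succ n ih =>
    obtain ⟨h, hh⟩ := ih
    have hmem : MemLp (fun η => (((1 + symbol m η)⁻¹ : ℝ) : ℂ) * (𝓕 (h : L2 d) : L2 d) η) 2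
        volume := by
      refine (Lp.memLp (𝓕 (h : L2 d) : L2 d)).of_le ?_ ?_
      · exact (Complex.measurable_ofReal.comp
          (((measurable_symbol hm).const_add 1).inv)).aestronglyMeasurable.mul
          (Lp.aestronglyMeasurable _)
      · filter_upwards [hpos] with η hη
        rw [norm_mul, Complex.norm_real, norm_inv, Real.norm_of_nonneg (by positivity)]
        exact mul_le_of_le_one_left (norm_nonneg _) (inv_le_one_of_one_le₀ (by linarith))
    obtain ⟨h', hh'⟩ := exists_fourier_eq hmem
    refine ⟨⟨h', resolvent_mem hA hAm hpos h hh'⟩, ?_⟩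
    filter_upwards [hh, hh'] with η h1 h2
    rw [h2, h1]; push_cast; ring

theorem exists_resolvent_polynomial (hA : IsSelfAdjoint A)
    (hAm : IsRadialFourierMultiplier m H A) (hm : Measurable m)
    (hpos : ∀ᵐ η : EuclideanSpace ℝ (Fin d), 0 < symbol m η) (f : H) (p : Polynomial ℝ) :
    ∃ h : H, (𝓕 (h : L2 d) : L2 d) =ᵐ[volume]
      fun η => ((p.eval (1 + symbol m η)⁻¹ : ℝ) : ℂ) * (𝓕 (f : L2 d) : L2 d) η := by
  induction p using Polynomial.induction_on' with
  | add p q hp hq =>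
    obtain ⟨h₁, hh₁⟩ := hp
    obtain ⟨h₂, hh₂⟩ := hq
    refine ⟨h₁ + h₂, ?_⟩
    filter_upwards [hh₁, hh₂, fourier_add_ae (h₁ : L2 d) (h₂ : L2 d)] with η h1 h2 h3
    rw [Submodule.coe_add, h3, h1, h2, Polynomial.eval_add]; push_cast; ring
  | monomial n a =>
    obtain ⟨h, hh⟩ := exists_resolvent_pow hA hAm hm hpos f n
    refine ⟨(a : ℂ) • h, ?_⟩
    filter_upwards [hh, fourier_smul_ae (a : ℂ) (h : L2 d)] with η h1 h2
    rw [Submodule.coe_smul, h2, h1, Polynomial.eval_monomial]; push_cast; ring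

theorem memLp_bounded_mul {g : EuclideanSpace ℝ (Fin d) → ℂ} (hg : AEStronglyMeasurable g volume)
    {C : ℝ} (hC : ∀ᵐ η, ‖g η‖ ≤ C) {F : EuclideanSpace ℝ (Fin d) → ℂ} (hF : MemLp F 2 volume) :
    MemLp (fun η => g η * F η) 2 volume := by
  refine hF.of_le_mul (c := C) (hg.mul hF.1) ?_
  filter_upwards [hC] with η hη
  rw [norm_mul]
  gcongr

/-- The continuous functional calculus of the multiplier operator preserves the subspace. -/
theorem exists_functional_calculus (hA : IsSelfAdjoint A)
    (hAm : IsRadialFourierMultiplier m H A) (hm : Measurable m)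
    (hpos : ∀ᵐ η : EuclideanSpace ℝ (Fin d), 0 < symbol m η) {g : ℝ → ℂ} (hg : Continuous g)
    {C : ℝ} (hC : ∀ mu, 0 < mu → ‖g mu‖ ≤ C) (f : H) :
    ∃ h : H, (𝓕 (h : L2 d) : L2 d) =ᵐ[volume]
      fun η => g (symbol m η) * (𝓕 (f : L2 d) : L2 d) η := by
  -- The offset 2 keeps every δ n below 1, so the argument of g in G stays positive for x < 1 and
  -- the bound C applies.
  set δ : ℕ → ℝ := fun n => 1 / ((n : ℝ) + 2) with hδ
  have hδ0 : ∀ n, 0 < δ n := fun n => by positivity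
  have hδ1 : ∀ n, δ n < 1 := fun n => by
    rw [hδ, div_lt_one (by positivity)]; linarith [Nat.cast_nonneg (α := ℝ) n]
  have hδlim : Tendsto δ atTop (𝓝 0) := by
    have := (tendsto_const_div_atTop_nhds_zero_nat (1 : ℝ)).comp (tendsto_add_atTop_nat 2)
    refine this.congr fun n => ?_
    simp [hδ]
  -- In the variable x = 1/(1 + μ) ∈ (0, 1), g becomes g(1/x - 1), which may have no limit at x = 0.
  -- Freezing it below δ n gives a continuous function on [0, 1] to which Weierstrass' theorem
  -- applies; for fixed x it is unchanged once δ n < x.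
  set G : ℕ → ℝ → ℂ := fun n x => g ((max x (δ n))⁻¹ - 1) with hG
  have hGc : ∀ n, Continuous (G n) := fun n => hg.comp
    (((continuous_id.max continuous_const).inv₀ fun x =>
      ((hδ0 n).trans_le (le_max_right _ _)).ne').sub continuous_const)
  have hp : ∀ n, ∃ p : Polynomial ℝ, ∀ x ∈ Icc (0 : ℝ) 1, |p.eval x - (G n x).re| < δ n :=
    fun n => exists_polynomial_near_of_continuousOn 0 1 _
      (Complex.continuous_re.comp (hGc n)).continuousOn _ (hδ0 n)
  have hq : ∀ n, ∃ p : Polynomial ℝ, ∀ x ∈ Icc (0 : ℝ) 1, |p.eval x - (G n x).im| < δ n :=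
    fun n => exists_polynomial_near_of_continuousOn 0 1 _
      (Complex.continuous_im.comp (hGc n)).continuousOn _ (hδ0 n)
  choose p hp using hp
  choose q hq using hq
  set F : L2 d := 𝓕 (f : L2 d) with hF
  set x : EuclideanSpace ℝ (Fin d) → ℝ := fun η => (1 + symbol m η)⁻¹ with hx
  set Q : ℕ → EuclideanSpace ℝ (Fin d) → ℂ := fun n η =>
    (((p n).eval (x η) : ℝ) : ℂ) + Complex.I * (((q n).eval (x η) : ℝ) : ℂ) with hQ
  have hQG : ∀ n η, x η ∈ Icc (0 : ℝ) 1 → ‖Q n η - G n (x η)‖ ≤ 2 * δ n := by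
    intro n η hη
    refine (Complex.norm_le_abs_re_add_abs_im _).trans ?_
    have h1 := hp n _ hη
    have h2 := hq n _ hη
    simp only [hQ, Complex.sub_re, Complex.add_re, Complex.mul_re, Complex.I_re, Complex.I_im,
      Complex.ofReal_re, Complex.ofReal_im, Complex.sub_im, Complex.add_im, Complex.mul_im]
    simp only [zero_mul, mul_zero, sub_zero, one_mul, add_zero, zero_add]
    linarith
  have hh : ∀ n, ∃ h : H, (𝓕 (h : L2 d) : L2 d) =ᵐ[volume] fun η => Q n η * F η := by
    intro n
    obtain ⟨h₁, hh₁⟩ := exists_resolvent_polynomial hA hAm hm hpos f (p n)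
    obtain ⟨h₂, hh₂⟩ := exists_resolvent_polynomial hA hAm hm hpos f (q n)
    refine ⟨h₁ + Complex.I • h₂, ?_⟩
    filter_upwards [hh₁, hh₂, fourier_add_ae (h₁ : L2 d) (Complex.I • (h₂ : L2 d)),
      fourier_smul_ae Complex.I (h₂ : L2 d)] with η h1 h2 h3 h4
    rw [Submodule.coe_add, Submodule.coe_smul, h3, h4, h1, h2]
    ring
  choose h hh using hh
  have hmem : MemLp (fun η => g (symbol m η) * F η) 2 volume :=
    memLp_bounded_mul (hg.measurable.comp (measurable_symbol hm)).aestronglyMeasurable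
      (by filter_upwards [hpos] with η hη using hC _ hη) (Lp.memLp F)
  obtain ⟨k, hk⟩ := exists_fourier_eq hmem
  have hlim : Tendsto (fun n => (h n : L2 d)) atTop (𝓝 k) := by
    rw [tendsto_iff_norm_sub_tendsto_zero]
    have := tendsto_norm_zero_of_dominated (l := atTop)
      (X := fun n => (𝓕 ((h n : L2 d) - k) : L2 d))
      (χ := fun n η => (Q n η - g (symbol m η)) * F η)
      (B := fun η => (2 + C + C) * ‖F η‖) (Eventually.of_forall fun n => ?_)
      ((Lp.memLp F).norm.const_mul _) (Eventually.of_forall fun n => ?_) ?_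
    · simpa only [Lp.norm_fourier_eq] using this
    · filter_upwards [hh n, hk, fourier_sub_ae (h n : L2 d) k] with η h1 h2 h3
      rw [h3, h1, h2]; ring
    · filter_upwards [hpos] with η hη
      have hxη : x η ∈ Ioo (0 : ℝ) 1 := ⟨by positivity, inv_lt_one_of_one_lt₀ (by linarith)⟩
      have h1 := hQG n η ⟨hxη.1.le, hxη.2.le⟩
      have h2 : ‖G n (x η)‖ ≤ C := by
        apply hC
        have h3 : max (x η) (δ n) < 1 := max_lt hxη.2 (hδ1 n)
        have h4 : 0 < max (x η) (δ n) := hxη.1.trans_le (le_max_left _ _)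
        linarith [(one_lt_inv₀ h4).2 h3]
      have h3 := hC _ hη
      rw [norm_mul]
      gcongr
      calc ‖Q n η - g (symbol m η)‖
          = ‖(Q n η - G n (x η)) + G n (x η) - g (symbol m η)‖ := by ring_nf
        _ ≤ ‖Q n η - G n (x η)‖ + ‖G n (x η)‖ + ‖g (symbol m η)‖ :=
            (norm_sub_le _ _).trans (by gcongr; exact norm_add_le _ _)
        _ ≤ 2 * δ n + C + C := by gcongr
        _ ≤ 2 + C + C := by linarith [hδ1 n]
    · filter_upwards [hpos] with η hη
      have hxη : x η ∈ Ioo (0 : ℝ) 1 := ⟨by positivity, inv_lt_one_of_one_lt₀ (by linarith)⟩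
      have h1 : Tendsto (fun n => Q n η - g (symbol m η)) atTop (𝓝 0) := by
        have h2 : Tendsto (fun n => 2 * δ n) atTop (𝓝 0) := by simpa using hδlim.const_mul 2
        refine squeeze_zero_norm' ?_ h2
        filter_upwards [hδlim.eventually (gt_mem_nhds hxη.1)] with n hn
        have h3 : G n (x η) = g (symbol m η) := by
          simp only [hG]
          rw [max_eq_left hn.le, hx]
          simp
        rw [← h3]
        exact hQG n η ⟨hxη.1.le, hxη.2.le⟩
      simpa using h1.mul_const (F η)
  have hclosed : IsClosed (H : Set (L2 d)) :=
    (completeSpace_coe_iff_isComplete.1 ‹CompleteSpace H›).isClosed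
  exact ⟨⟨k, hclosed.mem_of_tendsto hlim (Eventually.of_forall fun n => (h n).2)⟩, hk⟩

end Operator

/-! ### Uniqueness for the Cauchy problem -/

section CauchyProblem

variable {d : ℕ}

/-- The restriction of an `L²` function to a measurable set, as an operator. -/
def cutoff {S : Set (EuclideanSpace ℝ (Fin d))} (hS : MeasurableSet S) : L2 d →L[ℂ] L2 d :=
  (ContinuousLinearMap.mul ℂ ℂ).holderL volume ⊤ 2 2
    ((memLp_top_const (1 : ℂ)).indicator hS).toLp

theorem coeFn_cutoff {S : Set (EuclideanSpace ℝ (Fin d))} (hS : MeasurableSet S) (f : L2 d) :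
    cutoff hS f =ᵐ[volume] S.indicator f := by
  have h1 := (ContinuousLinearMap.mul ℂ ℂ).coeFn_holder (r := 2)
    (((memLp_top_const (μ := volume) (1 : ℂ)).indicator hS).toLp) f
  have h2 := ((memLp_top_const (μ := volume) (1 : ℂ)).indicator hS).coeFn_toLp
  refine EventuallyEq.trans h1 ?_
  filter_upwards [h2] with x hx
  rw [hx, ContinuousLinearMap.mul_apply']
  by_cases h : x ∈ S <;> simp [h]

theorem inner_cutoff_left {S : Set (EuclideanSpace ℝ (Fin d))} (hS : MeasurableSet S)
    (f g : L2 d) : inner ℂ (cutoff hS f) g = inner ℂ f (cutoff hS g) := by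
  rw [L2.inner_def, L2.inner_def]
  apply integral_congr_ae
  filter_upwards [coeFn_cutoff hS f, coeFn_cutoff hS g] with x h1 h2
  rw [h1, h2]
  by_cases h : x ∈ S <;> simp [h]

theorem cutoff_cutoff {S : Set (EuclideanSpace ℝ (Fin d))} (hS : MeasurableSet S) (f : L2 d) :
    cutoff hS (cutoff hS f) = cutoff hS f := by
  apply Lp.ext
  filter_upwards [coeFn_cutoff hS f, coeFn_cutoff hS (cutoff hS f)] with x h1 h2
  rw [h2, h1]
  by_cases h : x ∈ S <;> simp [h, h1]

variable {m : ℝ → ℝ} {H : Submodule ℂ (L2 d)} {A : H →ₗ.[ℂ] H}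

/-- The Fourier transform on a closed subspace, as a real linear isometry. -/
def fourierSubspace (H : Submodule ℂ (L2 d)) : H →ₗᵢ[ℝ] L2 d where
  toLinearMap := ((Lp.fourierTransformₗᵢ (EuclideanSpace ℝ (Fin d)) ℂ).toLinearIsometry.comp
    H.subtypeₗᵢ).toLinearMap.restrictScalars ℝ
  norm_map' f := ((Lp.fourierTransformₗᵢ (EuclideanSpace ℝ (Fin d)) ℂ).toLinearIsometry.comp
    H.subtypeₗᵢ).norm_map f

theorem fourierSubspace_apply (f : H) : fourierSubspace H f = 𝓕 (f : L2 d) := rfl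

theorem re_inner_cutoff_self {S : Set (EuclideanSpace ℝ (Fin d))} (hS : MeasurableSet S)
    (x : L2 d) : (inner ℂ (cutoff hS x) x).re = ‖cutoff hS x‖ ^ 2 := by
  rw [← cutoff_cutoff hS x, inner_cutoff_left, cutoff_cutoff, ← RCLike.re_eq_complex_re,
    inner_self_eq_norm_sq]

theorem abs_re_inner_cutoff_le {S : Set (EuclideanSpace ℝ (Fin d))} (hS : MeasurableSet S)
    (x y : L2 d) : |(inner ℂ (cutoff hS x) y).re| ≤ ‖cutoff hS x‖ * ‖cutoff hS y‖ := by
  rw [← cutoff_cutoff hS x, inner_cutoff_left, cutoff_cutoff]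
  exact (Complex.abs_re_le_norm _).trans (norm_inner_le_norm _ _)

/-! ### Gronwall estimates on frequency bands and uniqueness -/

variable [CompleteSpace H]

/-- The identity `integral_caputo` is tested against the cut-off difference x at the fixed time t
itself. This yields Γ(α)‖x‖² ≤ ‖x‖ ∫ (t-s)^(α-1) G(s) ds, and one factor cancels. Only a bound on
the Caputo derivative along this one direction is needed. -/
theorem norm_cutoff_le_integral {α : ℝ} (hα0 : 0 < α) (hα1 : α ≤ 1)
    {S : Set (EuclideanSpace ℝ (Fin d))} (hS : MeasurableSet S) {g₁ g₂ : ℝ → H} {G : ℝ → ℝ}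
    (hg₁ : CaputoDifferentiable α g₁) (hg₂ : CaputoDifferentiable α g₂) (h0 : g₁ 0 = g₂ 0)
    {T : ℝ} (hG : ContinuousOn G (Icc 0 T))
    (hle : ∀ s ∈ Ioc 0 T, ∀ x : L2 d, (inner ℂ (cutoff hS x)
      (fourierSubspace H (caputo α g₁ s) - fourierSubspace H (caputo α g₂ s))).re ≤
        ‖cutoff hS x‖ * G s)
    (hG0 : ∀ s ∈ Ioc 0 T, 0 ≤ G s) {t : ℝ} (ht : t ∈ Ioc 0 T) :
    Real.Gamma α * ‖cutoff hS (fourierSubspace H (g₁ t) - fourierSubspace H (g₂ t))‖ ≤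
      ∫ s in (0 : ℝ)..t, (t - s) ^ (α - 1) * G s := by
  set x := fourierSubspace H (g₁ t) - fourierSubspace H (g₂ t) with hx
  obtain ⟨ℓ, hℓ⟩ : ∃ ℓ : H →L[ℝ] ℝ,
      ∀ g, ℓ g = (inner ℂ (cutoff hS x) (fourierSubspace H g)).re :=
    ⟨(Complex.reCLM.comp ((innerSL ℂ (cutoff hS x)).restrictScalars ℝ)).comp
      (fourierSubspace H).toContinuousLinearMap, fun _ => rfl⟩
  obtain ⟨hi₁, hI₁⟩ := hg₁.integral_caputo hα0 hα1 ℓ ht.1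
  obtain ⟨hi₂, hI₂⟩ := hg₂.integral_caputo hα0 hα1 ℓ ht.1
  have hker : IntervalIntegrable (fun s : ℝ => (t - s) ^ (α - 1)) volume 0 t := by
    simpa using intervalIntegrable_sub_rpow_mul_rpow one_pos hα0 ht.1
  have hkG : IntervalIntegrable (fun s : ℝ => (t - s) ^ (α - 1) * G s) volume 0 t :=
    hker.mul_continuousOn (hG.mono (by
      rw [uIcc_of_le ht.1.le]; exact Icc_subset_Icc_right ht.2))
  have e : Real.Gamma α * ‖cutoff hS x‖ ^ 2 =
      ∫ s in (0 : ℝ)..t, ((t - s) ^ (α - 1) * ℓ (caputo α g₁ s) -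
        (t - s) ^ (α - 1) * ℓ (caputo α g₂ s)) := by
    rw [intervalIntegral.integral_sub hi₁ hi₂, hI₁, hI₂, h0, ← re_inner_cutoff_self]
    have : (inner ℂ (cutoff hS x) x).re = ℓ (g₁ t) - ℓ (g₂ t) := by
      rw [hℓ, hℓ, ← Complex.sub_re, ← inner_sub_right]
    rw [this]; ring
  have h1 : Real.Gamma α * ‖cutoff hS x‖ ^ 2 ≤
      ‖cutoff hS x‖ * ∫ s in (0 : ℝ)..t, (t - s) ^ (α - 1) * G s := by
    rw [e, ← intervalIntegral.integral_const_mul, intervalIntegral.integral_of_le ht.1.le,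
      intervalIntegral.integral_of_le ht.1.le]
    apply setIntegral_mono_on _ _ measurableSet_Ioc
    · intro s hs
      have h2 := hle s ⟨hs.1, hs.2.trans ht.2⟩ x
      rw [inner_sub_right, Complex.sub_re] at h2
      rw [hℓ, hℓ, ← mul_sub, mul_left_comm]
      exact mul_le_mul_of_nonneg_left h2 (Real.rpow_nonneg (by linarith [hs.2]) _)
    · exact (intervalIntegrable_iff_integrableOn_Ioc_of_le ht.1.le).1 (hi₁.sub hi₂)
    · exact (intervalIntegrable_iff_integrableOn_Ioc_of_le ht.1.le).1 (hkG.const_mul _)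
  rcases (norm_nonneg (cutoff hS x)).eq_or_lt with h | h
  · rw [← h, mul_zero]
    apply intervalIntegral.integral_nonneg_of_ae_restrict ht.1.le
    filter_upwards [ae_restrict_mem measurableSet_Icc, ae_restrict_of_ae
      (by simp [ae_iff] : ∀ᵐ s : ℝ, s ≠ 0)] with s hs hs0
    exact mul_nonneg (Real.rpow_nonneg (by linarith [hs.2]) _)
      (hG0 s ⟨lt_of_le_of_ne hs.1 hs0.symm, hs.2.trans ht.2⟩)
  · nlinarith

/-- A coupled pair of fractional integral inequalities has only the zero solution. -/
theorem eq_zero_of_pair_le_integral_rpow {α T c₁ c₂ : ℝ} (hα : 0 < α) (hc₁ : 0 ≤ c₁)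
    (hc₂ : 0 ≤ c₂) {X Y : ℝ → ℝ} (hX : ContinuousOn X (Icc 0 T)) (hY : ContinuousOn Y (Icc 0 T))
    (hX0 : ∀ t, 0 ≤ X t) (hY0 : ∀ t, 0 ≤ Y t)
    (hXle : ∀ t ∈ Ioc 0 T, Real.Gamma α * X t ≤ ∫ s in (0 : ℝ)..t, (t - s) ^ (α - 1) * Y s)
    (hYle : ∀ t ∈ Ioc 0 T, Real.Gamma α * Y t ≤
      ∫ s in (0 : ℝ)..t, (t - s) ^ (α - 1) * (c₁ * Y s + c₂ * X s)) :
    ∀ t ∈ Ioc 0 T, X t = 0 := by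
  have hΓ := Real.Gamma_pos_of_pos hα
  have h := eq_zero_of_le_integral_rpow (T := T) hα
    (C := (Real.Gamma α)⁻¹ * (1 + c₁ + c₂)) (by positivity)
    (x := fun t => X t + Y t) (hX.add hY) (fun t _ => add_nonneg (hX0 t) (hY0 t))
    (fun t ht => by
      have h1 := hXle t ht
      have h2 := hYle t ht
      have hker : IntervalIntegrable (fun s : ℝ => (t - s) ^ (α - 1)) volume 0 t := by
        simpa using intervalIntegrable_sub_rpow_mul_rpow one_pos hα ht.1
      have hmono : uIcc 0 t ⊆ Icc 0 T := by
        rw [uIcc_of_le ht.1.le]; exact Icc_subset_Icc_right ht.2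
      have hi1 : IntervalIntegrable (fun s : ℝ => (t - s) ^ (α - 1) * Y s) volume 0 t :=
        hker.mul_continuousOn (hY.mono hmono)
      have hi2 : IntervalIntegrable (fun s : ℝ => (t - s) ^ (α - 1) *
          (c₁ * Y s + c₂ * X s)) volume 0 t :=
        hker.mul_continuousOn (((hY.const_smul c₁).add (hX.const_smul c₂)).mono hmono)
      have hi3 : IntervalIntegrable (fun s : ℝ => (t - s) ^ (α - 1) *
          (X s + Y s)) volume 0 t :=
        hker.mul_continuousOn ((hX.add hY).mono hmono)
      rw [mul_assoc, ← div_eq_inv_mul, le_div_iff₀ hΓ, ← intervalIntegral.integral_const_mul]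
      calc (X t + Y t) * Real.Gamma α
          ≤ (∫ s in (0 : ℝ)..t, (t - s) ^ (α - 1) * Y s) +
            ∫ s in (0 : ℝ)..t, (t - s) ^ (α - 1) * (c₁ * Y s + c₂ * X s) := by linarith
        _ = ∫ s in (0 : ℝ)..t, ((t - s) ^ (α - 1) * Y s + (t - s) ^ (α - 1) *
              (c₁ * Y s + c₂ * X s)) :=
            (intervalIntegral.integral_add hi1 hi2).symm
        _ ≤ _ := by
            apply intervalIntegral.integral_mono_on ht.1.le (hi1.add hi2) (hi3.const_mul _)
            intro s hs
            have h0 : 0 ≤ (t - s) ^ (α - 1) := Real.rpow_nonneg (by linarith [hs.2]) _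
            rw [← mul_add, mul_left_comm]
            apply mul_le_mul_of_nonneg_left _ h0
            have := mul_nonneg hc₁ (hX0 s)
            have := mul_nonneg hc₂ (hY0 s)
            nlinarith [hX0 s, hY0 s])
  intro t ht
  exact le_antisymm (by linarith [h t ht, hY0 t]) (hX0 t)

omit [CompleteSpace H] in
theorem norm_cutoff_multiplier_le (hAm : IsRadialFourierMultiplier m H A) (N : ℝ)
    (hS : MeasurableSet {η : EuclideanSpace ℝ (Fin d) | |symbol m η| ≤ N}) (x y : A.domain) :
    ‖cutoff hS (fourierSubspace H (A x) - fourierSubspace H (A y))‖ ≤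
      N * ‖cutoff hS (fourierSubspace H (x : H) - fourierSubspace H (y : H))‖ := by
  apply Lp.norm_le_mul_norm_of_ae_le_mul
  filter_upwards [coeFn_cutoff hS (fourierSubspace H (A x) - fourierSubspace H (A y)),
    coeFn_cutoff hS (fourierSubspace H (x : H) - fourierSubspace H (y : H)),
    Lp.coeFn_sub (fourierSubspace H (A x)) (fourierSubspace H (A y)),
    Lp.coeFn_sub (fourierSubspace H (x : H)) (fourierSubspace H (y : H)),
    hAm.fourier_apply_symbol x, hAm.fourier_apply_symbol y] with η h1 h2 h3 h4 h5 h6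
  rw [h1, h2]
  by_cases hη : η ∈ {η : EuclideanSpace ℝ (Fin d) | |symbol m η| ≤ N}
  · rw [indicator_of_mem hη, indicator_of_mem hη, h3, h4, Pi.sub_apply, Pi.sub_apply]
    simp only [fourierSubspace_apply]
    rw [h5, h6, ← mul_sub, norm_mul, Complex.norm_real]
    gcongr
    exact hη
  · rw [indicator_of_notMem hη, indicator_of_notMem hη]; simp

/-- On the band |m| ≤ N the operator acts with norm at most N, so the norms of the cut-off
differences of u and of D^α u satisfy a coupled pair of Abel inequalities. The cut-off is taken on
the Fourier side in all of L², so it need not preserve the subspace. -/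
theorem IsSolution.cutoff_eq_zero {α lam : ℝ} (hα0 : 0 < α) (hα1 : α ≤ 1) (hlam : 0 < lam)
    (hAm : IsRadialFourierMultiplier m H A) {f : H} {u v : ℝ → H}
    (hu : IsSolution A α lam f u) (hv : IsSolution A α lam f v) {T N : ℝ} (hT : 0 < T)
    (hN : 0 ≤ N) (hS : MeasurableSet {η : EuclideanSpace ℝ (Fin d) | |symbol m η| ≤ N}) :
    cutoff hS (fourierSubspace H (u T) - fourierSubspace H (v T)) = 0 := by
  obtain ⟨w₁, hw₁, hw₁0, hw₁c, heq₁⟩ := hu.equation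
  obtain ⟨w₂, hw₂, hw₂0, hw₂c, heq₂⟩ := hv.equation
  have hcont : ∀ {g₁ g₂ : ℝ → H}, CaputoDifferentiable α g₁ → CaputoDifferentiable α g₂ →
      ContinuousOn (fun t => ‖cutoff hS (fourierSubspace H (g₁ t) - fourierSubspace H (g₂ t))‖)
        (Icc 0 T) := fun hg₁ hg₂ => by
    have h1 := (hg₁.absCont T hT).continuousOn
    have h2 := (hg₂.absCont T hT).continuousOn
    rw [uIcc_of_le hT.le] at h1 h2
    exact ((cutoff hS).continuous.comp_continuousOn
      (((fourierSubspace H).continuous.comp_continuousOn h1).sub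
        ((fourierSubspace H).continuous.comp_continuousOn h2))).norm
  have hzc := hcont hu.caputoDifferentiable hv.caputoDifferentiable
  have hωc := hcont hw₁c hw₂c
  refine norm_eq_zero.1 (eq_zero_of_pair_le_integral_rpow hα0 (c₁ := 2 * lam) (c₂ := N)
    (by positivity) hN hzc hωc (fun _ => norm_nonneg _) (fun _ => norm_nonneg _) (fun t ht => ?_)
    (fun t ht => ?_) T ⟨hT, le_rfl⟩)
  · refine norm_cutoff_le_integral hα0 hα1 hS hu.caputoDifferentiable hv.caputoDifferentiable
      (hu.initial.trans hv.initial.symm) hωc (fun s hs x => ?_) (fun _ _ => norm_nonneg _) ht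
    rw [← hw₁ s hs.1, ← hw₂ s hs.1]
    exact (le_abs_self _).trans (abs_re_inner_cutoff_le hS _ _)
  · refine norm_cutoff_le_integral hα0 hα1 hS hw₁c hw₂c (hw₁0.trans hw₂0.symm)
      (G := fun s => 2 * lam *
          ‖cutoff hS (fourierSubspace H (w₁ s) - fourierSubspace H (w₂ s))‖ +
        N * ‖cutoff hS (fourierSubspace H (u s) - fourierSubspace H (v s))‖)
      ((hωc.const_smul (2 * lam)).add (hzc.const_smul N)) (fun s hs x => ?_)
      (fun s _ => by positivity) ht
    have h3 := norm_cutoff_multiplier_le hAm N hS ⟨u s, hu.mem_domain s hs.1⟩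
      ⟨v s, hv.mem_domain s hs.1⟩
    have heq₁ := heq₁ s hs.1
    have heq₂ := heq₂ s hs.1
    generalize A ⟨u s, hu.mem_domain s hs.1⟩ = a₁ at *
    generalize A ⟨v s, hv.mem_domain s hs.1⟩ = a₂ at *
    have e₁ : caputo α w₁ s = -((2 * lam) • w₁ s) - a₁ := by
      rw [← sub_eq_zero, ← heq₁]; abel
    have e₂ : caputo α w₂ s = -((2 * lam) • w₂ s) - a₂ := by
      rw [← sub_eq_zero, ← heq₂]; abel
    have e₃ : fourierSubspace H (caputo α w₁ s) - fourierSubspace H (caputo α w₂ s) =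
        -((2 * lam) • (fourierSubspace H (w₁ s) - fourierSubspace H (w₂ s))) -
          (fourierSubspace H a₁ - fourierSubspace H a₂) := by
      rw [e₁, e₂]
      simp only [map_sub, map_neg, map_smul, smul_sub]
      abel
    have h1 := abs_re_inner_cutoff_le hS x (fourierSubspace H (w₁ s) - fourierSubspace H (w₂ s))
    have h2 := abs_re_inner_cutoff_le hS x (fourierSubspace H a₁ - fourierSubspace H a₂)
    rw [e₃, inner_sub_right, inner_neg_right, RCLike.real_smul_eq_coe_smul (K := ℂ),
      inner_smul_right, Complex.sub_re, Complex.neg_re, RCLike.ofReal_eq_complex_ofReal,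
      Complex.re_ofReal_mul]
    have h4 := mul_le_mul_of_nonneg_left h3 (norm_nonneg (cutoff hS x))
    have h5 := neg_abs_le (inner ℂ (cutoff hS x)
      (fourierSubspace H (w₁ s) - fourierSubspace H (w₂ s))).re
    have h6 := neg_abs_le (inner ℂ (cutoff hS x) (fourierSubspace H a₁ - fourierSubspace H a₂)).re
    have h7 := mul_le_mul_of_nonneg_left (neg_le_of_neg_le ((neg_le_neg h1).trans h5))
      (by positivity : 0 ≤ 2 * lam)
    simp only at h4
    linarith

theorem IsSolution.unique {α lam : ℝ} (hα0 : 0 < α) (hα1 : α ≤ 1) (hlam : 0 < lam)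
    (hm : Measurable m) (hAm : IsRadialFourierMultiplier m H A) {f : H} {u v : ℝ → H}
    (hu : IsSolution A α lam f u) (hv : IsSolution A α lam f v) :
    ∀ t, 0 ≤ t → v t = u t := by
  intro T hT
  rcases hT.eq_or_lt with rfl | hT
  · rw [hu.initial, hv.initial]
  have hz : fourierSubspace H (u T) - fourierSubspace H (v T) = 0 := by
    apply Lp.ext
    have hS : ∀ N : ℕ, MeasurableSet {η : EuclideanSpace ℝ (Fin d) | |symbol m η| ≤ N} := fun N =>
      measurableSet_le (measurable_symbol hm).norm measurable_const
    -- Countably many bands exhaust the frequencies because m is finite everywhere.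
    have hall : ∀ᵐ η : EuclideanSpace ℝ (Fin d), ∀ N : ℕ,
        ({η : EuclideanSpace ℝ (Fin d) | |symbol m η| ≤ N}).indicator
          (fourierSubspace H (u T) - fourierSubspace H (v T) : L2 d) η = 0 := by
      rw [ae_all_iff]
      intro N
      have h1 := coeFn_cutoff (hS N) (fourierSubspace H (u T) - fourierSubspace H (v T))
      rw [hu.cutoff_eq_zero hα0 hα1 hlam hAm hv hT N.cast_nonneg (hS N)] at h1
      filter_upwards [h1, Lp.coeFn_zero ℂ 2 volume] with η h2 h3
      rw [← h2, h3]; rfl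
    filter_upwards [hall, Lp.coeFn_zero ℂ 2 volume] with η h1 h2
    obtain ⟨N, hN⟩ := exists_nat_ge |symbol m η|
    rw [h2, Pi.zero_apply, ← h1 N, indicator_of_mem]
    · exact hN
  exact ((fourierSubspace H).injective (sub_eq_zero.1 hz)).symm

/-! ### Existence for the Cauchy problem -/

theorem continuous_scalarSolDeriv {α lam t : ℝ} (hα : 0 < α) :
    Continuous fun mu => scalarSolDeriv α lam t mu :=
  continuous_const.mul (continuous_iff_continuousAt.2 fun mu =>
    ContinuousAt.comp (f := fun mu : ℝ => (t, mu))
      (continuousAt_gammaSeries_telegraphCoeff hα hα 0 (t, mu)) (by fun_prop))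

theorem continuous_scalarVelDeriv {α lam t : ℝ} (hα : 0 < α) :
    Continuous fun mu => scalarVelDeriv α lam t mu :=
  continuous_const.mul (continuous_iff_continuousAt.2 fun mu =>
    ContinuousAt.comp (f := fun mu : ℝ => (t, mu))
      (continuousAt_gammaSeries_telegraphCoeff hα hα 1 (t, mu)) (by fun_prop))

/-- Existence for the Cauchy problem, with the Fourier transform of the solution. -/
theorem exists_isSolution {α lam : ℝ} (hα0 : 0 < α) (hα1 : α ≤ 1) (hlam : 0 < lam)
    (hm : Measurable m) (hA : IsSelfAdjoint A) (hAm : IsRadialFourierMultiplier m H A)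
    (hpos : ∀ᵐ η : EuclideanSpace ℝ (Fin d), 0 < symbol m η) {f : H} (hf : f ∈ A.domain) :
    ∃ u : ℝ → H, IsSolution A α lam f u ∧ ∀ t, 0 ≤ t → (𝓕 (u t : L2 d) : L2 d) =ᵐ[volume]
      fun η => scalarSol α lam t (symbol m η) * (𝓕 (f : L2 d) : L2 d) η := by
  set Af : H := A ⟨f, hf⟩ with hAf
  set F : EuclideanSpace ℝ (Fin d) → ℂ := fun η => (𝓕 (f : L2 d) : L2 d) η with hF
  set M : EuclideanSpace ℝ (Fin d) → ℝ := symbol m with hM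
  have hMm : Measurable M := measurable_symbol hm
  have hFm : Measurable F := (Lp.stronglyMeasurable _).measurable
  have hAfF : (𝓕 (Af : L2 d) : L2 d) =ᵐ[volume] fun η => (M η : ℂ) * F η :=
    hAm.fourier_apply_symbol ⟨f, hf⟩
  have hMF : MemLp (fun η => (M η : ℂ) * F η) 2 volume := (hAm.mem_domain_iff_symbol f).1 hf
  -- The dominating function for all time derivatives. Their factor μ is attached to the datum,
  -- where f ∈ D(A) makes it square integrable, so the velocity terms below are bounded functions of
  -- A applied to `Af`, not unbounded ones applied to `f`.
  have hB : MemLp (fun η => ‖(M η : ℂ) * F η‖) 2 volume := hMF.norm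
  have hcalc : ∀ (g : ℝ → ℝ → ℂ) (k : H), (∀ t, 0 ≤ t → Continuous (g t)) →
      (∀ t, 0 ≤ t → ∃ C, ∀ mu, 0 < mu → ‖g t mu‖ ≤ C) →
      ∃ h : ℝ → H, ∀ t, 0 ≤ t → (𝓕 (h t : L2 d) : L2 d) =ᵐ[volume]
        fun η => g t (M η) * (𝓕 (k : L2 d) : L2 d) η := by
    intro g k hg hC
    have : ∀ t, ∃ h : H, 0 ≤ t → (𝓕 (h : L2 d) : L2 d) =ᵐ[volume]
        fun η => g t (M η) * (𝓕 (k : L2 d) : L2 d) η := by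
      intro t
      rcases le_or_gt 0 t with ht | ht
      · obtain ⟨C, hC⟩ := hC t ht
        obtain ⟨h, hh⟩ := exists_functional_calculus hA hAm hm hpos (hg t ht) hC k
        exact ⟨h, fun _ => hh⟩
      · exact ⟨0, fun h => absurd h (not_le.2 ht)⟩
    choose h hh using this
    exact ⟨h, hh⟩
  have hbd := fun T => exists_bound_scalar hα0 hα1 hlam T
  obtain ⟨u, hu⟩ := hcalc (fun t mu => scalarSol α lam t mu) f
    (fun t _ => (continuous_scalarSol hα0).comp (by fun_prop : Continuous fun mu : ℝ => (t, mu)))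
    (fun t ht => by
      obtain ⟨C, _, hC⟩ := hbd t
      exact ⟨C, fun mu hmu => (hC mu hmu t ht le_rfl).1⟩)
  obtain ⟨w, hw⟩ := hcalc (fun t mu => -scalarVel α lam t mu) Af
    (fun t _ => ((continuous_scalarVel hα0).comp
      (by fun_prop : Continuous fun mu : ℝ => (t, mu))).neg)
    (fun t ht => by
      obtain ⟨C, _, hC⟩ := hbd t
      exact ⟨C, fun mu hmu => by rw [norm_neg]; exact (hC mu hmu t ht le_rfl).2.1⟩)
  obtain ⟨a, ha⟩ := hcalc (fun t mu => -scalarAcc α lam t mu) Af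
    (fun t _ => ((continuous_scalarAcc hα0).comp
      (by fun_prop : Continuous fun mu : ℝ => (t, mu))).neg)
    (fun t ht => by
      obtain ⟨C, _, hC⟩ := hbd t
      exact ⟨C, fun mu hmu => by rw [norm_neg]; exact (hC mu hmu t ht le_rfl).2.2.1⟩)
  obtain ⟨u', hu'⟩ := hcalc (fun t mu => -scalarSolDeriv α lam t mu) Af
    (fun t _ => (continuous_scalarSolDeriv hα0).neg)
    (fun t ht => by
      obtain ⟨C, _, hC⟩ := hbd t
      exact ⟨C * t ^ (α - 1), fun mu hmu => by
        rw [norm_neg]; exact (hC mu hmu t ht le_rfl).2.2.2.1⟩)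
  obtain ⟨w', hw'⟩ := hcalc (fun t mu => -scalarVelDeriv α lam t mu) Af
    (fun t _ => (continuous_scalarVelDeriv hα0).neg)
    (fun t ht => by
      obtain ⟨C, _, hC⟩ := hbd t
      exact ⟨C * t ^ (α - 1), fun mu hmu => by
        rw [norm_neg]; exact (hC mu hmu t ht le_rfl).2.2.2.2⟩)
  have hsub : ∀ {g : ℝ → ℝ → ℂ} {h : ℝ → H}, (∀ t, 0 ≤ t → (𝓕 (h t : L2 d) : L2 d) =ᵐ[volume]
      fun η => -g t (M η) * (𝓕 (Af : L2 d) : L2 d) η) → ∀ t, 0 ≤ t →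
      fourierSubspace H (h t) =ᵐ[volume] fun η => -((M η : ℂ) * F η) * g t (M η) := by
    intro g h hh t ht
    filter_upwards [hh t ht, hAfF] with η h1 h2
    change (𝓕 (h t : L2 d) : L2 d) η = _
    rw [h1, h2]; ring
  have hmeas : ∀ {g : ℝ → ℝ → ℂ}, Measurable (fun p : ℝ × ℝ => g p.1 p.2) →
      Measurable (Function.uncurry fun (t : ℝ) (η : EuclideanSpace ℝ (Fin d)) =>
        -((M η : ℂ) * F η) * g t (M η)) := by
    intro g hg
    have h1 : Measurable fun p : ℝ × EuclideanSpace ℝ (Fin d) => g p.1 (M p.2) :=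
      hg.comp (measurable_fst.prodMk (hMm.comp measurable_snd))
    have h2 : Measurable fun p : ℝ × EuclideanSpace ℝ (Fin d) => (M p.2 : ℂ) * F p.2 :=
      (Complex.measurable_ofReal.comp (hMm.comp measurable_snd)).mul (hFm.comp measurable_snd)
    exact h2.neg.mul h1
  have hbound : ∀ {g : ℝ → ℝ → ℂ} {T C : ℝ}, (∀ mu, 0 < mu → ∀ t, 0 ≤ t → t ≤ T →
      ‖g t mu‖ ≤ C * t ^ (α - 1)) → ∀ᵐ η, ∀ t ∈ Ioc 0 T,
      ‖-((M η : ℂ) * F η) * g t (M η)‖ ≤ C * ‖(M η : ℂ) * F η‖ * t ^ (α - 1) := by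
    intro g T C hC
    filter_upwards [hpos] with η hη t ht
    rw [norm_mul, norm_neg]
    calc _ ≤ ‖(M η : ℂ) * F η‖ * (C * t ^ (α - 1)) := by
          gcongr; exact hC _ hη t ht.1.le ht.2
      _ = _ := by ring
  have hconst : ∀ (c : ℂ) {t : ℝ} (k : ℝ → ℂ), ∫ τ in (0 : ℝ)..t,
      (((t - τ) ^ (-α) : ℝ) : ℂ) * (c * k τ) =
      c * ∫ τ in (0 : ℝ)..t, (((t - τ) ^ (-α) : ℝ) : ℂ) * k τ := by
    intro c t k
    rw [← intervalIntegral.integral_const_mul]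
    congr 1; ext τ; ring
  obtain ⟨hucd, hucap⟩ := caputoDifferentiable_of_pointwise hα0 hα1 (fourierSubspace H)
    (u := u) (D := u') (c := w)
    (φ := fun t η => scalarSol α lam t (M η) * F η)
    (ψ := fun t η => -((M η : ℂ) * F η) * scalarSolDeriv α lam t (M η))
    (θ := fun t η => -((M η : ℂ) * F η) * scalarVel α lam t (M η))
    hu (fun t ht => hsub hu' t ht.le) (fun t ht => hsub hw t ht.le)
    (hmeas (measurable_scalarSolDeriv hα0)) hB
    (fun η => (((continuous_scalarSol hα0).comp
      (by fun_prop : Continuous fun t : ℝ => (t, M η))).mul continuous_const).continuousOn)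
    (fun η t ht => by
      exact ((hasDerivAt_scalarSol (lam := lam) hα0 ht (M η)).mul_const (F η)).congr_deriv
        (by ring))
    (fun η t ht => by
      split_ifs with h
      · subst h; rw [scalarSolDeriv_one]
      · have hlt := lt_of_le_of_ne hα1 h
        rw [hconst, integral_scalarSolDeriv hα0 hlt ht]; ring)
    (fun T => by
      obtain ⟨C, hC0, hC⟩ := hbd T
      exact ⟨C, hC0, hbound fun mu hmu t ht htT => (hC mu hmu t ht htT).2.2.2.1⟩)
  obtain ⟨hwcd, hwcap⟩ := caputoDifferentiable_of_pointwise hα0 hα1 (fourierSubspace H)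
    (u := w) (D := w') (c := a)
    (φ := fun t η => -((M η : ℂ) * F η) * scalarVel α lam t (M η))
    (ψ := fun t η => -((M η : ℂ) * F η) * scalarVelDeriv α lam t (M η))
    (θ := fun t η => -((M η : ℂ) * F η) * scalarAcc α lam t (M η))
    (hsub hw) (fun t ht => hsub hw' t ht.le) (fun t ht => hsub ha t ht.le)
    (hmeas (measurable_scalarVelDeriv hα0)) hB
    (fun η => (continuous_const.mul ((continuous_scalarVel hα0).comp
      (by fun_prop : Continuous fun t : ℝ => (t, M η)))).continuousOn)
    (fun η t ht => (hasDerivAt_scalarVel (lam := lam) hα0 ht (M η)).const_mul _)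
    (fun η t ht => by
      split_ifs with h
      · subst h; rw [scalarVelDeriv_one]
      · have hlt := lt_of_le_of_ne hα1 h
        rw [hconst, integral_scalarVelDeriv hα0 hlt ht]; ring)
    (fun T => by
      obtain ⟨C, hC0, hC⟩ := hbd T
      exact ⟨C, hC0, hbound fun mu hmu t ht htT => (hC mu hmu t ht htT).2.2.2.2⟩)
  have hdom : ∀ t, 0 < t → u t ∈ A.domain := by
    intro t ht
    rw [hAm.mem_domain_iff_symbol]
    obtain ⟨C, _, hC⟩ := hbd t
    have h1 : MemLp (fun η => scalarSol α lam t (M η) * ((M η : ℂ) * F η)) 2 volume :=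
      memLp_bounded_mul (C := C) (((continuous_scalarSol hα0).comp
        (by fun_prop : Continuous fun mu : ℝ => (t, mu))).measurable.comp hMm).aestronglyMeasurable
        (by filter_upwards [hpos] with η hη using (hC _ hη t ht.le le_rfl).1) hMF
    refine (memLp_congr_ae ?_).1 h1
    filter_upwards [hu t ht.le] with η h2
    rw [h2]; ring
  refine ⟨u, ⟨hucd, ?_, hdom, w, fun t ht => (hucap t ht).symm, ?_, hwcd, fun t ht => ?_⟩, hu⟩
  · apply Subtype.ext
    apply eq_of_fourier_ae_eq
    filter_upwards [hu 0 le_rfl] with η h1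
    rw [h1, scalarSol_zero hα0, one_mul]
  · apply Subtype.ext
    apply eq_of_fourier_ae_eq
    have h0 : (𝓕 ((0 : H) : L2 d) : L2 d) = 0 :=
      (Lp.fourierTransformₗᵢ (EuclideanSpace ℝ (Fin d)) ℂ).map_zero
    rw [h0]
    filter_upwards [hw 0 le_rfl, Lp.coeFn_zero ℂ 2 volume] with η h1 h2
    rw [h1, h2, scalarVel_zero hα0]; simp
  · rw [hwcap t ht]
    apply (fourierSubspace H).injective
    rw [map_add, map_add, map_smul, map_zero]
    apply Lp.ext
    set b : H := A ⟨u t, hdom t ht⟩ with hb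
    have hb' : (𝓕 (b : L2 d) : L2 d) =ᵐ[volume]
        fun η => (M η : ℂ) * (𝓕 (u t : L2 d) : L2 d) η :=
      hAm.fourier_apply_symbol ⟨u t, hdom t ht⟩
    filter_upwards [hsub ha t ht.le, hsub hw t ht.le, hb', hu t ht.le,
      Lp.coeFn_add (fourierSubspace H (a t) + (2 * lam) • fourierSubspace H (w t))
        (fourierSubspace H b),
      Lp.coeFn_add (fourierSubspace H (a t)) ((2 * lam) • fourierSubspace H (w t)),
      Lp.coeFn_smul (2 * lam) (fourierSubspace H (w t)), Lp.coeFn_zero ℂ 2 volume]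
      with η h1 h2 h3 h4 h5 h6 h7 h8
    rw [h5, Pi.add_apply, h6, Pi.add_apply, h7, Pi.smul_apply, h1, h2, h8,
      fourierSubspace_apply b, h3, h4, scalarSol_eq hα0, Complex.real_smul]
    push_cast
    simp only [Pi.zero_apply, hF]
    ring

end CauchyProblem

/-! ### Polar coordinates and the Bessel function -/

section Polar

variable {d : ℕ} {F : Type*} [NormedAddCommGroup F] [NormedSpace ℝ F]

/-- The surface measure on the unit sphere. -/
abbrev sphereMeasure (d : ℕ) : Measure (Metric.sphere (0 : EuclideanSpace ℝ (Fin d)) 1) :=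
  (volume : Measure (EuclideanSpace ℝ (Fin d))).toSphere

theorem integral_eq_integral_sphere_prod (hd : 1 ≤ d) (g : EuclideanSpace ℝ (Fin d) → F) :
    ∫ x, g x = ∫ z : Metric.sphere (0 : EuclideanSpace ℝ (Fin d)) 1 × Ioi (0 : ℝ),
      g ((z.2 : ℝ) • (z.1 : EuclideanSpace ℝ (Fin d)))
        ∂((sphereMeasure d).prod (Measure.volumeIoiPow (d - 1))) := by
  have : Nonempty (Fin d) := ⟨⟨0, hd⟩⟩
  have h := (volume : Measure (EuclideanSpace ℝ (Fin d))).measurePreserving_homeomorphUnitSphereProd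
  rw [finrank_euclideanSpace_fin] at h
  have h0 : ∫ x, g x = ∫ x : ({(0 : EuclideanSpace ℝ (Fin d))}ᶜ : Set _), g x
      ∂(Measure.comap Subtype.val volume) := by
    rw [integral_subtype_comap (measurableSet_singleton _).compl fun x => g x,
      restrict_compl_singleton]
  rw [← h.integral_comp (Homeomorph.measurableEmbedding _), h0]
  apply integral_congr_ae
  refine Eventually.of_forall fun x => ?_
  have : ‖(x : EuclideanSpace ℝ (Fin d))‖ ≠ 0 := norm_ne_zero_iff.2 x.2
  simp [smul_smul, this]

omit [NormedSpace ℝ F] in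
theorem integrable_sphere_prod (hd : 1 ≤ d) {g : EuclideanSpace ℝ (Fin d) → F}
    (hg : Integrable g) :
    Integrable (fun z : Metric.sphere (0 : EuclideanSpace ℝ (Fin d)) 1 × Ioi (0 : ℝ) =>
      g ((z.2 : ℝ) • (z.1 : EuclideanSpace ℝ (Fin d))))
        ((sphereMeasure d).prod (Measure.volumeIoiPow (d - 1))) := by
  have : Nonempty (Fin d) := ⟨⟨0, hd⟩⟩
  have h := (volume : Measure (EuclideanSpace ℝ (Fin d))).measurePreserving_homeomorphUnitSphereProd
  rw [finrank_euclideanSpace_fin] at h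
  rw [← h.integrable_comp_emb (Homeomorph.measurableEmbedding _)]
  have h1 : Integrable (fun x : ({(0 : EuclideanSpace ℝ (Fin d))}ᶜ : Set _) => g x)
      (Measure.comap Subtype.val volume) :=
    (integrableOn_iff_comap_subtypeVal (measurableSet_singleton _).compl).1 hg.integrableOn
  refine h1.congr (Eventually.of_forall fun x => ?_)
  have : ‖(x : EuclideanSpace ℝ (Fin d))‖ ≠ 0 := norm_ne_zero_iff.2 x.2
  simp [smul_smul, this]

theorem integral_volumeIoiPow (n : ℕ) (q : ℝ → F) :
    ∫ r : Ioi (0 : ℝ), q r ∂(Measure.volumeIoiPow n) = ∫ r in Ioi (0 : ℝ), r ^ n • q r := by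
  simp only [Measure.volumeIoiPow, ENNReal.ofReal]
  rw [integral_withDensity_eq_integral_smul,
    integral_subtype_comap measurableSet_Ioi fun a ↦ Real.toNNReal (a ^ n) • q a]
  · refine setIntegral_congr_fun measurableSet_Ioi fun x hx => ?_
    rw [NNReal.smul_def, Real.coe_toNNReal _ (pow_nonneg (le_of_lt hx) _)]
  · exact (measurable_subtype_coe.pow_const _).real_toNNReal

/-- The moments of the surface measure of the unit sphere in a given direction. -/
def sphereMoment (x : EuclideanSpace ℝ (Fin d)) (n : ℕ) : ℝ :=
  ∫ ω, (inner ℝ x (ω : EuclideanSpace ℝ (Fin d))) ^ n ∂(sphereMeasure d)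

/-- A Gaussian weight converts the spherical moments into moments over the whole space. These factor
over coordinates (`integral_inner_pow_mul_exp`), and comparing the two evaluations gives the
spherical moments. -/
theorem integral_inner_pow_mul_exp_eq (hd : 1 ≤ d) (x : EuclideanSpace ℝ (Fin d)) (n : ℕ) :
    ∫ y : EuclideanSpace ℝ (Fin d), (inner ℝ x y) ^ n * Real.exp (-‖y‖ ^ 2) =
      sphereMoment x n * (1 / 2 * Real.Gamma ((n + d : ℝ) / 2)) := by
  rw [integral_eq_integral_sphere_prod hd]
  have h1 : ∀ z : Metric.sphere (0 : EuclideanSpace ℝ (Fin d)) 1 × Ioi (0 : ℝ),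
      (inner ℝ x ((z.2 : ℝ) • (z.1 : EuclideanSpace ℝ (Fin d)))) ^ n *
        Real.exp (-‖(z.2 : ℝ) • (z.1 : EuclideanSpace ℝ (Fin d))‖ ^ 2) =
      (inner ℝ x (z.1 : EuclideanSpace ℝ (Fin d))) ^ n *
        ((fun r : ℝ => r ^ n * Real.exp (-r ^ 2)) z.2) := by
    rintro ⟨ω, r, hr⟩
    have : ‖(ω : EuclideanSpace ℝ (Fin d))‖ = 1 := by simp
    simp only [inner_smul_right, norm_smul, this, mul_one, Real.norm_eq_abs, sq_abs, mul_pow]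
    ring
  rw [integral_congr_ae (Eventually.of_forall h1),
    integral_prod_mul (fun ω : Metric.sphere (0 : EuclideanSpace ℝ (Fin d)) 1 =>
      (inner ℝ x (ω : EuclideanSpace ℝ (Fin d))) ^ n)
      (fun r : Ioi (0 : ℝ) => (fun r : ℝ => r ^ n * Real.exp (-r ^ 2)) r),
    integral_volumeIoiPow (d - 1) fun r : ℝ => r ^ n * Real.exp (-r ^ 2)]
  congr 1
  have h2 := integral_rpow_mul_exp_neg_rpow (p := 2) (q := n + d - 1) two_pos (by
    have : (1 : ℝ) ≤ d := by exact_mod_cast hd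
    have := Nat.cast_nonneg (α := ℝ) n
    linarith)
  rw [show ((n : ℝ) + d - 1 + 1) / 2 = (n + d) / 2 by ring] at h2
  rw [← h2]
  refine setIntegral_congr_fun measurableSet_Ioi fun r (hr : 0 < r) => ?_
  simp only [smul_eq_mul]
  rw [← mul_assoc, ← pow_add, show (n : ℝ) + d - 1 = ((d - 1 + n : ℕ) : ℝ) by
    push_cast [Nat.cast_sub hd]; ring, Real.rpow_natCast]
  norm_num

theorem integral_even_pow_mul_exp (k : ℕ) :
    ∫ y : ℝ, y ^ (2 * k) * Real.exp (-y ^ 2) = Real.Gamma (k + 1 / 2) := by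
  have h1 := integral_comp_abs (f := fun y : ℝ => y ^ (2 * k) * Real.exp (-y ^ 2))
  simp only [sq_abs, pow_mul] at h1
  simp only [pow_mul]
  rw [h1]
  have h2 := integral_rpow_mul_exp_neg_rpow (p := 2) (q := 2 * k) two_pos (by
    have := Nat.cast_nonneg (α := ℝ) k
    linarith)
  rw [show (2 * (k : ℝ) + 1) / 2 = k + 1 / 2 by ring] at h2
  have h3 : ∫ y in Ioi (0 : ℝ), (y ^ 2) ^ k * Real.exp (-y ^ 2) =
      ∫ y in Ioi (0 : ℝ), y ^ (2 * (k : ℝ)) * Real.exp (-y ^ (2 : ℝ)) := by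
    refine setIntegral_congr_fun measurableSet_Ioi fun r (hr : 0 < r) => ?_
    rw [show 2 * (k : ℝ) = ((2 * k : ℕ) : ℝ) by push_cast; ring, Real.rpow_natCast, pow_mul]
    norm_num
  rw [h3, h2]
  ring

theorem Gamma_nat_add_half_mul (k : ℕ) :
    Real.Gamma (k + 1 / 2) * (4 ^ k * k.factorial) = (2 * k).factorial * √Real.pi := by
  induction k with
  | zero => simp [-one_div, Real.Gamma_one_half_eq]
  | succ k ih =>
    have h : ((k + 1 : ℕ) : ℝ) + 1 / 2 = (k + 1 / 2 : ℝ) + 1 := by push_cast; ring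
    rw [h, Real.Gamma_add_one (by positivity), show 2 * (k + 1) = 2 * k + 1 + 1 by ring,
      Nat.factorial_succ, Nat.factorial_succ, Nat.factorial_succ]
    push_cast
    linear_combination (4 * (k + 1) * (k + 1 / 2) : ℝ) * ih

theorem integral_inner_pow_mul_exp (hd : 1 ≤ d) (x : EuclideanSpace ℝ (Fin d)) (k : ℕ) :
    ∫ y : EuclideanSpace ℝ (Fin d), (inner ℝ x y) ^ (2 * k) * Real.exp (-‖y‖ ^ 2) =
      ‖x‖ ^ (2 * k) * (Real.Gamma (k + 1 / 2) * √Real.pi ^ (d - 1)) := by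
  obtain ⟨d, rfl⟩ : ∃ d', d = d' + 1 := ⟨d - 1, by omega⟩
  set e : EuclideanSpace ℝ (Fin (d + 1)) := ‖x‖ • EuclideanSpace.single 0 1 with he
  have hnorm : ‖x‖ = ‖e‖ := by simp [he, norm_smul]
  -- A reflection taking x to the first coordinate axis; the Gaussian is invariant and the integrand
  -- becomes a product over coordinates.
  set U := (Submodule.span ℝ {x - e})ᗮ.reflection with hU
  have hUx : U x = e := Submodule.reflection_sub hnorm
  have h1 : ∫ y : EuclideanSpace ℝ (Fin (d + 1)), (inner ℝ x y) ^ (2 * k) * Real.exp (-‖y‖ ^ 2) =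
      ∫ y : EuclideanSpace ℝ (Fin (d + 1)), (inner ℝ e y) ^ (2 * k) * Real.exp (-‖y‖ ^ 2) := by
    rw [← U.measurePreserving.integral_comp U.toHomeomorph.measurableEmbedding
      (fun y => (inner ℝ e y) ^ (2 * k) * Real.exp (-‖y‖ ^ 2))]
    simp only [← hUx, LinearIsometryEquiv.inner_map_map, LinearIsometryEquiv.norm_map]
  have h2 : ∀ y : EuclideanSpace ℝ (Fin (d + 1)),
      (inner ℝ e y) ^ (2 * k) * Real.exp (-‖y‖ ^ 2) = ‖x‖ ^ (2 * k) *
        ∏ i, (if i = 0 then y i ^ (2 * k) else 1) * Real.exp (-y i ^ 2) := by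
    intro y
    simp only [Finset.prod_mul_distrib, ← Real.exp_sum, EuclideanSpace.norm_sq_eq,
      Finset.sum_neg_distrib, Finset.prod_ite_eq', Finset.mem_univ, if_true]
    rw [he, inner_smul_left, EuclideanSpace.inner_single_left]
    simp [mul_pow, mul_assoc]
  have h3 := (PiLp.volume_preserving_ofLp (Fin (d + 1))).integral_comp
    (MeasurableEquiv.toLp 2 (Fin (d + 1) → ℝ)).symm.measurableEmbedding
    (fun v => ∏ i, (if i = 0 then v i ^ (2 * k) else 1) * Real.exp (-v i ^ 2))
  rw [h1, integral_congr_ae (Eventually.of_forall h2), integral_const_mul, h3,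
    integral_fintype_prod_volume_eq_prod (fun (i : Fin (d + 1)) (s : ℝ) =>
      (if i = 0 then s ^ (2 * k) else 1) * Real.exp (-s ^ 2)), Fin.prod_univ_succ]
  have h4 : ∫ s : ℝ, Real.exp (-s ^ 2) = √Real.pi := by
    simpa using integral_gaussian 1
  simp [Fin.succ_ne_zero, integral_even_pow_mul_exp, h4]

theorem sphereMoment_odd (x : EuclideanSpace ℝ (Fin d)) (hd : 1 ≤ d) {n : ℕ} (hn : Odd n) :
    sphereMoment x n = 0 := by
  have h1 := integral_inner_pow_mul_exp_eq hd x n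
  have h2 : ∫ y : EuclideanSpace ℝ (Fin d), (inner ℝ x y) ^ n * Real.exp (-‖y‖ ^ 2) = 0 := by
    have h3 := integral_neg_eq_self
      (fun y : EuclideanSpace ℝ (Fin d) => (inner ℝ x y) ^ n * Real.exp (-‖y‖ ^ 2)) volume
    simp only [inner_neg_right, hn.neg_pow, norm_neg, neg_mul, integral_neg] at h3
    linarith
  rw [h2] at h1
  have h4 : 0 < Real.Gamma ((n + d : ℝ) / 2) := Real.Gamma_pos_of_pos (by
    have : (1 : ℝ) ≤ d := by exact_mod_cast hd
    positivity)
  rcases mul_eq_zero.1 h1.symm with h | h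
  · exact h
  · linarith

theorem sphereMoment_even (x : EuclideanSpace ℝ (Fin d)) (hd : 1 ≤ d) (k : ℕ) :
    sphereMoment x (2 * k) / (2 * k).factorial =
      2 * √Real.pi ^ d * ((‖x‖ / 2) ^ (2 * k) / (k.factorial * Real.Gamma (k + d / 2))) := by
  have h1 := integral_inner_pow_mul_exp_eq hd x (2 * k)
  rw [integral_inner_pow_mul_exp hd] at h1
  have hd' : (1 : ℝ) ≤ d := by exact_mod_cast hd
  have h2 := Gamma_nat_add_half_mul k
  have e : (((2 * k : ℕ) : ℝ) + d) / 2 = k + d / 2 := by push_cast; ring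
  rw [e] at h1
  have h4 : 0 < Real.Gamma (k + d / 2 : ℝ) := Real.Gamma_pos_of_pos (by positivity)
  have h5 : √Real.pi ^ d = √Real.pi ^ (d - 1) * √Real.pi := by
    rw [← pow_succ, Nat.sub_add_cancel hd]
  have h6 : (0 : ℝ) < (2 * k).factorial := by positivity
  have h7 : (0 : ℝ) < k.factorial := by positivity
  have h8 : (2 : ℝ) ^ (2 * k) = 4 ^ k := by rw [pow_mul]; norm_num
  rw [div_pow, h8, h5]
  field_simp
  have h9 : sphereMoment x (2 * k) * Real.Gamma (k + d / 2) =
      2 * (‖x‖ ^ (2 * k) * (Real.Gamma (k + 1 / 2) * √Real.pi ^ (d - 1))) := by linarith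
  calc _ = (sphereMoment x (2 * k) * Real.Gamma (k + d / 2)) * (4 ^ k * k.factorial) := by ring_nf
    _ = 2 * ‖x‖ ^ (2 * k) * √Real.pi ^ (d - 1) *
        (Real.Gamma (k + 1 / 2) * (4 ^ k * k.factorial)) := by rw [h9]; ring
    _ = _ := by rw [h2]; ring

/-- The Fourier transform of the surface measure. -/
def sphereFourier (x : EuclideanSpace ℝ (Fin d)) (r : ℝ) : ℂ :=
  ∫ ω, Complex.exp ((r * inner ℝ x (ω : EuclideanSpace ℝ (Fin d)) : ℝ) * Complex.I)
    ∂(sphereMeasure d)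

theorem norm_sphereFourier_le (x : EuclideanSpace ℝ (Fin d)) (r : ℝ) :
    ‖sphereFourier x r‖ ≤ (sphereMeasure d).real univ := by
  refine (norm_integral_le_of_norm_le_const (C := 1) (Eventually.of_forall fun ω => ?_)).trans
    (by rw [one_mul])
  rw [Complex.norm_exp_ofReal_mul_I]

theorem hasSum_integral_exp_mul_I {X : Type*} [MeasurableSpace X] {μ : Measure X}
    [IsFiniteMeasure μ] {s : X → ℝ} (hs : Measurable s) {B : ℝ} (hB : ∀ ω, |s ω| ≤ B) (r : ℝ) :
    HasSum (fun n : ℕ => (r * Complex.I) ^ n / n.factorial * ((∫ ω, s ω ^ n ∂μ : ℝ) : ℂ))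
      (∫ ω, Complex.exp ((r * s ω : ℝ) * Complex.I) ∂μ) := by
  have h := hasSum_integral_of_dominated_convergence (μ := μ)
    (F := fun (n : ℕ) ω => (r * Complex.I) ^ n / n.factorial * ((s ω ^ n : ℝ) : ℂ))
    (f := fun ω => Complex.exp ((r * s ω : ℝ) * Complex.I))
    (fun n _ => (|r| * B) ^ n / n.factorial)
    (fun n => ((Complex.measurable_ofReal.comp (hs.pow_const n)).const_mul _).aestronglyMeasurable)
    (fun n => Eventually.of_forall fun ω => ?_)
    (Eventually.of_forall fun _ => Real.summable_pow_div_factorial _)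
    (integrable_const _) (Eventually.of_forall fun ω => ?_)
  · simpa only [integral_const_mul, integral_complex_ofReal] using h
  · rw [norm_mul, norm_div, norm_pow, norm_mul, Complex.norm_I, mul_one, Complex.norm_real,
      Complex.norm_real, Complex.norm_natCast, norm_pow, Real.norm_eq_abs, Real.norm_eq_abs,
      mul_pow, div_mul_eq_mul_div]
    gcongr
    exact hB ω
  · have h1 := NormedSpace.expSeries_div_hasSum_exp (𝔸 := ℂ) ((r * s ω : ℝ) * Complex.I)
    rw [← Complex.exp_eq_exp_ℂ] at h1
    refine h1.congr_fun fun n => ?_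
    push_cast
    ring

/-- Expanding the exponential turns the Fourier transform of the sphere into a moment series. Odd
moments vanish by symmetry and the even ones produce the Bessel series. -/
theorem hasSum_sphereFourier (x : EuclideanSpace ℝ (Fin d)) (r : ℝ) :
    HasSum (fun n : ℕ => (r * Complex.I) ^ n / n.factorial * (sphereMoment x n : ℂ))
      (sphereFourier x r) := by
  refine hasSum_integral_exp_mul_I (B := ‖x‖) (Continuous.measurable ?_) (fun ω => ?_) r
  · exact continuous_const.inner continuous_subtype_val
  · have : ‖(ω : EuclideanSpace ℝ (Fin d))‖ = 1 := by simp
    simpa [this] using abs_real_inner_le_norm x (ω : EuclideanSpace ℝ (Fin d))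

theorem hasSum_sphereFourier_even (hd : 1 ≤ d) (x : EuclideanSpace ℝ (Fin d)) (r : ℝ) :
    HasSum (fun k : ℕ => ((2 * √Real.pi ^ d * ((-1) ^ k / (k.factorial * Real.Gamma (k + d / 2)) *
      (r * ‖x‖ / 2) ^ (2 * k)) : ℝ) : ℂ)) (sphereFourier x r) := by
  have h := hasSum_sphereFourier x r
  rw [← (mul_right_injective₀ (two_ne_zero' ℕ)).hasSum_iff (f := fun n : ℕ =>
    (r * Complex.I) ^ n / n.factorial * (sphereMoment x n : ℂ)) (fun n hn => by
      have : Odd n := by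
        rw [← Nat.not_even_iff_odd]
        rintro ⟨k, rfl⟩
        exact hn ⟨k, by simp only; ring⟩
      rw [sphereMoment_odd x hd this]; simp)] at h
  convert h using 2 with k
  have h1 := sphereMoment_even x hd k
  have h2 : (r * Complex.I : ℂ) ^ (2 * k) = (((-1) ^ k * r ^ (2 * k) : ℝ) : ℂ) := by
    rw [mul_pow, pow_mul Complex.I, Complex.I_sq]; push_cast; ring
  have h3 : (r * Complex.I) ^ (2 * k) / ((2 * k).factorial : ℂ) * (sphereMoment x (2 * k) : ℂ) =
      (((-1) ^ k * r ^ (2 * k) * (sphereMoment x (2 * k) / (2 * k).factorial) : ℝ) : ℂ) := by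
    rw [h2]; push_cast; ring
  rw [Function.comp, h3, h1]
  congr 1
  rw [mul_div_assoc r, mul_pow]
  ring

theorem sphereFourier_eq_tsum (hd : 1 ≤ d) (x : EuclideanSpace ℝ (Fin d)) (r : ℝ) :
    sphereFourier x r = ((2 * √Real.pi ^ d * ∑' k : ℕ, (-1) ^ k /
      (k.factorial * Real.Gamma (k + (d / 2 - 1) + 1)) * (r * ‖x‖ / 2) ^ (2 * k) : ℝ) : ℂ) := by
  rw [← (hasSum_sphereFourier_even hd x r).tsum_eq, ← Complex.ofReal_tsum, tsum_mul_left]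
  simp only [show ∀ k : ℕ, (k : ℝ) + (d / 2 - 1) + 1 = k + d / 2 from fun k => by ring]

/-- The bridge between the Bessel form and the Fourier transform. The right-hand side is bounded by
a multiple of r^(d-1), so no asymptotics of Bessel functions are ever needed. -/
theorem hankelPrefactor_mul (hd : 1 ≤ d) {x : EuclideanSpace ℝ (Fin d)} (hx : x ≠ 0) {r : ℝ}
    (hr : 0 < r) : hankelPrefactor d x *
      ((r ^ ((d : ℝ) / 2) * besselJ ((d : ℝ) / 2 - 1) (r * ‖x‖) : ℝ) : ℂ) =
      (((2 * Real.pi) ^ d)⁻¹ * r ^ (d - 1) : ℝ) * sphereFourier x r := by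
  have hx' : 0 < ‖x‖ := norm_pos_iff.2 hx
  have hπ := Real.pi_pos
  rw [hankelPrefactor, besselJ, sphereFourier_eq_tsum hd, ← Complex.ofReal_mul,
    ← Complex.ofReal_mul]
  congr 1
  generalize (∑' k : ℕ, (-1) ^ k / ((k.factorial : ℝ) *
    Real.Gamma (k + ((d : ℝ) / 2 - 1) + 1)) * (r * ‖x‖ / 2) ^ (2 * k)) = S
  have e1 : (r * ‖x‖ / 2) ^ ((d : ℝ) / 2 - 1) =
      r ^ ((d : ℝ) / 2 - 1) * ‖x‖ ^ ((d : ℝ) / 2 - 1) / 2 ^ ((d : ℝ) / 2 - 1) := by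
    rw [Real.div_rpow (by positivity) (by positivity), Real.mul_rpow hr.le hx'.le]
  have e2 : r ^ ((d : ℝ) / 2) * r ^ ((d : ℝ) / 2 - 1) = r ^ (d - 1) := by
    rw [← Real.rpow_add hr, ← Real.rpow_natCast]
    congr 1
    rw [Nat.cast_sub hd]; push_cast; ring
  have e3 : (2 * Real.pi) ^ ((d : ℝ) / 2) = 2 ^ ((d : ℝ) / 2) * √Real.pi ^ d := by
    rw [Real.mul_rpow two_pos.le hπ.le, Real.sqrt_eq_rpow, ← Real.rpow_natCast, ← Real.rpow_mul hπ.le]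
    congr 2; ring
  have e4 : (2 : ℝ) ^ ((d : ℝ) / 2) * 2 ^ ((d : ℝ) / 2 - 1) * 2 = 2 ^ d := by
    rw [← Real.rpow_add two_pos, ← Real.rpow_add_one two_ne_zero, ← Real.rpow_natCast]
    congr 1; ring
  have e5 : √Real.pi ^ d * √Real.pi ^ d = Real.pi ^ d := by
    rw [← mul_pow, Real.mul_self_sqrt hπ.le]
  have p1 : (0 : ℝ) < ‖x‖ ^ ((d : ℝ) / 2 - 1) := by positivity
  have p2 : (0 : ℝ) < 2 ^ ((d : ℝ) / 2) := by positivity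
  have p3 : (0 : ℝ) < 2 ^ ((d : ℝ) / 2 - 1) := by positivity
  have p4 : 0 < √Real.pi ^ d := by positivity
  rw [e1, e3, mul_pow, ← e4, ← e5, ← e2]
  field_simp

theorem continuous_sphereFourier (x : EuclideanSpace ℝ (Fin d)) :
    Continuous (sphereFourier x) := by
  refine continuous_of_dominated (bound := fun _ => 1) (fun r => ?_) (fun r => ?_)
    (integrable_const _) ?_
  · have : Continuous fun ω : Metric.sphere (0 : EuclideanSpace ℝ (Fin d)) 1 =>
        Complex.exp ((r * inner ℝ x (ω : EuclideanSpace ℝ (Fin d)) : ℝ) * Complex.I) := by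
      fun_prop
    exact this.aestronglyMeasurable
  · refine Eventually.of_forall fun ω => ?_
    rw [Complex.norm_exp_ofReal_mul_I]
  · refine Eventually.of_forall fun ω => ?_
    have : Continuous fun r : ℝ => ((r * inner ℝ x (ω : EuclideanSpace ℝ (Fin d)) : ℝ) : ℂ) :=
      Complex.continuous_ofReal.comp (continuous_id.mul continuous_const)
    exact Complex.continuous_exp.comp (this.mul continuous_const)

/-- The Hankel transform formula for the inverse Fourier transform of a radial function. -/
theorem fourierInv_radial (hd : 1 ≤ d) {x : EuclideanSpace ℝ (Fin d)} (hx : x ≠ 0) {g : ℝ → ℂ}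
    (hg : Integrable fun η : EuclideanSpace ℝ (Fin d) => g (2 * Real.pi * ‖η‖)) :
    𝓕⁻ (fun η : EuclideanSpace ℝ (Fin d) => g (2 * Real.pi * ‖η‖)) x =
      hankelPrefactor d x * ∫ r in Ioi (0 : ℝ),
        ((r ^ ((d : ℝ) / 2) * besselJ ((d : ℝ) / 2 - 1) (r * ‖x‖) : ℝ) : ℂ) * g r := by
  have hπ := Real.pi_pos
  rw [Real.fourierInv_eq', integral_eq_integral_sphere_prod hd]
  have hint : Integrable fun η : EuclideanSpace ℝ (Fin d) =>
      Complex.exp (((2 * Real.pi * inner ℝ η x : ℝ) : ℂ) * Complex.I) •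
        g (2 * Real.pi * ‖η‖) := by
    refine (integrable_norm_iff ?_).1 ?_
    · have : Continuous fun η : EuclideanSpace ℝ (Fin d) =>
          Complex.exp (((2 * Real.pi * inner ℝ η x : ℝ) : ℂ) * Complex.I) := by fun_prop
      exact this.aestronglyMeasurable.smul hg.1
    · simp only [norm_smul, Complex.norm_exp_ofReal_mul_I, one_mul]
      exact hg.norm
  have hint' := integrable_sphere_prod hd hint
  rw [integral_prod_symm _ hint']
  have h1 : ∀ r : Ioi (0 : ℝ), ∫ ω : Metric.sphere (0 : EuclideanSpace ℝ (Fin d)) 1,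
      Complex.exp (((2 * Real.pi * inner ℝ ((r : ℝ) • (ω : EuclideanSpace ℝ (Fin d))) x : ℝ) : ℂ)
        * Complex.I) • g (2 * Real.pi * ‖(r : ℝ) • (ω : EuclideanSpace ℝ (Fin d))‖)
        ∂(sphereMeasure d) =
      (fun r : ℝ => sphereFourier x (2 * Real.pi * r) * g (2 * Real.pi * r)) r := by
    rintro ⟨r, hr⟩
    simp only [sphereFourier]
    rw [← integral_mul_const]
    congr 1; ext ω
    have : ‖(ω : EuclideanSpace ℝ (Fin d))‖ = 1 := by simp
    rw [norm_smul, this, mul_one, Real.norm_of_nonneg (le_of_lt hr), real_inner_smul_left,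
      real_inner_comm, smul_eq_mul, mul_assoc (2 * Real.pi)]
  simp only [h1]
  rw [integral_volumeIoiPow (d - 1) fun r : ℝ =>
    sphereFourier x (2 * Real.pi * r) * g (2 * Real.pi * r), ← integral_const_mul]
  have h2 : ∫ r in Ioi (0 : ℝ), hankelPrefactor d x *
      (((r ^ ((d : ℝ) / 2) * besselJ ((d : ℝ) / 2 - 1) (r * ‖x‖) : ℝ) : ℂ) * g r) =
      ∫ r in Ioi (0 : ℝ), (((2 * Real.pi) ^ d)⁻¹ * r ^ (d - 1) : ℝ) * sphereFourier x r * g r :=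
    setIntegral_congr_fun measurableSet_Ioi fun r (hr : 0 < r) => by
      rw [← mul_assoc, hankelPrefactor_mul hd hx hr]
  -- The substitution r ↦ 2πr passes from the frequency in exp(2πi⟨η, x⟩) to the one in exp(i⟨ξ, x⟩)
  -- and accounts for the factor (2π)^(-d).
  have h3 := integral_comp_mul_left_Ioi' (fun r : ℝ =>
    ((((2 * Real.pi) ^ d)⁻¹ * r ^ (d - 1) : ℝ) : ℂ) * sphereFourier x r * g r) 0
    (by positivity : 0 < 2 * Real.pi)
  rw [mul_zero] at h3
  rw [h2, ← h3, ← integral_smul]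
  refine setIntegral_congr_fun measurableSet_Ioi fun r (hr : 0 < r) => ?_
  have e : 2 * Real.pi * (((2 * Real.pi) ^ d)⁻¹ * (2 * Real.pi * r) ^ (d - 1)) = r ^ (d - 1) := by
    obtain ⟨d, rfl⟩ : ∃ d', d = d' + 1 := ⟨d - 1, by omega⟩
    rw [Nat.add_sub_cancel, mul_pow, pow_succ]
    field_simp
    ring
  simp only [Complex.real_smul]
  rw [← e, Complex.ofReal_mul (2 * Real.pi)]
  ring

theorem integrableOn_bessel_mul (hd : 1 ≤ d) {x : EuclideanSpace ℝ (Fin d)} (hx : x ≠ 0)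
    {g : ℝ → ℂ} {S : Set ℝ} (hS : S ⊆ Ioi 0) (hSm : MeasurableSet S)
    (hg : IntegrableOn (fun r => (r ^ (d - 1) : ℝ) • g r) S) :
    IntegrableOn (fun r => ((r ^ ((d : ℝ) / 2) *
      besselJ ((d : ℝ) / 2 - 1) (r * ‖x‖) : ℝ) : ℂ) * g r) S := by
  have hx' : 0 < ‖x‖ := norm_pos_iff.2 hx
  have hp : hankelPrefactor d x ≠ 0 := by
    rw [hankelPrefactor, Complex.ofReal_ne_zero]
    have := Real.pi_pos
    positivity
  have h1 : IntegrableOn (fun r => (hankelPrefactor d x)⁻¹ * ((((2 * Real.pi) ^ d)⁻¹ : ℝ) : ℂ) *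
      (sphereFourier x r * ((r ^ (d - 1) : ℝ) • g r))) S :=
    (Integrable.bdd_mul hg (continuous_sphereFourier x).aestronglyMeasurable
      (Eventually.of_forall (norm_sphereFourier_le x))).const_mul _
  refine h1.congr_fun (fun r hr => ?_) hSm
  have h2 := hankelPrefactor_mul hd hx (hS hr)
  simp only [Complex.real_smul]
  have h3 : ((r ^ ((d : ℝ) / 2) * besselJ ((d : ℝ) / 2 - 1) (r * ‖x‖) : ℝ) : ℂ) =
    (hankelPrefactor d x)⁻¹ * ((((2 * Real.pi) ^ d)⁻¹ * r ^ (d - 1) : ℝ) * sphereFourier x r) := by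
    rw [← h2, inv_mul_cancel_left₀ hp]
  rw [h3]
  push_cast
  ring

end Polar

/-! ### Pairings of square integrable functions and their Fourier transforms -/

section Pairing

variable {d : ℕ}

theorem L2.integrable_mul (f g : L2 d) : Integrable fun x => f x * g x :=
  (Lp.memLp f).integrable_mul (Lp.memLp g)

theorem L2.continuous_integral_mul (f : L2 d) : Continuous fun g : L2 d => ∫ x, f x * g x := by
  have h : ∀ g : L2 d, ∫ x, f x * g x =
      (ContinuousLinearMap.mul ℂ ℂ).lpPairing volume 2 2 f g := fun g => by
    rw [ContinuousLinearMap.lpPairing_eq_integral]; rfl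
  simp only [h]
  exact ContinuousLinearMap.continuous _

theorem denseRange_toL2 (d : ℕ) :
    DenseRange fun φ : 𝓢(EuclideanSpace ℝ (Fin d), ℂ) => φ.toLp 2 volume :=
  SchwartzMap.denseRange_toLpCLM (p := 2) ENNReal.ofNat_ne_top

/-- For Schwartz g this says that the Fourier transforms on L² and on tempered distributions agree;
density does the rest. The pairing is bilinear, without conjugation, to match distributions. -/
theorem L2.integral_fourier_mul_eq (f g : L2 d) :
    ∫ x, (𝓕 f : L2 d) x * g x = ∫ x, f x * (𝓕 g : L2 d) x := by
  refine (denseRange_toL2 d).induction_on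
    (p := fun g : L2 d => ∫ x, (𝓕 f : L2 d) x * g x = ∫ x, f x * (𝓕 g : L2 d) x) g ?_ fun φ => ?_
  · exact isClosed_eq (L2.continuous_integral_mul _) ((L2.continuous_integral_mul _).comp
      (Lp.fourierTransformₗᵢ (EuclideanSpace ℝ (Fin d)) ℂ).continuous)
  · have h := congrArg (fun K : 𝓢'(EuclideanSpace ℝ (Fin d), ℂ) => K φ)
      (Lp.fourier_toTemperedDistribution_eq f)
    simp only [TemperedDistribution.fourier_apply, Lp.toTemperedDistribution_apply,
      smul_eq_mul] at h
    rw [SchwartzMap.toLp_fourier_eq]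
    calc _ = ∫ x, φ x * (𝓕 f : L2 d) x := integral_congr_ae (by
          filter_upwards [φ.coeFn_toLp 2] with x hx
          rw [hx, mul_comm])
      _ = _ := h.symm
      _ = _ := integral_congr_ae (by
          filter_upwards [(𝓕 φ).coeFn_toLp 2] with x hx
          rw [hx, mul_comm])

theorem L2.integral_fourierInv_mul_eq (f g : L2 d) :
    ∫ x, (𝓕⁻ f : L2 d) x * g x = ∫ x, f x * (𝓕⁻ g : L2 d) x := by
  have h := L2.integral_fourier_mul_eq (𝓕⁻ f) (𝓕⁻ g)
  rw [FourierTransform.fourier_fourierInv_eq, FourierTransform.fourier_fourierInv_eq] at h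
  exact h.symm

theorem integral_fourier_mul_eq_of_integrable {f g : EuclideanSpace ℝ (Fin d) → ℂ}
    (hf : Integrable f) (hg : Integrable g) : ∫ x, 𝓕 f x * g x = ∫ x, f x * 𝓕 g x := by
  have h := VectorFourier.integral_fourierIntegral_smul_eq_flip (μ := volume) (ν := volume)
    (L := innerₗ (EuclideanSpace ℝ (Fin d))) Real.continuous_fourierChar continuous_inner hf hg
  rw [flip_innerₗ] at h
  exact h

theorem integral_fourierInv_mul_eq_of_integrable {f g : EuclideanSpace ℝ (Fin d) → ℂ}
    (hf : Integrable f) (hg : Integrable g) : ∫ x, 𝓕⁻ f x * g x = ∫ x, f x * 𝓕⁻ g x := by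
  rw [Real.fourierInv_eq_fourier_comp_neg, integral_fourier_mul_eq_of_integrable hf.comp_neg hg,
    ← integral_neg_eq_self]
  simp only [neg_neg, Real.fourierInv_eq_fourier_neg]

theorem continuous_fourier {f : EuclideanSpace ℝ (Fin d) → ℂ} (hf : Integrable f) :
    Continuous (𝓕 f) :=
  VectorFourier.fourierIntegral_continuous (L := innerₗ (EuclideanSpace ℝ (Fin d)))
    Real.continuous_fourierChar continuous_inner hf

theorem continuous_fourierInv {f : EuclideanSpace ℝ (Fin d) → ℂ} (hf : Integrable f) :
    Continuous (𝓕⁻ f) := by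
  rw [Real.fourierInv_eq_fourier_comp_neg]
  exact continuous_fourier hf.comp_neg

theorem norm_fourierInv_le {f : EuclideanSpace ℝ (Fin d) → ℂ} (x : EuclideanSpace ℝ (Fin d)) :
    ‖𝓕⁻ f x‖ ≤ ∫ y, ‖f y‖ := by
  rw [Real.fourierInv_eq]
  refine (norm_integral_le_integral_norm _).trans (le_of_eq ?_)
  simp only [Circle.norm_smul]

theorem ae_eq_of_integral_schwartz_mul_eq {f g : EuclideanSpace ℝ (Fin d) → ℂ}
    (hf : LocallyIntegrable f) (hg : LocallyIntegrable g)
    (h : ∀ φ : 𝓢(EuclideanSpace ℝ (Fin d), ℂ), ∫ x, f x * φ x = ∫ x, g x * φ x) :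
    f =ᵐ[volume] g := by
  refine ae_eq_of_integral_contDiff_smul_eq hf hg fun ψ hψ hc => ?_
  have hψ' : ContDiff ℝ (⊤ : ℕ∞) fun x => (ψ x : ℂ) := Complex.ofRealCLM.contDiff.comp hψ
  have hc' : HasCompactSupport fun x => (ψ x : ℂ) := hc.comp_left Complex.ofReal_zero
  have := h (hc'.toSchwartzMap hψ')
  simpa [mul_comm] using this

/-- The two Fourier transforms of an integrable and square integrable function agree. -/
theorem fourier_toL2_ae_eq {f : EuclideanSpace ℝ (Fin d) → ℂ} (h1 : Integrable f)
    (h2 : MemLp f 2) : (𝓕 (h2.toLp f) : L2 d) =ᵐ[volume] 𝓕 f := by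
  refine ae_eq_of_integral_schwartz_mul_eq ((Lp.memLp _).locallyIntegrable one_le_two)
    (continuous_fourier h1).locallyIntegrable fun φ => ?_
  have h := L2.integral_fourier_mul_eq (h2.toLp f) (φ.toLp 2)
  rw [SchwartzMap.toLp_fourier_eq] at h
  calc _ = ∫ x, (𝓕 (h2.toLp f) : L2 d) x * φ.toLp 2 volume x := integral_congr_ae (by
        filter_upwards [φ.coeFn_toLp 2] with x hx
        rw [hx])
    _ = _ := h
    _ = ∫ x, f x * 𝓕 (φ : EuclideanSpace ℝ (Fin d) → ℂ) x := integral_congr_ae (by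
        filter_upwards [(𝓕 φ).coeFn_toLp 2, h2.coeFn_toLp] with x hx hx'
        rw [hx, hx', SchwartzMap.fourier_coe])
    _ = _ := (integral_fourier_mul_eq_of_integrable h1 φ.integrable).symm

theorem fourierInv_toL2_ae_eq {f : EuclideanSpace ℝ (Fin d) → ℂ} (h1 : Integrable f)
    (h2 : MemLp f 2) : (𝓕⁻ (h2.toLp f) : L2 d) =ᵐ[volume] 𝓕⁻ f := by
  refine ae_eq_of_integral_schwartz_mul_eq ((Lp.memLp _).locallyIntegrable one_le_two)
    (continuous_fourierInv h1).locallyIntegrable fun φ => ?_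
  have h := L2.integral_fourierInv_mul_eq (h2.toLp f) (φ.toLp 2)
  rw [SchwartzMap.toLp_fourierInv_eq] at h
  calc _ = ∫ x, (𝓕⁻ (h2.toLp f) : L2 d) x * φ.toLp 2 volume x := integral_congr_ae (by
        filter_upwards [φ.coeFn_toLp 2] with x hx
        rw [hx])
    _ = _ := h
    _ = ∫ x, f x * 𝓕⁻ (φ : EuclideanSpace ℝ (Fin d) → ℂ) x := integral_congr_ae (by
        filter_upwards [(𝓕⁻ φ).coeFn_toLp 2, h2.coeFn_toLp] with x hx hx'
        rw [hx, hx', SchwartzMap.fourierInv_coe])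
    _ = _ := (integral_fourierInv_mul_eq_of_integrable h1 φ.integrable).symm

/-- The convolution of two square integrable functions is the inverse Fourier transform of the
product of their Fourier transforms, at every point. -/
theorem L2.integral_mul_fourierInv_sub (f Z : L2 d) (x : EuclideanSpace ℝ (Fin d)) :
    ∫ y, f y * (𝓕⁻ Z : L2 d) (x - y) =
      𝓕⁻ (fun η => (𝓕 f : L2 d) η * Z η) x := by
  have hmp : MeasurePreserving (fun y : EuclideanSpace ℝ (Fin d) => x - y) :=
    Measure.measurePreserving_sub_left volume x
  set e : EuclideanSpace ℝ (Fin d) → ℂ := fun η => (Real.fourierChar (inner ℝ η x) : ℂ) with he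
  have hec : Continuous e := by
    have : Continuous fun η : EuclideanSpace ℝ (Fin d) => Real.fourierChar (inner ℝ η x) :=
      Real.continuous_fourierChar.comp (by fun_prop)
    exact continuous_subtype_val.comp this
  have hen : ∀ η, ‖e η‖ = 1 := fun η => Circle.norm_coe _
  have hF : MemLp (fun η => e η * (𝓕 f : L2 d) η) 2 :=
    memLp_bounded_mul (C := 1) hec.aestronglyMeasurable
      (Eventually.of_forall fun η => (hen η).le) (Lp.memLp _)
  have hright : ∀ Z : L2 d, 𝓕⁻ (fun η => (𝓕 f : L2 d) η * Z η) x =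
      ∫ η, hF.toLp _ η * Z η := fun Z => by
    rw [Real.fourierInv_eq]
    apply integral_congr_ae
    filter_upwards [hF.coeFn_toLp] with η hη
    rw [hη, Circle.smul_def, smul_eq_mul, mul_assoc]
  have hleft : ∀ Z : L2 d, ∫ y, f y * (𝓕⁻ Z : L2 d) (x - y) =
      ∫ y, f y * (Lp.compMeasurePreserving _ hmp (𝓕⁻ Z : L2 d) : L2 d) y := fun Z => by
    apply integral_congr_ae
    filter_upwards [Lp.coeFn_compMeasurePreserving (𝓕⁻ Z : L2 d) hmp] with y hy
    rw [hy]; rfl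
  -- With x fixed, both sides are continuous functionals of Z ∈ L², so a dense set of Z suffices and
  -- the identity holds at every x, not only almost everywhere.
  refine (denseRange_toL2 d).induction_on (p := fun Z : L2 d =>
    ∫ y, f y * (𝓕⁻ Z : L2 d) (x - y) = 𝓕⁻ (fun η => (𝓕 f : L2 d) η * Z η) x) Z ?_ fun φ => ?_
  · simp only [hleft, hright]
    refine isClosed_eq ?_ (L2.continuous_integral_mul _)
    exact (L2.continuous_integral_mul f).comp ((Lp.isometry_compMeasurePreserving hmp).continuous.comp
      (Lp.fourierTransformₗᵢ (EuclideanSpace ℝ (Fin d)) ℂ).symm.continuous)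
  · have hφ1 : Integrable fun η => e η * φ η :=
      Integrable.bdd_mul φ.integrable hec.aestronglyMeasurable (Eventually.of_forall fun η => (hen η).le)
    have hφ2 : MemLp (fun η => e η * φ η) 2 :=
      memLp_bounded_mul (C := 1) hec.aestronglyMeasurable
        (Eventually.of_forall fun η => (hen η).le) (φ.memLp 2)
    -- Modulation by e becomes translation by x, with the reflection turning 𝓕⁻ into 𝓕.
    have h1 : ∀ y, 𝓕 (fun η => e η * φ η) y = 𝓕⁻ (φ : EuclideanSpace ℝ (Fin d) → ℂ) (x - y) := by
      intro y
      rw [Real.fourierInv_eq, Real.fourier_eq]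
      congr 1; ext η
      simp only [he, Circle.smul_def, smul_eq_mul]
      rw [← mul_assoc, inner_sub_right, sub_eq_neg_add, AddChar.map_add_eq_mul, Circle.coe_mul]
    calc _ = ∫ y, f y * (𝓕 (hφ2.toLp _) : L2 d) y := by
          apply integral_congr_ae
          rw [SchwartzMap.toLp_fourierInv_eq]
          filter_upwards [fourier_toL2_ae_eq hφ1 hφ2,
            hmp.quasiMeasurePreserving.ae (p := fun z => (𝓕⁻ φ).toLp 2 volume z = (𝓕⁻ φ) z)
              ((𝓕⁻ φ).coeFn_toLp 2 volume)] with y hy hy'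
          rw [hy, hy', h1, SchwartzMap.fourierInv_coe]
      _ = ∫ y, (𝓕 f : L2 d) y * hφ2.toLp _ y := (L2.integral_fourier_mul_eq _ _).symm
      _ = _ := by
          rw [Real.fourierInv_eq]
          apply integral_congr_ae
          filter_upwards [hφ2.coeFn_toLp, φ.coeFn_toLp 2] with y hy hy'
          rw [hy, hy', Circle.smul_def, smul_eq_mul]
          ring

end Pairing

/-! ### The kernel as a tempered distribution -/

section Kernel

variable {d : ℕ}

/-- The tempered distribution with the bounded Fourier transform `Y`. -/
def fourierKernel {Y : EuclideanSpace ℝ (Fin d) → ℂ} (hY : MemLp Y ⊤ volume) :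
    𝓢'(EuclideanSpace ℝ (Fin d), ℂ) :=
  𝓕⁻ (Lp.toTemperedDistribution (hY.toLp Y))

theorem fourierKernel_apply {Y : EuclideanSpace ℝ (Fin d) → ℂ} (hY : MemLp Y ⊤ volume)
    (φ : 𝓢(EuclideanSpace ℝ (Fin d), ℂ)) :
    fourierKernel hY φ = ∫ η, Y η * (𝓕⁻ φ) η := by
  rw [fourierKernel, TemperedDistribution.fourierInv_apply, Lp.toTemperedDistribution_apply]
  apply integral_congr_ae
  filter_upwards [hY.coeFn_toLp] with η hη
  rw [hη, smul_eq_mul, mul_comm]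

theorem exists_ae_norm_le {Y : EuclideanSpace ℝ (Fin d) → ℂ} (hY : MemLp Y ⊤ volume) :
    ∃ C, ∀ᵐ η, ‖Y η‖ ≤ C := by
  refine ⟨(eLpNormEssSup Y volume).toReal, ?_⟩
  have h : eLpNormEssSup Y volume < ⊤ := by simpa using hY.2
  filter_upwards [ae_le_eLpNormEssSup (f := Y) (μ := volume)] with η hη
  have := ENNReal.toReal_mono h.ne hη
  simpa using this

theorem integrable_mul_schwartz {Y : EuclideanSpace ℝ (Fin d) → ℂ} (hY : MemLp Y ⊤ volume)
    (φ : 𝓢(EuclideanSpace ℝ (Fin d), ℂ)) : Integrable fun η => Y η * φ η := by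
  obtain ⟨C, hC⟩ := exists_ae_norm_le hY
  exact Integrable.bdd_mul φ.integrable hY.1 hC

theorem memLp_mul_schwartz {Y : EuclideanSpace ℝ (Fin d) → ℂ} (hY : MemLp Y ⊤ volume)
    (φ : 𝓢(EuclideanSpace ℝ (Fin d), ℂ)) : MemLp (fun η => Y η * φ η) 2 := by
  obtain ⟨C, hC⟩ := exists_ae_norm_le hY
  exact memLp_bounded_mul hY.1 hC (φ.memLp 2)

theorem fourierInv_compSubConst (φ : 𝓢(EuclideanSpace ℝ (Fin d), ℂ))
    (x η : EuclideanSpace ℝ (Fin d)) :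
    (𝓕⁻ (SchwartzMap.compSubConstCLM ℂ (-x) φ)) η =
      Real.fourierChar (-inner ℝ η x) • (𝓕⁻ φ) η := by
  rw [SchwartzMap.fourierInv_coe, SchwartzMap.fourierInv_coe, Real.fourierInv_eq,
    Real.fourierInv_eq, Circle.smul_def, ← integral_smul,
    ← integral_add_right_eq_self (fun y => ((Real.fourierChar (-inner ℝ η x) : Circle) : ℂ) •
      Real.fourierChar (inner ℝ y η) • φ y) x]
  congr 1; ext y
  rw [SchwartzMap.compSubConstCLM_apply, sub_neg_eq_add, ← Circle.smul_def, smul_smul,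
    ← AddChar.map_add_eq_mul, inner_add_left, real_inner_comm x η]
  congr 2
  ring

/-- Applied to translates of φ, the kernel becomes a Fourier transform in x of a square integrable
function. This makes the pairing with an L² datum absolutely convergent. -/
theorem fourierKernel_compSubConst {Y : EuclideanSpace ℝ (Fin d) → ℂ} (hY : MemLp Y ⊤ volume)
    (φ : 𝓢(EuclideanSpace ℝ (Fin d), ℂ)) (x : EuclideanSpace ℝ (Fin d)) :
    fourierKernel hY (SchwartzMap.compSubConstCLM ℂ (-x) φ) =
      𝓕 (fun η => Y η * (𝓕⁻ φ) η) x := by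
  rw [fourierKernel_apply, Real.fourier_eq]
  congr 1; ext η
  rw [fourierInv_compSubConst, mul_smul_comm]

/-- A multiplier acts by convolution with its kernel. -/
theorem isConvolution_fourierKernel {Y : EuclideanSpace ℝ (Fin d) → ℂ} (hY : MemLp Y ⊤ volume)
    {f g : L2 d} (hg : (𝓕 g : L2 d) =ᵐ[volume] fun η => Y η * (𝓕 f : L2 d) η) :
    IsConvolution f (fourierKernel hY) g := by
  intro φ
  simp only [fourierKernel_compSubConst]
  have h1 := integrable_mul_schwartz hY (𝓕⁻ φ)
  have h2 := memLp_mul_schwartz hY (𝓕⁻ φ)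
  have h3 := fourier_toL2_ae_eq h1 h2
  have h4 : (fun x => f x * (𝓕 (h2.toLp _) : L2 d) x) =ᵐ[volume]
      fun x => f x * 𝓕 (fun η => Y η * (𝓕⁻ φ) η) x := by
    filter_upwards [h3] with x hx
    rw [hx]
  refine ⟨(L2.integrable_mul _ _).congr h4, ?_⟩
  rw [← integral_congr_ae h4, ← L2.integral_fourier_mul_eq]
  have h5 : (𝓕 ((𝓕⁻ φ).toLp 2 volume) : L2 d) = φ.toLp 2 volume := by
    rw [SchwartzMap.toLp_fourier_eq, FourierTransform.fourier_fourierInv_eq]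
  calc ∫ x, g x * φ x = ∫ x, g x * (𝓕 ((𝓕⁻ φ).toLp 2 volume) : L2 d) x := by
        rw [h5]
        apply integral_congr_ae
        filter_upwards [φ.coeFn_toLp 2 volume] with x hx
        rw [hx]
    _ = ∫ x, (𝓕 g : L2 d) x * (𝓕⁻ φ).toLp 2 volume x := (L2.integral_fourier_mul_eq _ _).symm
    _ = _ := by
        apply integral_congr_ae
        filter_upwards [(𝓕⁻ φ).coeFn_toLp 2 volume, hg, h2.coeFn_toLp] with x h6 h7 h8
        rw [h6, h7, h8]
        ring

/-- A bounded and square integrable multiplier has a square integrable kernel. -/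
theorem isRepresentedBy_fourierInv {Y : EuclideanSpace ℝ (Fin d) → ℂ} (hY : MemLp Y ⊤ volume)
    (hY2 : MemLp Y 2 volume) :
    IsRepresentedBy (fourierKernel hY) (𝓕⁻ (hY2.toLp Y) : L2 d) := by
  intro φ
  have h4 : (fun x => (𝓕⁻ (hY2.toLp Y) : L2 d) x * φ.toLp 2 volume x) =ᵐ[volume]
      fun x => (𝓕⁻ (hY2.toLp Y) : L2 d) x * φ x := by
    filter_upwards [φ.coeFn_toLp 2 volume] with x hx
    rw [hx]
  refine ⟨(L2.integrable_mul _ _).congr h4, ?_⟩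
  rw [← integral_congr_ae h4, L2.integral_fourierInv_mul_eq, SchwartzMap.toLp_fourierInv_eq,
    fourierKernel_apply]
  apply integral_congr_ae
  filter_upwards [(𝓕⁻ φ).coeFn_toLp 2 volume, hY2.coeFn_toLp] with x h1 h2
  rw [h1, h2]

/-- The product Y f̂ of two L² functions is integrable, so its inverse Fourier transform is a
continuous function, equal to the convolution at every point. The product is also ĝ, hence in L²,
and the two notions of inverse transform agree almost everywhere. -/
theorem isPointwiseConvolution_fourierInv {Y : EuclideanSpace ℝ (Fin d) → ℂ}
    (hY2 : MemLp Y 2 volume) {f g : L2 d}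
    (hg : (𝓕 g : L2 d) =ᵐ[volume] fun η => Y η * (𝓕 f : L2 d) η) :
    IsPointwiseConvolution f (𝓕⁻ (hY2.toLp Y) : L2 d) g := by
  have hint : Integrable fun η => (𝓕 f : L2 d) η * hY2.toLp Y η := L2.integrable_mul _ _
  have hg' : (𝓕 g : L2 d) =ᵐ[volume] fun η => (𝓕 f : L2 d) η * hY2.toLp Y η := by
    filter_upwards [hg, hY2.coeFn_toLp] with η h1 h2
    rw [h1, h2, mul_comm]
  have hconv : convolution f (𝓕⁻ (hY2.toLp Y) : L2 d) (ContinuousLinearMap.mul ℂ ℂ) volume =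
      𝓕⁻ (fun η => (𝓕 f : L2 d) η * hY2.toLp Y η) :=
    funext fun x => L2.integral_mul_fourierInv_sub f (hY2.toLp Y) x
  have hmem : MemLp (fun η => (𝓕 f : L2 d) η * hY2.toLp Y η) 2 :=
    (memLp_congr_ae hg').1 (Lp.memLp _)
  refine ⟨fun x => ?_, ?_, ?_⟩
  · have hmp : MeasurePreserving (fun y : EuclideanSpace ℝ (Fin d) => x - y) :=
      Measure.measurePreserving_sub_left volume x
    exact (Lp.memLp f).integrable_mul ((Lp.memLp _).comp_measurePreserving hmp)
  · rw [hconv]; exact continuous_fourierInv hint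
  · rw [hconv]
    have h1 : g = 𝓕⁻ (hmem.toLp _) := by
      have h2 : hmem.toLp _ = (𝓕 g : L2 d) := by
        apply Lp.ext
        filter_upwards [hmem.coeFn_toLp, hg'] with η h3 h4
        rw [h3, h4]
      rw [h2, FourierTransform.fourierInv_fourier_eq]
    have h2 := fourierInv_toL2_ae_eq hint hmem
    rw [← h1] at h2
    exact h2

theorem IsRepresentedBy.congr_ae {K : 𝓢'(EuclideanSpace ℝ (Fin d), ℂ)}
    {k k' : EuclideanSpace ℝ (Fin d) → ℂ} (h : IsRepresentedBy K k) (hk : k =ᵐ[volume] k') :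
    IsRepresentedBy K k' := by
  intro φ
  have e : (fun x => k x * φ x) =ᵐ[volume] fun x => k' x * φ x := by
    filter_upwards [hk] with x hx
    rw [hx]
  exact ⟨(h φ).1.congr e, (h φ).2.trans (integral_congr_ae e)⟩

theorem IsPointwiseConvolution.congr_ae {f g : L2 d} {k k' : EuclideanSpace ℝ (Fin d) → ℂ}
    (h : IsPointwiseConvolution f k g) (hk : k =ᵐ[volume] k') :
    IsPointwiseConvolution f k' g := by
  have e : convolution f k (ContinuousLinearMap.mul ℂ ℂ) volume =
      convolution f k' (ContinuousLinearMap.mul ℂ ℂ) volume :=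
    convolution_congr _ EventuallyEq.rfl hk
  refine ⟨fun x => (h.1 x).congr ?_, e ▸ h.2.1, e ▸ h.2.2⟩
  have hmp : MeasurePreserving (fun y : EuclideanSpace ℝ (Fin d) => x - y) :=
    Measure.measurePreserving_sub_left volume x
  filter_upwards [hmp.quasiMeasurePreserving.ae hk] with y hy
  simp only [hy]

/-! ### The kernel of the telegraph multiplier -/

variable {α lam t : ℝ} {m : ℝ → ℝ}

theorem measurable_multiplier_comp (hα0 : 0 < α) (hm : Measurable m) :
    Measurable fun r => multiplier α lam t (m r) := by
  have h : Continuous fun mu => multiplier α lam t mu := by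
    have h1 : (fun mu => multiplier α lam t mu) = fun mu => scalarSol α lam t mu :=
      funext fun mu => multiplier_eq_gammaSeries hα0 lam t mu
    rw [h1]
    exact (continuous_scalarSol hα0).comp (by fun_prop : Continuous fun mu : ℝ => (t, mu))
  exact h.measurable.comp hm

theorem exists_multiplier_bound (hα0 : 0 < α) (hα1 : α ≤ 1) (hlam : 0 < lam) (ht : 0 < t) :
    ∃ C, 0 ≤ C ∧ ∀ mu, 0 < mu → ‖multiplier α lam t mu‖ ≤ C := by
  obtain ⟨C, hC0, hC⟩ := exists_bound_scalar hα0 hα1 hlam t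
  refine ⟨C, hC0, fun mu hmu => ?_⟩
  rw [multiplier_eq_gammaSeries hα0]
  exact (hC mu hmu t ht.le le_rfl).1

/-- The telegraph multiplier in the frequency variable of Mathlib's Fourier transform. -/
def freqMultiplier (d : ℕ) (α lam : ℝ) (m : ℝ → ℝ) (t : ℝ) (η : EuclideanSpace ℝ (Fin d)) : ℂ :=
  multiplier α lam t (symbol m η)

theorem measurable_freqMultiplier (hα0 : 0 < α) (hm : Measurable m) :
    Measurable (freqMultiplier d α lam m t) :=
  (measurable_multiplier_comp hα0 hm).comp (measurable_norm.const_mul _)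

theorem exists_freqMultiplier_bound (hd : 1 ≤ d) (hα0 : 0 < α) (hα1 : α ≤ 1) (hlam : 0 < lam)
    (hpos : ∀ᵐ r ∂volume.restrict (Ioi (0 : ℝ)), 0 < m r) (ht : 0 < t) :
    ∃ C, 0 ≤ C ∧ ∀ᵐ η, ‖freqMultiplier d α lam m t η‖ ≤ C := by
  obtain ⟨C, hC0, hC⟩ := exists_multiplier_bound hα0 hα1 hlam ht
  refine ⟨C, hC0, ?_⟩
  filter_upwards [ae_symbol_pos hd hpos] with η hη
  exact hC _ hη

theorem memLp_top_freqMultiplier (hd : 1 ≤ d) (hα0 : 0 < α) (hα1 : α ≤ 1) (hlam : 0 < lam)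
    (hm : Measurable m) (hpos : ∀ᵐ r ∂volume.restrict (Ioi (0 : ℝ)), 0 < m r) (ht : 0 < t) :
    MemLp (freqMultiplier d α lam m t) ⊤ volume := by
  obtain ⟨C, -, hC⟩ := exists_freqMultiplier_bound hd hα0 hα1 hlam hpos ht
  exact memLp_top_of_bound (measurable_freqMultiplier hα0 hm).aestronglyMeasurable C hC

/-- The multiplier restricted to the frequencies that enter the truncated kernel. -/
def truncatedMultiplier (d : ℕ) (α lam : ℝ) (m : ℝ → ℝ) (t R : ℝ)
    (η : EuclideanSpace ℝ (Fin d)) : ℂ :=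
  (Iic R).indicator (fun r => multiplier α lam t (m r)) (2 * Real.pi * ‖η‖)

theorem norm_truncatedMultiplier_le (R : ℝ) (η : EuclideanSpace ℝ (Fin d)) :
    ‖truncatedMultiplier d α lam m t R η‖ ≤ ‖freqMultiplier d α lam m t η‖ :=
  norm_indicator_le_norm_self _ _

theorem tendsto_truncatedMultiplier (η : EuclideanSpace ℝ (Fin d)) :
    Tendsto (fun R => truncatedMultiplier d α lam m t R η) atTop
      (𝓝 (freqMultiplier d α lam m t η)) := by
  apply tendsto_const_nhds.congr'
  filter_upwards [eventually_ge_atTop (2 * Real.pi * ‖η‖)] with R hR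
  rw [truncatedMultiplier, indicator_of_mem (mem_Iic.2 hR)]
  rfl

theorem measurable_truncatedMultiplier (hα0 : 0 < α) (hm : Measurable m) (R : ℝ) :
    Measurable (truncatedMultiplier d α lam m t R) :=
  ((measurable_multiplier_comp hα0 hm).indicator measurableSet_Iic).comp
    (measurable_norm.const_mul _)

/-- Bounded and supported in a ball, hence in every L^p; p = 1 and p = 2 are used together. -/
theorem memLp_truncatedMultiplier (hd : 1 ≤ d) (hα0 : 0 < α) (hα1 : α ≤ 1) (hlam : 0 < lam)
    (hm : Measurable m) (hpos : ∀ᵐ r ∂volume.restrict (Ioi (0 : ℝ)), 0 < m r) (ht : 0 < t)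
    (R : ℝ) (p : ENNReal) : MemLp (truncatedMultiplier d α lam m t R) p volume := by
  have hπ := Real.pi_pos
  obtain ⟨C, -, hC⟩ := exists_freqMultiplier_bound hd hα0 hα1 hlam hpos ht
  have h1 : MemLp ((Metric.closedBall (0 : EuclideanSpace ℝ (Fin d)) (R / (2 * Real.pi))).indicator
      fun _ => (C : ℝ)) p volume :=
    memLp_indicator_const p Metric.isClosed_closedBall.measurableSet C
      (Or.inr measure_closedBall_lt_top.ne)
  refine h1.of_le (measurable_truncatedMultiplier hα0 hm R).aestronglyMeasurable ?_
  filter_upwards [hC] with η hη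
  by_cases h : 2 * Real.pi * ‖η‖ ≤ R
  · have h2 : η ∈ Metric.closedBall (0 : EuclideanSpace ℝ (Fin d)) (R / (2 * Real.pi)) := by
      rw [mem_closedBall_zero_iff, le_div_iff₀ (by positivity)]
      linarith
    rw [indicator_of_mem h2]
    exact (norm_truncatedMultiplier_le R η).trans (hη.trans (le_abs_self C))
  · rw [truncatedMultiplier, indicator_of_notMem (by simpa using h), norm_zero]
    exact norm_nonneg _

theorem truncatedKernel_eq_fourierInv (hd : 1 ≤ d) (hα0 : 0 < α) (hα1 : α ≤ 1) (hlam : 0 < lam)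
    (hm : Measurable m) (hpos : ∀ᵐ r ∂volume.restrict (Ioi (0 : ℝ)), 0 < m r) (ht : 0 < t)
    {R : ℝ} (hR : 0 < R) {x : EuclideanSpace ℝ (Fin d)} (hx : x ≠ 0) :
    truncatedKernel d α lam m t R x = 𝓕⁻ (truncatedMultiplier d α lam m t R) x := by
  have h := memLp_one_iff_integrable.1
    (memLp_truncatedMultiplier hd hα0 hα1 hlam hm hpos ht R 1)
  have h1 := fourierInv_radial hd hx (g := (Iic R).indicator fun r => multiplier α lam t (m r)) h
  refine Eq.trans ?_ h1.symm
  rw [truncatedKernel, intervalIntegral.integral_of_le hR.le, ← Ioi_inter_Iic,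
    ← setIntegral_indicator measurableSet_Iic]
  congr 2
  ext r
  by_cases hr : r ∈ Iic R
  · simp only [indicator_of_mem hr, hankelIntegrand]
  · simp only [indicator_of_notMem hr, mul_zero]

theorem truncatedKernel_ae_eq (hd : 1 ≤ d) (hα0 : 0 < α) (hα1 : α ≤ 1) (hlam : 0 < lam)
    (hm : Measurable m) (hpos : ∀ᵐ r ∂volume.restrict (Ioi (0 : ℝ)), 0 < m r) (ht : 0 < t)
    {R : ℝ} (hR : 0 < R) :
    truncatedKernel d α lam m t R =ᵐ[volume] 𝓕⁻ (truncatedMultiplier d α lam m t R) := by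
  have : Nonempty (Fin d) := ⟨⟨0, hd⟩⟩
  filter_upwards [Measure.ae_ne volume (0 : EuclideanSpace ℝ (Fin d))] with x hx
  exact truncatedKernel_eq_fourierInv hd hα0 hα1 hlam hm hpos ht hR hx

theorem tendsto_integral_truncatedMultiplier_mul (hα0 : 0 < α) (hm : Measurable m)
    (hY : MemLp (freqMultiplier d α lam m t) ⊤ volume)
    (φ : 𝓢(EuclideanSpace ℝ (Fin d), ℂ)) :
    Tendsto (fun R => ∫ η, truncatedMultiplier d α lam m t R η * φ η) atTop
      (𝓝 (∫ η, freqMultiplier d α lam m t η * φ η)) := by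
  refine tendsto_integral_filter_of_dominated_convergence
    (fun η => ‖freqMultiplier d α lam m t η * φ η‖) ?_ ?_
    (integrable_mul_schwartz hY φ).norm ?_
  · exact Eventually.of_forall fun R =>
      (measurable_truncatedMultiplier hα0 hm R).aestronglyMeasurable.mul
        φ.continuous.aestronglyMeasurable
  · refine Eventually.of_forall fun R => Eventually.of_forall fun η => ?_
    rw [norm_mul, norm_mul]
    gcongr
    exact norm_truncatedMultiplier_le R η
  · exact Eventually.of_forall fun η => (tendsto_truncatedMultiplier η).mul_const _

/-- The limit R → ∞ is taken on the Fourier side: there the truncated multiplier is paired with a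
Schwartz function, is dominated by the full one, and is pointwise eventually constant in R. -/
theorem isHankelKernel_fourierKernel (hd : 1 ≤ d) (hα0 : 0 < α) (hα1 : α ≤ 1) (hlam : 0 < lam)
    (hm : Measurable m) (hpos : ∀ᵐ r ∂volume.restrict (Ioi (0 : ℝ)), 0 < m r) (ht : 0 < t)
    (hY : MemLp (freqMultiplier d α lam m t) ⊤ volume) :
    IsHankelKernel d α lam m t (fourierKernel hY) := by
  refine ⟨fun x hx R hR => ?_, fun φ => ⟨fun R hR => ?_, ?_⟩⟩
  · rw [intervalIntegrable_iff_integrableOn_Ioc_of_le hR.le]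
    refine integrableOn_bessel_mul hd hx (fun r hr => hr.1) measurableSet_Ioc ?_
    obtain ⟨C, -, hC⟩ := exists_multiplier_bound hα0 hα1 hlam ht
    have h1 : ∀ᵐ r ∂volume.restrict (Ioc 0 R), ‖multiplier α lam t (m r)‖ ≤ C := by
      filter_upwards [ae_restrict_of_ae_restrict_of_subset Ioc_subset_Ioi_self hpos] with r hr
      exact hC _ hr
    have h2 : IntegrableOn (fun r : ℝ => r ^ (d - 1)) (Ioc 0 R) :=
      (Continuous.integrableOn_Ioc (by fun_prop))
    refine (h2.norm.mul_const C).mono' (((continuous_id.pow (d - 1)).measurable.smul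
      (measurable_multiplier_comp hα0 hm)).aestronglyMeasurable) ?_
    filter_upwards [h1] with r hr
    rw [norm_smul]
    gcongr
  · have h := memLp_one_iff_integrable.1
      (memLp_truncatedMultiplier hd hα0 hα1 hlam hm hpos ht R 1)
    have h1 : Integrable fun x => 𝓕⁻ (truncatedMultiplier d α lam m t R) x * φ x :=
      Integrable.bdd_mul φ.integrable (continuous_fourierInv h).aestronglyMeasurable
        (Eventually.of_forall norm_fourierInv_le)
    refine h1.congr ?_
    filter_upwards [truncatedKernel_ae_eq hd hα0 hα1 hlam hm hpos ht hR] with x hx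
    rw [hx]
  · rw [fourierKernel_apply]
    have h1 := tendsto_integral_truncatedMultiplier_mul hα0 hm hY (𝓕⁻ φ)
    refine h1.congr' ?_
    filter_upwards [eventually_gt_atTop 0] with R hR
    have h := memLp_one_iff_integrable.1
      (memLp_truncatedMultiplier hd hα0 hα1 hlam hm hpos ht R 1)
    rw [SchwartzMap.fourierInv_coe, ← integral_fourierInv_mul_eq_of_integrable h φ.integrable]
    apply integral_congr_ae
    filter_upwards [truncatedKernel_ae_eq hd hα0 hα1 hlam hm hpos ht hR] with x hx
    rw [hx]

/-! ### Square integrable and integrable multipliers -/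

theorem integrable_radial_of_integrableOn (hd : 1 ≤ d) {q : ℝ → ℝ}
    (hq : IntegrableOn (fun r : ℝ => r ^ (d - 1) * q r) (Ioi (0 : ℝ))) :
    Integrable fun η : EuclideanSpace ℝ (Fin d) => q (2 * Real.pi * ‖η‖) := by
  have hπ := Real.pi_pos
  have : Nonempty (Fin d) := ⟨⟨0, hd⟩⟩
  rw [integrable_fun_norm_addHaar volume (f := fun r => q (2 * Real.pi * r)),
    finrank_euclideanSpace_fin]
  have h1 := (integrableOn_Ioi_comp_mul_left_iff (fun r : ℝ => r ^ (d - 1) * q r) 0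
    (by positivity : 0 < 2 * Real.pi)).2 (by rwa [mul_zero])
  have h2 := h1.const_mul (((2 * Real.pi) ^ (d - 1))⁻¹)
  refine IntegrableOn.congr_fun h2 (fun r _ => ?_) measurableSet_Ioi
  simp only [smul_eq_mul, mul_pow]
  field_simp

theorem memLp_two_freqMultiplier (hd : 1 ≤ d) (hα0 : 0 < α) (hm : Measurable m)
    (h : IntegrableOn (fun r : ℝ => r ^ (d - 1) * ‖multiplier α lam t (m r)‖ ^ 2)
      (Ioi (0 : ℝ)) volume) : MemLp (freqMultiplier d α lam m t) 2 volume :=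
  (memLp_two_iff_integrable_sq_norm
    (measurable_freqMultiplier hα0 hm).aestronglyMeasurable).2
    (integrable_radial_of_integrableOn hd h)

theorem integrable_freqMultiplier (hd : 1 ≤ d) (hα0 : 0 < α) (hm : Measurable m)
    (h : IntegrableOn (fun r : ℝ => r ^ (d - 1) * ‖multiplier α lam t (m r)‖)
      (Ioi (0 : ℝ)) volume) : Integrable (freqMultiplier d α lam m t) :=
  (integrable_norm_iff (measurable_freqMultiplier hα0 hm).aestronglyMeasurable).1
    (integrable_radial_of_integrableOn hd h)

/-- Reduces the integrable case to the square integrable one, since the telegraph multiplier is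
bounded. -/
theorem memLp_two_of_integrable {Y : EuclideanSpace ℝ (Fin d) → ℂ} (hY : MemLp Y ⊤ volume)
    (h : Integrable Y) : MemLp Y 2 volume := by
  obtain ⟨C, hC⟩ := exists_ae_norm_le hY
  rw [memLp_two_iff_integrable_sq_norm h.1]
  refine (h.norm.const_mul C).mono' (h.1.norm.pow 2) ?_
  filter_upwards [hC] with η hη
  rw [norm_pow, norm_norm, sq]
  gcongr

/-- By Plancherel this is the L² convergence of the truncated multipliers, which is dominated
convergence. -/
theorem tendsto_eLpNorm_truncatedKernel (hd : 1 ≤ d) (hα0 : 0 < α) (hα1 : α ≤ 1)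
    (hlam : 0 < lam) (hm : Measurable m)
    (hpos : ∀ᵐ r ∂volume.restrict (Ioi (0 : ℝ)), 0 < m r) (ht : 0 < t)
    (hY2 : MemLp (freqMultiplier d α lam m t) 2 volume) :
    Tendsto (fun R : ℝ => eLpNorm (fun x => truncatedKernel d α lam m t R x -
      (𝓕⁻ (hY2.toLp _) : L2 d) x) 2 volume) atTop (𝓝 0) := by
  have hR2 := fun R => memLp_truncatedMultiplier hd hα0 hα1 hlam hm hpos ht R 2
  have h1 : Tendsto (fun R => ‖(hR2 R).toLp _ - hY2.toLp _‖) atTop (𝓝 0) := by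
    refine tendsto_norm_zero_of_dominated
      (χ := fun R η => truncatedMultiplier d α lam m t R η - freqMultiplier d α lam m t η)
      (B := fun η => 2 * ‖freqMultiplier d α lam m t η‖) (Eventually.of_forall fun R => ?_)
      (hY2.norm.const_mul 2) (Eventually.of_forall fun R => Eventually.of_forall fun η => ?_)
      (Eventually.of_forall fun η => ?_)
    · filter_upwards [Lp.coeFn_sub ((hR2 R).toLp _) (hY2.toLp _), (hR2 R).coeFn_toLp,
        hY2.coeFn_toLp] with η h1 h2 h3
      rw [h1, Pi.sub_apply, h2, h3]
    · refine (norm_sub_le _ _).trans ?_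
      linarith [norm_truncatedMultiplier_le (α := α) (lam := lam) (m := m) (t := t) R η]
    · rw [← sub_self (freqMultiplier d α lam m t η)]
      exact (tendsto_truncatedMultiplier η).sub_const _
  have h2 : Tendsto (fun R => ENNReal.ofReal ‖(hR2 R).toLp _ - hY2.toLp _‖) atTop (𝓝 0) := by
    have h := (ENNReal.continuous_ofReal.tendsto 0).comp h1
    rwa [ENNReal.ofReal_zero] at h
  refine h2.congr' ?_
  filter_upwards [eventually_gt_atTop 0] with R hR
  have h3 : ‖(hR2 R).toLp _ - hY2.toLp _‖ =
      ‖(𝓕⁻ ((hR2 R).toLp _) : L2 d) - (𝓕⁻ (hY2.toLp _) : L2 d)‖ := by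
    have h := (Lp.fourierTransformₗᵢ (EuclideanSpace ℝ (Fin d)) ℂ).symm.norm_map
      ((hR2 R).toLp _ - hY2.toLp _)
    rw [map_sub] at h
    exact h.symm
  rw [h3, Lp.norm_def, ENNReal.ofReal_toReal (Lp.eLpNorm_ne_top _)]
  apply eLpNorm_congr_ae
  have h4 := memLp_one_iff_integrable.1
    (memLp_truncatedMultiplier hd hα0 hα1 hlam hm hpos ht R 1)
  filter_upwards [Lp.coeFn_sub (𝓕⁻ ((hR2 R).toLp _) : L2 d) (𝓕⁻ (hY2.toLp _) : L2 d),
    fourierInv_toL2_ae_eq h4 (hR2 R),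
    truncatedKernel_ae_eq hd hα0 hα1 hlam hm hpos ht hR] with x h5 h6 h7
  rw [h5, Pi.sub_apply, h6, h7]

/-- L² convergence gives almost everywhere convergence along a sequence of radii, and wherever the
full limit exists it must coincide with the limit along that sequence. The exceptional null set does
not depend on c. -/
theorem ae_eq_of_tendsto_truncatedKernel (hd : 1 ≤ d) (hα0 : 0 < α) (hα1 : α ≤ 1)
    (hlam : 0 < lam) (hm : Measurable m)
    (hpos : ∀ᵐ r ∂volume.restrict (Ioi (0 : ℝ)), 0 < m r) (ht : 0 < t)
    (hY2 : MemLp (freqMultiplier d α lam m t) 2 volume) :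
    ∀ᵐ x, ∀ c : ℂ, Tendsto (fun R : ℝ => truncatedKernel d α lam m t R x) atTop (𝓝 c) →
      (𝓕⁻ (hY2.toLp _) : L2 d) x = c := by
  have h1 : Tendsto (fun n : ℕ => ((n + 1 : ℕ) : ℝ)) atTop atTop :=
    tendsto_natCast_atTop_atTop.comp (tendsto_add_atTop_nat 1)
  have h2 := (tendsto_eLpNorm_truncatedKernel hd hα0 hα1 hlam hm hpos ht hY2).comp h1
  have h3 : TendstoInMeasure volume (fun (n : ℕ) => truncatedKernel d α lam m t ((n + 1 : ℕ) : ℝ))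
      atTop (𝓕⁻ (hY2.toLp _) : L2 d) := by
    refine tendstoInMeasure_of_tendsto_eLpNorm two_ne_zero (fun n => ?_)
      (Lp.aestronglyMeasurable _) h2
    have hR : (0 : ℝ) < ((n + 1 : ℕ) : ℝ) := by positivity
    have h4 := memLp_one_iff_integrable.1
      (memLp_truncatedMultiplier hd hα0 hα1 hlam hm hpos ht ((n + 1 : ℕ) : ℝ) 1)
    exact (continuous_fourierInv h4).aestronglyMeasurable.congr
      (truncatedKernel_ae_eq hd hα0 hα1 hlam hm hpos ht hR).symm
  obtain ⟨ns, hns, hlim⟩ := h3.exists_seq_tendsto_ae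
  filter_upwards [hlim] with x hx c hc
  exact tendsto_nhds_unique hx (hc.comp (h1.comp hns.tendsto_atTop))

theorem hankelKernel_ae_eq (hd : 1 ≤ d) (hY1 : Integrable (freqMultiplier d α lam m t))
    (hY2 : MemLp (freqMultiplier d α lam m t) 2 volume) :
    (𝓕⁻ (hY2.toLp _) : L2 d) =ᵐ[volume] hankelKernel d α lam m t := by
  have : Nonempty (Fin d) := ⟨⟨0, hd⟩⟩
  filter_upwards [fourierInv_toL2_ae_eq hY1 hY2,
    Measure.ae_ne volume (0 : EuclideanSpace ℝ (Fin d))] with x h1 hx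
  rw [h1]
  exact fourierInv_radial hd hx (g := fun r => multiplier α lam t (m r)) hY1

theorem integrableOn_hankelIntegrand (hd : 1 ≤ d) (hα0 : 0 < α) (hm : Measurable m)
    (h : IntegrableOn (fun r : ℝ => r ^ (d - 1) * ‖multiplier α lam t (m r)‖)
      (Ioi (0 : ℝ)) volume) {x : EuclideanSpace ℝ (Fin d)} (hx : x ≠ 0) :
    IntegrableOn (hankelIntegrand d α lam m t x) (Ioi (0 : ℝ)) volume := by
  refine integrableOn_bessel_mul hd hx subset_rfl measurableSet_Ioi ?_
  refine (integrable_norm_iff ?_).1 ?_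
  · exact ((continuous_id.pow (d - 1)).measurable.smul
      (measurable_multiplier_comp hα0 hm)).aestronglyMeasurable
  · refine IntegrableOn.congr_fun h (fun r (hr : 0 < r) => ?_) measurableSet_Ioi
    rw [norm_smul, Real.norm_of_nonneg (by positivity)]

end Kernel

/-! ### Fourier transform of an arbitrary solution -/

section Solution

variable {d : ℕ} {α lam : ℝ} {m : ℝ → ℝ} {H : Submodule ℂ (L2 d)} [CompleteSpace H]
  {A : H →ₗ.[ℂ] H}

/-- Uniqueness transfers the explicit formula from the constructed solution to any given one. -/
theorem IsSolution.fourier_ae_eq (hd : 1 ≤ d) (hα0 : 0 < α) (hα1 : α ≤ 1) (hlam : 0 < lam)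
    (hm : Measurable m) (hpos : ∀ᵐ r ∂volume.restrict (Ioi (0 : ℝ)), 0 < m r)
    (hA : IsSelfAdjoint A) (hAm : IsRadialFourierMultiplier m H A) {f : H} (hf : f ∈ A.domain)
    {u : ℝ → H} (hu : IsSolution A α lam f u) {t : ℝ} (ht : 0 < t) :
    (𝓕 (u t : L2 d) : L2 d) =ᵐ[volume]
      fun η => freqMultiplier d α lam m t η * (𝓕 (f : L2 d) : L2 d) η := by
  obtain ⟨v, hv, hvF⟩ := exists_isSolution hα0 hα1 hlam hm hA hAm (ae_symbol_pos hd hpos) hf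
  rw [hv.unique hα0 hα1 hlam hm hAm hu t ht.le]
  filter_upwards [hvF t ht.le] with η hη
  rw [hη, freqMultiplier, multiplier_eq_gammaSeries hα0]
  rfl

end Solution

end FracTelegraph

end

/-! ### The main theorem -/

theorem theorem1 (d : ℕ) (hd : 1 ≤ d) (α lam : ℝ) (hα0 : 0 < α) (hα1 : α ≤ 1) (hlam : 0 < lam)
    (m : ℝ → ℝ) (hm : Measurable m) (hpos : ∀ᵐ r ∂volume.restrict (Ioi (0 : ℝ)), 0 < m r)
    (H : Submodule ℂ (FracTelegraph.L2 d)) [CompleteSpace H]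
    (A : H →ₗ.[ℂ] H) (hA : IsSelfAdjoint A)
    (hAm : FracTelegraph.IsRadialFourierMultiplier m H A) :
    -- the Cauchy problem has exactly one solution
    (∀ f : H, f ∈ A.domain → ∃ u : ℝ → H, FracTelegraph.IsSolution A α lam f u ∧
      ∀ v : ℝ → H, FracTelegraph.IsSolution A α lam f v → ∀ t : ℝ, 0 ≤ t → v t = u t) ∧
    ∃ Φ : ℝ → 𝓢'(EuclideanSpace ℝ (Fin d), ℂ),
      -- the kernel is the Hankel-type integral
      (∀ t : ℝ, 0 < t → FracTelegraph.IsHankelKernel d α lam m t (Φ t)) ∧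
      -- the solution is the convolution of the datum with the kernel
      (∀ f : H, f ∈ A.domain → ∀ u : ℝ → H, FracTelegraph.IsSolution A α lam f u →
        ∀ t : ℝ, 0 < t →
          FracTelegraph.IsConvolution (f : FracTelegraph.L2 d) (Φ t) (u t : FracTelegraph.L2 d)) ∧
      -- square integrable multiplier: the kernel is a function in `L²`, equal to the improper
      -- integral wherever that converges, and the convolution is an absolutely convergent integral
      (∀ t : ℝ, 0 < t →
        IntegrableOn (fun r : ℝ => r ^ (d - 1) *
          ‖FracTelegraph.multiplier α lam t (m r)‖ ^ 2) (Ioi (0 : ℝ)) volume →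
        ∃ k : EuclideanSpace ℝ (Fin d) → ℂ, MemLp k 2 volume ∧
          Tendsto (fun R : ℝ => eLpNorm
            (fun x => FracTelegraph.truncatedKernel d α lam m t R x - k x) 2 volume)
            atTop (𝓝 0) ∧
          (∀ᵐ x, ∀ c : ℂ,
            Tendsto (fun R : ℝ => FracTelegraph.truncatedKernel d α lam m t R x) atTop (𝓝 c) →
            k x = c) ∧
          FracTelegraph.IsRepresentedBy (Φ t) k ∧
          ∀ f : H, f ∈ A.domain → ∀ u : ℝ → H, FracTelegraph.IsSolution A α lam f u →
            FracTelegraph.IsPointwiseConvolution (f : FracTelegraph.L2 d) k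
              (u t : FracTelegraph.L2 d)) ∧
      -- integrable multiplier: the kernel is the absolutely convergent Hankel-type integral
      (∀ t : ℝ, 0 < t →
        IntegrableOn (fun r : ℝ => r ^ (d - 1) *
          ‖FracTelegraph.multiplier α lam t (m r)‖) (Ioi (0 : ℝ)) volume →
        (∀ x : EuclideanSpace ℝ (Fin d), x ≠ 0 →
          IntegrableOn (FracTelegraph.hankelIntegrand d α lam m t x) (Ioi (0 : ℝ)) volume) ∧
        FracTelegraph.IsRepresentedBy (Φ t) (FracTelegraph.hankelKernel d α lam m t) ∧
        ∀ f : H, f ∈ A.domain → ∀ u : ℝ → H, FracTelegraph.IsSolution A α lam f u →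
          FracTelegraph.IsPointwiseConvolution (f : FracTelegraph.L2 d)
            (FracTelegraph.hankelKernel d α lam m t) (u t : FracTelegraph.L2 d)) := by
  classical
  have hY : ∀ t : ℝ, 0 < t → MemLp (FracTelegraph.freqMultiplier d α lam m t) ⊤ volume :=
    fun t ht => FracTelegraph.memLp_top_freqMultiplier hd hα0 hα1 hlam hm hpos ht
  refine ⟨fun f hf => ?_, fun t => if ht : 0 < t then FracTelegraph.fourierKernel (hY t ht) else 0,
    fun t ht => ?_, fun f hf u hu t ht => ?_, fun t ht h => ?_, fun t ht h => ?_⟩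
  · obtain ⟨u, hu, -⟩ := FracTelegraph.exists_isSolution hα0 hα1 hlam hm hA hAm
      (FracTelegraph.ae_symbol_pos hd hpos) hf
    exact ⟨u, hu, fun v hv => hu.unique hα0 hα1 hlam hm hAm hv⟩
  · simp only [dif_pos ht]
    exact FracTelegraph.isHankelKernel_fourierKernel hd hα0 hα1 hlam hm hpos ht (hY t ht)
  · simp only [dif_pos ht]
    exact FracTelegraph.isConvolution_fourierKernel (hY t ht)
      (hu.fourier_ae_eq hd hα0 hα1 hlam hm hpos hA hAm hf ht)
  · simp only [dif_pos ht]
    have hY2 := FracTelegraph.memLp_two_freqMultiplier hd hα0 hm h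
    exact ⟨_, Lp.memLp _,
      FracTelegraph.tendsto_eLpNorm_truncatedKernel hd hα0 hα1 hlam hm hpos ht hY2,
      FracTelegraph.ae_eq_of_tendsto_truncatedKernel hd hα0 hα1 hlam hm hpos ht hY2,
      FracTelegraph.isRepresentedBy_fourierInv (hY t ht) hY2,
      fun f hf u hu => FracTelegraph.isPointwiseConvolution_fourierInv hY2
        (hu.fourier_ae_eq hd hα0 hα1 hlam hm hpos hA hAm hf ht)⟩
  · simp only [dif_pos ht]
    have hY1 := FracTelegraph.integrable_freqMultiplier hd hα0 hm h
    have hY2 := FracTelegraph.memLp_two_of_integrable (hY t ht) hY1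
    have hk := FracTelegraph.hankelKernel_ae_eq hd hY1 hY2
    exact ⟨fun x hx => FracTelegraph.integrableOn_hankelIntegrand hd hα0 hm h hx,
      (FracTelegraph.isRepresentedBy_fourierInv (hY t ht) hY2).congr_ae hk,
      fun f hf u hu => (FracTelegraph.isPointwiseConvolution_fourierInv hY2
        (hu.fourier_ae_eq hd hα0 hα1 hlam hm hpos hA hAm hf ht)).congr_ae hk⟩
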